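/- Write $\lg$ for the binary logarithm. The model is the word RAM with word size $w=\Theta(\lg n)$: words are $w$-bit strings, and reading or writing a memory cell, arithmetic (including multiplication and division), bitwise operations, shifts and comparisons on words take unit time. Space is counted in bits, as $w$ times the number of memory cells and registers used. Theorem. Let $G$ be a graph (undirected or directed) with vertex set $V$, $|V|=n\ge 1$, and $m$ edges, let $G'\subseteq G$ be a spanning subgraph with $m'$ edges, and let $d'=m'/n$. The degree of a vertex $v$ in a graph is the number of vertices $u$ such that $(v,u)$ is an edge (in the directed case, the out-degree). Suppose that $G'$ is created dynamically: starting from the graph on $V$ without edges, the edges of $G'$ are inserted one by one, in an arbitrary order. Then the degree sequence can be maintained online by fixed word RAM programs (one collection for undirected and one for directed graphs), which are given only $n$ and, one after another, the inserted edges, such that: 1. the whole construction (the initialization, all insertions, and the final compaction described in 3) takes $O(m+n)$ time in total; 2. at every moment of the construction the space used is $O\bigl(n(\lg(d'+2)+\lg\lg (n+2))\bigr)$ bits, and after every insertion the current degree of any vertex can be returned in $O(1)$ time; 3. at the end the degree sequence of $G'$ is compacted into a representation of $O(n\lg (d'+2))$ bits, from which the degree in $G'$ of any vertex can be returned in $O(1)$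 time. The constants hidden in the $O$-bounds depend only on the constants in $w=\Theta(\lg n)$; the lower constant there (a sufficiently large multiple of $\lg(n+2)$) is fixed along with the programs, and the upper constant is arbitrary. -/

import Mathlib

/-! ### A word RAM

Words are `w`-bit strings, a program has finitely many registers holding one word each, and a
memory of words that is addressed by words. Programs are structured (`while`) programs; all the
usual word instructions take unit time. -/

namespace WordRAM

/-- The unit-time binary instructions on words (unsigned, modulo `2 ^ w`). -/
inductive BinOp
  | add | sub | mul | div | mod | band | bor | bxor | shl | shr | lt | eq

def BinOp.eval {w : ℕ} : BinOp → BitVec w → BitVec w → BitVec w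
  | .add, x, y => x + y
  | .sub, x, y => x - y
  | .mul, x, y => x * y
  | .div, x, y => x / y
  | .mod, x, y => x % y
  | .band, x, y => x &&& y
  | .bor, x, y => x ||| y
  | .bxor, x, y => x ^^^ y
  | .shl, x, y => x <<< y
  | .shr, x, y => x >>> y
  | .lt, x, y => if x < y then 1 else 0
  | .eq, x, y => if x = y then 1 else 0

/-- Expressions over the registers: fixed constants, the word size, register contents, and
binary instructions. -/
inductive Expr
  | const (k : ℕ)
  | wordSize
  | reg (x : ℕ)
  | bin (op : BinOp) (a b : Expr)

def Expr.eval {w : ℕ} (r : ℕ → BitVec w) : Expr → BitVec w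
  | .const k => BitVec.ofNat w k
  | .wordSize => BitVec.ofNat w w
  | .reg x => r x
  | .bin op a b => op.eval (a.eval r) (b.eval r)

/-- The time for evaluating an expression: one step for each of its nodes. -/
def Expr.cost : Expr → ℕ
  | .const _ => 1
  | .wordSize => 1
  | .reg _ => 1
  | .bin _ a b => a.cost + b.cost + 1

/-- All registers occurring in the expression have an index below this number. -/
def Expr.numRegs : Expr → ℕ
  | .const _ => 0
  | .wordSize => 0
  | .reg x => x + 1
  | .bin _ a b => max a.numRegs b.numRegs

/-- Programs. `load x a` reads the memory cell with address `a` into register `x`;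
`store a e` writes the value of `e` into the memory cell with address `a`; a test of `ite` and
`loop` (a while loop) succeeds when its value is nonzero. -/
inductive Cmd
  | skip
  | assign (x : ℕ) (e : Expr)
  | load (x : ℕ) (a : Expr)
  | store (a e : Expr)
  | seq (p q : Cmd)
  | ite (e : Expr) (p q : Cmd)
  | loop (e : Expr) (p : Cmd)

/-- All registers occurring in the program have an index below this number. -/
def Cmd.numRegs : Cmd → ℕ
  | .skip => 0
  | .assign x e => max (x + 1) e.numRegs
  | .load x a => max (x + 1) a.numRegs
  | .store a e => max a.numRegs e.numRegs
  | .seq p q => max p.numRegs q.numRegs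
  | .ite e p q => max e.numRegs (max p.numRegs q.numRegs)
  | .loop e p => max e.numRegs p.numRegs

structure State (w : ℕ) where
  regs : ℕ → BitVec w
  mem : ℕ → BitVec w

/-- `Exec S p s t s'`: started in state `s`, the program `p` halts in state `s'` after exactly `t`
steps, and every memory cell that it reads or writes on the way has an address below `S`. -/
inductive Exec {w : ℕ} (S : ℕ) : Cmd → State w → ℕ → State w → Prop
  | skip (s : State w) : Exec S .skip s 1 s
  | assign (x : ℕ) (e : Expr) (s : State w) :
      Exec S (.assign x e) s (e.cost + 1) ⟨Function.update s.regs x (e.eval s.regs), s.mem⟩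
  | load (x : ℕ) (a : Expr) (s : State w) (h : (a.eval s.regs).toNat < S) :
      Exec S (.load x a) s (a.cost + 1)
        ⟨Function.update s.regs x (s.mem (a.eval s.regs).toNat), s.mem⟩
  | store (a e : Expr) (s : State w) (h : (a.eval s.regs).toNat < S) :
      Exec S (.store a e) s (a.cost + e.cost + 1)
        ⟨s.regs, Function.update s.mem (a.eval s.regs).toNat (e.eval s.regs)⟩
  | seq {p q : Cmd} {s s' s'' : State w} {t t' : ℕ} (hp : Exec S p s t s')
      (hq : Exec S q s' t' s'') : Exec S (.seq p q) s (t + t') s''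
  | iteTrue {e : Expr} {p q : Cmd} {s s' : State w} {t : ℕ} (h : e.eval s.regs ≠ 0)
      (hp : Exec S p s t s') : Exec S (.ite e p q) s (e.cost + 1 + t) s'
  | iteFalse {e : Expr} {p q : Cmd} {s s' : State w} {t : ℕ} (h : e.eval s.regs = 0)
      (hq : Exec S q s t s') : Exec S (.ite e p q) s (e.cost + 1 + t) s'
  | loopStop {e : Expr} {p : Cmd} {s : State w} (h : e.eval s.regs = 0) :
      Exec S (.loop e p) s (e.cost + 1) s
  | loopStep {e : Expr} {p : Cmd} {s s' s'' : State w} {t t' : ℕ} (h : e.eval s.regs ≠ 0)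
      (hp : Exec S p s t s') (hl : Exec S (.loop e p) s' t' s'') :
      Exec S (.loop e p) s (e.cost + 1 + t + t') s''

/-- The registers at the start of a call: the arguments in registers `0, 1, …`, and `0` elsewhere.
So nothing but the memory survives from one call to the next. -/
def argRegs (w : ℕ) (args : List ℕ) : ℕ → BitVec w :=
  fun i => BitVec.ofNat w (args.getD i 0)

/-- Calling `p` on `args` with memory `M` takes `t` steps, accesses only memory cells with
addresses below `S`, and leaves the memory `M'`. -/
def Updates {w : ℕ} (S : ℕ) (p : Cmd) (args : List ℕ) (M : ℕ → BitVec w) (t : ℕ)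
    (M' : ℕ → BitVec w) : Prop :=
  ∃ r' : ℕ → BitVec w, Exec S p ⟨argRegs w args, M⟩ t ⟨r', M'⟩

/-- Calling `p` on `args` with memory `M` takes `t` steps, accesses only memory cells with
addresses below `S`, leaves the memory as it was, and returns the number `y` in register `0`. -/
def Returns {w : ℕ} (S : ℕ) (p : Cmd) (args : List ℕ) (M : ℕ → BitVec w) (t : ℕ) (y : ℕ) : Prop :=
  ∃ r' : ℕ → BitVec w, Exec S p ⟨argRegs w args, M⟩ t ⟨r', M⟩ ∧ (r' 0).toNat = y

end WordRAM

open WordRAM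

/-! ### Dynamic degree sequences -/

/-- The programs of a dynamic degree sequence: `init` (argument: the number of vertices) sets up
the empty graph, `insert` (arguments: the two ends) adds an edge, `degree` (argument: a vertex) is
the degree query during the construction, `compact` turns the result of the construction into
the final representation, and `finalDegree` (argument: a vertex) is the degree query there. -/
structure DegreeSequenceProgram where
  init : Cmd
  insert : Cmd
  degree : Cmd
  compact : Cmd
  finalDegree : Cmd

/-- A number of registers that suffices for each of the programs. -/
def DegreeSequenceProgram.numRegs (P : DegreeSequenceProgram) : ℕ :=
  max P.init.numRegs (max P.insert.numRegs (max P.degree.numRegs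
    (max P.compact.numRegs P.finalDegree.numRegs)))

/-- With word size `w` and all memory cells `0` at the beginning, `P` maintains the degree sequence
of a graph on `n` vertices, initially without edges, while the edges in the list `edges` are
inserted one by one, and then compacts it. Here `deg k v` is the degree of `v` in the graph formed
by the first `k` edges, and `finalDeg v` the degree of `v` in the final graph. The whole
construction takes at most `time` steps and uses at most `space` bits (memory cells and registers),
each degree query takes at most `queryTime` steps, and the final representation takes at most
`finalSpace` bits. -/
def DegreeSequenceProgram.Maintains (P : DegreeSequenceProgram) (n w : ℕ)
    (edges : List (Fin n × Fin n)) (deg : ℕ → Fin n → ℕ) (finalDeg : Fin n → ℕ)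
    (time space finalSpace : ℝ) (queryTime : ℕ) : Prop :=
  ∃ (S Sfinal : ℕ) (M : ℕ → ℕ → BitVec w) (Mfinal : ℕ → BitVec w)
    (tInit : ℕ) (t : Fin edges.length → ℕ) (tCompact : ℕ),
    Updates S P.init [n] (fun _ => 0) tInit (M 0) ∧
    (∀ k : Fin edges.length,
      Updates S P.insert [((edges.get k).1 : ℕ), ((edges.get k).2 : ℕ)] (M k) (t k) (M (k + 1))) ∧
    (∀ k ≤ edges.length, ∀ v : Fin n,
      ∃ τ ≤ queryTime, Returns S P.degree [(v : ℕ)] (M k) τ (deg k v)) ∧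
    Updates S P.compact [] (M edges.length) tCompact Mfinal ∧
    (∀ v : Fin n,
      ∃ τ ≤ queryTime, Returns Sfinal P.finalDegree [(v : ℕ)] Mfinal τ (finalDeg v)) ∧
    ((tInit + ∑ k, t k + tCompact : ℕ) : ℝ) ≤ time ∧
    (((S + P.numRegs) * w : ℕ) : ℝ) ≤ space ∧
    (((Sfinal + P.numRegs) * w : ℕ) : ℝ) ≤ finalSpace

/-- The list contains every edge of the undirected graph `H` exactly once, each in one of its two
orientations, and nothing else. -/
def EnumeratesEdges {n : ℕ} (H : SimpleGraph (Fin n)) (edges : List (Fin n × Fin n)) : Prop :=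
  (edges.map fun p => s(p.1, p.2)).Nodup ∧
    ∀ e : Sym2 (Fin n), (e ∈ edges.map fun p => s(p.1, p.2)) ↔ e ∈ H.edgeSet

/-- The degree of `v` in the undirected graph formed by the first `k` edges of the list. -/
noncomputable def degreeAfter {n : ℕ} (edges : List (Fin n × Fin n)) (k : ℕ) (v : Fin n) : ℕ :=
  {u : Fin n | s(v, u) ∈ (edges.take k).map fun p => s(p.1, p.2)}.ncard

/-- The list contains every edge of the directed graph `H` exactly once, and nothing else. -/
def EnumeratesArcs {n : ℕ} (H : Digraph (Fin n)) (edges : List (Fin n × Fin n)) : Prop :=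
  edges.Nodup ∧ ∀ p : Fin n × Fin n, p ∈ edges ↔ H.Adj p.1 p.2

/-- The number of edges of a directed graph. -/
noncomputable def numArcs {n : ℕ} (H : Digraph (Fin n)) : ℕ :=
  {p : Fin n × Fin n | H.Adj p.1 p.2}.ncard

/-- The degree of `v` (the number of `u` such that `(v, u)` is an edge) in the directed graph
formed by the first `k` edges of the list. -/
noncomputable def outDegreeAfter {n : ℕ} (edges : List (Fin n × Fin n)) (k : ℕ) (v : Fin n) : ℕ :=
  {u : Fin n | (v, u) ∈ edges.take k}.ncard

/-- Binary logarithm. -/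
noncomputable def lg (x : ℝ) : ℝ := Real.logb 2 x

namespace WordRAM

/-! ### Reasoning about programs with natural numbers instead of words -/

/-! Let `b` be about a quarter of lg n, and cut the vertices into groups of `b` consecutive ones.
The degrees of a group lie in fields of variable width, packed into chunks of fewer than `8 * b`
bits, one chunk per word. The low `b` bits of a chunk mark the ends of its fields, and a boundary
word of `b` bits per group marks the last item of each chunk. Finding a field therefore amounts to
counting and locating ones in two `b`-bit strings. Tables of `pop` and `sel` for all such strings
take only O(n) bits, so that a degree is read in constant time (`wp_decode`).

Space. A degree d gets a field of width at least `codeLength L₀ s d`, which is max(L₀, size(d + s)).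
Packing is greedy: when a chunk is closed, its contents and the next code together exceed `b` bits,
so the number of chunks is at most one more than twice the total code length divided by `b`
(`Encoder.Inv.cnt_le_div`). As a word has Θ(`b`) bits, the space is O(n) plus a constant times the
total code length. By concavity of the logarithm the degrees themselves contribute at most n lg(d' +
2) + 5n (`sum_size_le`). During the construction s = `b * b` and L₀ = size(`b * b`), which costs a
further O(lg b) = O(lg lg n) bits per vertex; after compaction s = 0 and L₀ = 1, and only O(1) bits
per vertex remain on top. A group that outgrows its area moves to a new one of twice the required
size; the abandoned areas form a geometric series and are never reused (`Store.Inv.install`).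

Time. An increment adds a power of two to a chunk unless the field is full. In that case the whole
group is encoded anew in O(`b * b`) steps. The slack s = `b * b` ensures that a full field has
received at least `b * b` increments since its group was last encoded, so the amortized cost is O(1)
(`wp_increment`). The first encoding of a group happens when all its degrees are zero and costs
O(`b`), hence O(n) over all groups.

The programs are verified on natural numbers in place of words, with a clock in the postcondition
(`wp`). They implement abstract operations whose correctness is expressed by `Encodes`,
`Encoder.Inv`, `Store.Inv` and `DynamicInv`; `maintains_of_insert` combines everything with the
numerical bounds. -/

instance : Add Expr := ⟨.bin .add⟩
instance : Sub Expr := ⟨.bin .sub⟩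
instance : Mul Expr := ⟨.bin .mul⟩
instance : Div Expr := ⟨.bin .div⟩
instance : Mod Expr := ⟨.bin .mod⟩
instance : ShiftLeft Expr := ⟨.bin .shl⟩
instance : ShiftRight Expr := ⟨.bin .shr⟩

/-- The value of an instruction on natural numbers, without wrap-around. -/
def BinOp.natEval : BinOp → ℕ → ℕ → ℕ
  | .add, x, y => x + y
  | .sub, x, y => x - y
  | .mul, x, y => x * y
  | .div, x, y => x / y
  | .mod, x, y => x % y
  | .band, x, y => x &&& y
  | .bor, x, y => x ||| y
  | .bxor, x, y => x ^^^ y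
  | .shl, x, y => x * 2 ^ y
  | .shr, x, y => x / 2 ^ y
  | .lt, x, y => if x < y then 1 else 0
  | .eq, x, y => if x = y then 1 else 0

/-- A condition under which the instruction on words agrees with the one on numbers. -/
def BinOp.Fits (w : ℕ) : BinOp → ℕ → ℕ → Prop
  | .sub, x, y => y ≤ x
  | .div, x, y | .mod, x, y | .shr, x, y | .lt, x, y | .eq, x, y => x < 2 ^ w ∧ y < 2 ^ w
  | .shl, _, y => y < 2 ^ w
  | _, _, _ => True

/-- Reduction modulo `2 ^ w` respects sums, products and bitwise operations unconditionally, and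
differences as soon as the natural subtraction does not truncate. Only instructions that look at the
size of an operand require that operand to be a genuine word. -/
theorem BinOp.eval_ofNat {w : ℕ} (op : BinOp) {x y : ℕ} (h : op.Fits w x y) :
    op.eval (BitVec.ofNat w x) (BitVec.ofNat w y) = BitVec.ofNat w (op.natEval x y) := by
  cases op <;> simp only [BinOp.Fits] at h <;> simp only [BinOp.eval, BinOp.natEval]
  · exact (BitVec.ofNat_add ..).symm
  · obtain ⟨z, rfl⟩ := Nat.exists_eq_add_of_le h
    rw [BitVec.ofNat_add, Nat.add_sub_cancel_left, add_sub_cancel_left]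
  · exact (BitVec.ofNat_mul ..).symm
  · apply BitVec.eq_of_toNat_eq
    rw [BitVec.toNat_udiv]
    simp only [BitVec.toNat_ofNat, Nat.mod_eq_of_lt h.1, Nat.mod_eq_of_lt h.2]
    exact (Nat.mod_eq_of_lt ((Nat.div_le_self _ _).trans_lt h.1)).symm
  · apply BitVec.eq_of_toNat_eq
    rw [BitVec.toNat_umod]
    simp only [BitVec.toNat_ofNat, Nat.mod_eq_of_lt h.1, Nat.mod_eq_of_lt h.2]
    exact (Nat.mod_eq_of_lt ((Nat.mod_le _ _).trans_lt h.1)).symm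
  · apply BitVec.eq_of_toNat_eq
    simp
  · apply BitVec.eq_of_toNat_eq
    simp
  · apply BitVec.eq_of_toNat_eq
    simp
  · apply BitVec.eq_of_toNat_eq
    rw [BitVec.shiftLeft_eq', BitVec.toNat_shiftLeft]
    simp only [BitVec.toNat_ofNat, Nat.mod_eq_of_lt h, Nat.shiftLeft_eq, Nat.mod_mul_mod]
  · apply BitVec.eq_of_toNat_eq
    rw [BitVec.ushiftRight_eq', BitVec.toNat_ushiftRight]
    simp only [BitVec.toNat_ofNat, Nat.mod_eq_of_lt h.1, Nat.mod_eq_of_lt h.2,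
      Nat.shiftRight_eq_div_pow]
    exact (Nat.mod_eq_of_lt ((Nat.div_le_self _ _).trans_lt h.1)).symm
  · simp only [BitVec.lt_def, BitVec.toNat_ofNat, Nat.mod_eq_of_lt h.1, Nat.mod_eq_of_lt h.2]
    split_ifs <;> rfl
  · have : BitVec.ofNat w x = BitVec.ofNat w y ↔ x = y := by
      rw [← BitVec.toNat_inj]
      simp only [BitVec.toNat_ofNat, Nat.mod_eq_of_lt h.1, Nat.mod_eq_of_lt h.2]
    simp only [this]
    split_ifs <;> rfl

/-- The value of an expression in natural numbers. -/
def Expr.natEval (w : ℕ) (r : ℕ → ℕ) : Expr → ℕ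
  | .const k => k
  | .wordSize => w
  | .reg x => r x
  | .bin op a b => op.natEval (a.natEval w r) (b.natEval w r)

/-- A condition under which evaluation in words agrees with evaluation in numbers. -/
def Expr.Fits (w : ℕ) (r : ℕ → ℕ) : Expr → Prop
  | .bin op a b => a.Fits w r ∧ b.Fits w r ∧ op.Fits w (a.natEval w r) (b.natEval w r)
  | _ => True

theorem Expr.eval_ofNat {w : ℕ} {r : ℕ → ℕ} {e : Expr} (h : e.Fits w r) :
    e.eval (fun i => BitVec.ofNat w (r i)) = BitVec.ofNat w (e.natEval w r) := by
  induction e with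
  | const k => rfl
  | wordSize => rfl
  | reg x => rfl
  | bin op a b iha ihb =>
    obtain ⟨ha, hb, ho⟩ := h
    simp only [Expr.eval, iha ha, ihb hb, Expr.natEval, BinOp.eval_ofNat op ho]

section simpLemmas
variable (w : ℕ) (r : ℕ → ℕ) (a b : Expr) (k x : ℕ)

@[simp] theorem natEval_add : (a + b).natEval w r = a.natEval w r + b.natEval w r := rfl
@[simp] theorem natEval_sub : (a - b).natEval w r = a.natEval w r - b.natEval w r := rfl
@[simp] theorem natEval_mul : (a * b).natEval w r = a.natEval w r * b.natEval w r := rfl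
@[simp] theorem natEval_div : (a / b).natEval w r = a.natEval w r / b.natEval w r := rfl
@[simp] theorem natEval_mod : (a % b).natEval w r = a.natEval w r % b.natEval w r := rfl
@[simp] theorem natEval_shl : (a <<< b).natEval w r = a.natEval w r * 2 ^ b.natEval w r := rfl
@[simp] theorem natEval_shr : (a >>> b).natEval w r = a.natEval w r / 2 ^ b.natEval w r := rfl
@[simp] theorem natEval_lt : (Expr.bin .lt a b).natEval w r =
    if a.natEval w r < b.natEval w r then 1 else 0 := rfl
@[simp] theorem natEval_eq : (Expr.bin .eq a b).natEval w r =
    if a.natEval w r = b.natEval w r then 1 else 0 := rfl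
@[simp] theorem natEval_reg : (Expr.reg x).natEval w r = r x := rfl
@[simp] theorem natEval_const : (Expr.const k).natEval w r = k := rfl

@[simp] theorem fits_add : (a + b).Fits w r ↔ a.Fits w r ∧ b.Fits w r := by
  exact ⟨fun h => ⟨h.1, h.2.1⟩, fun h => ⟨h.1, h.2, trivial⟩⟩
@[simp] theorem fits_mul : (a * b).Fits w r ↔ a.Fits w r ∧ b.Fits w r := by
  exact ⟨fun h => ⟨h.1, h.2.1⟩, fun h => ⟨h.1, h.2, trivial⟩⟩
@[simp] theorem fits_sub : (a - b).Fits w r ↔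
    a.Fits w r ∧ b.Fits w r ∧ b.natEval w r ≤ a.natEval w r := Iff.rfl
@[simp] theorem fits_div : (a / b).Fits w r ↔
    a.Fits w r ∧ b.Fits w r ∧ a.natEval w r < 2 ^ w ∧ b.natEval w r < 2 ^ w := Iff.rfl
@[simp] theorem fits_mod : (a % b).Fits w r ↔
    a.Fits w r ∧ b.Fits w r ∧ a.natEval w r < 2 ^ w ∧ b.natEval w r < 2 ^ w := Iff.rfl
@[simp] theorem fits_shl : (a <<< b).Fits w r ↔
    a.Fits w r ∧ b.Fits w r ∧ b.natEval w r < 2 ^ w := Iff.rfl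
@[simp] theorem fits_shr : (a >>> b).Fits w r ↔
    a.Fits w r ∧ b.Fits w r ∧ a.natEval w r < 2 ^ w ∧ b.natEval w r < 2 ^ w := Iff.rfl
@[simp] theorem fits_lt : (Expr.bin .lt a b).Fits w r ↔
    a.Fits w r ∧ b.Fits w r ∧ a.natEval w r < 2 ^ w ∧ b.natEval w r < 2 ^ w := Iff.rfl
@[simp] theorem fits_eq : (Expr.bin .eq a b).Fits w r ↔
    a.Fits w r ∧ b.Fits w r ∧ a.natEval w r < 2 ^ w ∧ b.natEval w r < 2 ^ w := Iff.rfl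
@[simp] theorem fits_reg : (Expr.reg x).Fits w r := trivial
@[simp] theorem fits_const : (Expr.const k).Fits w r := trivial

@[simp] theorem cost_add : (a + b).cost = a.cost + b.cost + 1 := rfl
@[simp] theorem cost_sub : (a - b).cost = a.cost + b.cost + 1 := rfl
@[simp] theorem cost_mul : (a * b).cost = a.cost + b.cost + 1 := rfl
@[simp] theorem cost_div : (a / b).cost = a.cost + b.cost + 1 := rfl
@[simp] theorem cost_mod : (a % b).cost = a.cost + b.cost + 1 := rfl
@[simp] theorem cost_shl : (a <<< b).cost = a.cost + b.cost + 1 := rfl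
@[simp] theorem cost_shr : (a >>> b).cost = a.cost + b.cost + 1 := rfl
@[simp] theorem cost_lt : (Expr.bin .lt a b).cost = a.cost + b.cost + 1 := rfl
@[simp] theorem cost_eq : (Expr.bin .eq a b).cost = a.cost + b.cost + 1 := rfl
@[simp] theorem cost_reg : (Expr.reg x).cost = 1 := rfl
@[simp] theorem cost_const : (Expr.const k).cost = 1 := rfl

end simpLemmas

/-- A machine state with natural numbers in place of words. -/
structure NatState where
  regs : ℕ → ℕ
  mem : ℕ → ℕ

def NatState.toState (w : ℕ) (s : NatState) : State w :=
  ⟨fun i => BitVec.ofNat w (s.regs i), fun i => BitVec.ofNat w (s.mem i)⟩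

theorem ofNat_comp_update (w : ℕ) (f : ℕ → ℕ) (x v : ℕ) :
    (fun i => BitVec.ofNat w (Function.update f x v i)) =
      Function.update (fun i => BitVec.ofNat w (f i)) x (BitVec.ofNat w v) := by
  funext i
  by_cases h : i = x
  · subst h; simp
  · simp [h]

/-- Started in `s` at time `t`, the program halts in a state and at a time that satisfy `Q`. -/
def wp (w S : ℕ) (p : Cmd) (s : NatState) (t : ℕ) (Q : NatState → ℕ → Prop) : Prop :=
  ∃ dt s', Exec S p (s.toState w) dt (s'.toState w) ∧ Q s' (t + dt)

section rules
variable {w S : ℕ} {s : NatState} {t : ℕ} {Q : NatState → ℕ → Prop}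

theorem wp_skip (hQ : Q s (t + 1)) : wp w S .skip s t Q := ⟨1, s, .skip _, hQ⟩

theorem wp_assign {x : ℕ} {e : Expr} (h : e.Fits w s.regs)
    (hQ : Q ⟨Function.update s.regs x (e.natEval w s.regs), s.mem⟩ (t + (e.cost + 1))) :
    wp w S (.assign x e) s t Q := by
  refine ⟨_, _, ?_, hQ⟩
  have := Exec.assign (S := S) x e (s.toState w)
  simp only [NatState.toState, Expr.eval_ofNat h] at this
  simpa only [NatState.toState, ofNat_comp_update] using this

theorem toNat_ofNat_of_lt {w S x : ℕ} (h : x < S) (hS : S ≤ 2 ^ w) :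
    (BitVec.ofNat w x).toNat = x := by
  rw [BitVec.toNat_ofNat, Nat.mod_eq_of_lt (h.trans_le hS)]

theorem wp_load {x : ℕ} {a : Expr} (hS : S ≤ 2 ^ w) (h : a.Fits w s.regs)
    (ha : a.natEval w s.regs < S)
    (hQ : Q ⟨Function.update s.regs x (s.mem (a.natEval w s.regs)), s.mem⟩ (t + (a.cost + 1))) :
    wp w S (.load x a) s t Q := by
  refine ⟨_, _, ?_, hQ⟩
  have key : (a.eval (s.toState w).regs).toNat = a.natEval w s.regs := by
    simp only [NatState.toState, Expr.eval_ofNat h, toNat_ofNat_of_lt ha hS]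
  have := Exec.load (S := S) x a (s.toState w) (by rw [key]; exact ha)
  rw [key] at this
  simpa only [NatState.toState, ofNat_comp_update] using this

theorem wp_store {a e : Expr} (hS : S ≤ 2 ^ w) (h : a.Fits w s.regs) (he : e.Fits w s.regs)
    (ha : a.natEval w s.regs < S)
    (hQ : Q ⟨s.regs, Function.update s.mem (a.natEval w s.regs) (e.natEval w s.regs)⟩
      (t + (a.cost + e.cost + 1))) :
    wp w S (.store a e) s t Q := by
  refine ⟨_, _, ?_, hQ⟩
  have key : (a.eval (s.toState w).regs).toNat = a.natEval w s.regs := by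
    simp only [NatState.toState, Expr.eval_ofNat h, toNat_ofNat_of_lt ha hS]
  have := Exec.store (S := S) a e (s.toState w) (by rw [key]; exact ha)
  rw [key] at this
  simp only [NatState.toState, Expr.eval_ofNat he] at this
  simpa only [NatState.toState, ofNat_comp_update] using this

theorem wp_seq {p q : Cmd} (h : wp w S p s t fun s' t' => wp w S q s' t' Q) :
    wp w S (.seq p q) s t Q := by
  obtain ⟨dt, s', he, dt', s'', he', hq⟩ := h
  exact ⟨dt + dt', s'', .seq he he', by rwa [← Nat.add_assoc]⟩

theorem Expr.eval_eq_zero_iff {e : Expr} (h : e.Fits w s.regs) (hlt : e.natEval w s.regs < 2 ^ w) :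
    e.eval (s.toState w).regs = 0 ↔ e.natEval w s.regs = 0 := by
  simp only [NatState.toState, Expr.eval_ofNat h]
  rw [← BitVec.toNat_inj, BitVec.toNat_ofNat, Nat.mod_eq_of_lt hlt]
  simp

theorem wp_ite {e : Expr} {p q : Cmd} (h : e.Fits w s.regs) (hlt : e.natEval w s.regs < 2 ^ w)
    (hp : e.natEval w s.regs ≠ 0 → wp w S p s (t + (e.cost + 1)) Q)
    (hq : e.natEval w s.regs = 0 → wp w S q s (t + (e.cost + 1)) Q) :
    wp w S (.ite e p q) s t Q := by
  by_cases hz : e.natEval w s.regs = 0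
  · obtain ⟨dt, s', he, h'⟩ := hq hz
    exact ⟨_, s', .iteFalse ((Expr.eval_eq_zero_iff h hlt).2 hz) he, by rwa [← Nat.add_assoc]⟩
  · obtain ⟨dt, s', he, h'⟩ := hp hz
    exact ⟨_, s', .iteTrue (fun h0 => hz ((Expr.eval_eq_zero_iff h hlt).1 h0)) he,
      by rwa [← Nat.add_assoc]⟩

/-- The invariant may speak about the clock, so time bounds are proved through `I`; the measure `μ`
serves only for termination. -/
theorem wp_loop {e : Expr} {p : Cmd} (I : NatState → ℕ → Prop) (μ : NatState → ℕ)
    (h0 : I s t)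
    (h : ∀ s t, I s t → e.Fits w s.regs ∧ e.natEval w s.regs < 2 ^ w ∧
      (e.natEval w s.regs = 0 → Q s (t + (e.cost + 1))) ∧
      (e.natEval w s.regs ≠ 0 →
        wp w S p s (t + (e.cost + 1)) fun s' t' => I s' t' ∧ μ s' < μ s)) :
    wp w S (.loop e p) s t Q := by
  induction hm : μ s using Nat.strong_induction_on generalizing s t with
  | _ m ih =>
    subst hm
    obtain ⟨hf, hlt, hz, hs⟩ := h s t h0
    by_cases h1 : e.natEval w s.regs = 0
    · exact ⟨_, s, .loopStop ((Expr.eval_eq_zero_iff hf hlt).2 h1), hz h1⟩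
    · obtain ⟨dt, s', he, hi, hμ⟩ := hs h1
      obtain ⟨dt', s'', he', hq⟩ := ih _ hμ hi rfl
      refine ⟨_, s'', .loopStep (fun h0 => h1 ((Expr.eval_eq_zero_iff hf hlt).1 h0)) he he', ?_⟩
      convert hq using 1
      omega

end rules

end WordRAM

namespace DegreeSequence
open Finset

/-! ### Rank and select in bit strings -/

/-- The number of ones in the binary representation. -/
def pop (u : ℕ) : ℕ := if u = 0 then 0 else u % 2 + pop (u / 2)

/-- The position after the `k`-th one in the binary representation of `u`; beyond the last one,
the zero tail is continued by a field of length `H`. -/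
def sel (H : ℕ) (u k : ℕ) : ℕ :=
  if k = 0 then 0 else if u = 0 then H else 1 + sel H (u / 2) (k - u % 2)
termination_by u

@[simp] theorem pop_zero : pop 0 = 0 := by rw [pop]; rfl

theorem pop_eq (u : ℕ) : pop u = u % 2 + pop (u / 2) := by
  by_cases h : u = 0
  · subst h; simp
  · rw [pop, if_neg h]

@[simp] theorem sel_zero (H u : ℕ) : sel H u 0 = 0 := by rw [sel]; rfl

theorem sel_zero_left {H k : ℕ} (hk : k ≠ 0) : sel H 0 k = H := by
  rw [sel, if_neg hk, if_pos rfl]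

theorem sel_of_ne_zero {H u k : ℕ} (hu : u ≠ 0) (hk : k ≠ 0) :
    sel H u k = 1 + sel H (u / 2) (k - u % 2) := by
  rw [sel, if_neg hk, if_neg hu]

theorem mod_two_pow_succ (u i : ℕ) : u % 2 ^ (i + 1) = u % 2 + 2 * (u / 2 % 2 ^ i) := by
  rw [pow_succ', Nat.mod_mul]

theorem pop_mod_le (u i : ℕ) : pop (u % 2 ^ i) ≤ pop u := by
  induction i generalizing u with
  | zero => simp [Nat.mod_one]
  | succ i ih =>
    rw [mod_two_pow_succ, pop_eq, pop_eq u]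
    have := ih (u / 2)
    have h2 : (u % 2 + 2 * (u / 2 % 2 ^ i)) / 2 = u / 2 % 2 ^ i := by omega
    rw [h2]
    omega

/-- The last one below position `i` ends at or before `i`. This makes the subtraction in `slotIdx` a
genuine one. -/
theorem sel_pop_mod_le (H u i : ℕ) : sel H u (pop (u % 2 ^ i)) ≤ i := by
  induction i generalizing u with
  | zero => simp [Nat.mod_one]
  | succ i ih =>
    have h2 : (u % 2 + 2 * (u / 2 % 2 ^ i)) / 2 = u / 2 % 2 ^ i := by omega
    have h3 : pop (u % 2 ^ (i + 1)) = u % 2 + pop (u / 2 % 2 ^ i) := by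
      rw [mod_two_pow_succ, pop_eq, h2]; omega
    by_cases h0 : pop (u % 2 ^ (i + 1)) = 0
    · simp [h0]
    · have hu : u ≠ 0 := by rintro rfl; simp at h0
      rw [sel_of_ne_zero hu h0, h3, Nat.add_sub_cancel_left]
      have := ih (u / 2)
      omega

theorem sel_mono (H u : ℕ) {k k' : ℕ} (h : k ≤ k') : sel H u k ≤ sel H u k' := by
  induction u using Nat.strong_induction_on generalizing k k' with
  | _ u ih =>
    rcases Nat.eq_zero_or_pos k with rfl | hk
    · simp
    · by_cases hu : u = 0
      · subst hu
        rw [sel_zero_left hk.ne', sel_zero_left (by omega)]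
      · rw [sel_of_ne_zero hu hk.ne', sel_of_ne_zero hu (by omega)]
        exact Nat.add_le_add_left (ih _ (by omega) (by omega)) 1

/-- All ones end by position `c`, and the default `H` is added at most once. -/
theorem sel_le {H u c : ℕ} (hu : u < 2 ^ c) (k : ℕ) : sel H u k ≤ c + H := by
  induction c generalizing u k with
  | zero =>
    obtain rfl : u = 0 := by simpa using hu
    by_cases hk : k = 0
    · simp [hk]
    · simp [sel_zero_left hk]
  | succ c ih =>
    by_cases hk : k = 0
    · simp [hk]
    by_cases h0 : u = 0
    · subst h0; rw [sel_zero_left hk]; omega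
    · rw [sel_of_ne_zero h0 hk]
      have := ih (u := u / 2) (by rw [pow_succ] at hu; omega) (k - u % 2)
      omega

theorem pop_le {u c : ℕ} (hu : u < 2 ^ c) : pop u ≤ c := by
  induction c generalizing u with
  | zero =>
    obtain rfl : u = 0 := by simpa using hu
    simp
  | succ c ih =>
    rw [pop_eq]
    have := ih (u := u / 2) (by rw [pow_succ] at hu; omega)
    omega

theorem pop_add_two_pow {u c : ℕ} (hu : u < 2 ^ c) : pop (u + 2 ^ c) = pop u + 1 := by
  induction c generalizing u with
  | zero =>
    obtain rfl : u = 0 := by simpa using hu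
    rw [pop_eq]; simp
  | succ c ih =>
    have := ih (u := u / 2) (by rw [pow_succ] at hu; omega)
    have h1 : (u + 2 ^ (c + 1)) / 2 = u / 2 + 2 ^ c := by rw [pow_succ]; omega
    have h2 : (u + 2 ^ (c + 1)) % 2 = u % 2 := by rw [pow_succ]; omega
    rw [pop_eq, h1, h2, this, pop_eq u]
    omega

/-- A mark above all existing ones does not move these, so appending a field or closing a chunk
preserves what was laid out before. -/
theorem sel_add_two_pow {H u c k : ℕ} (hu : u < 2 ^ c) (hk : k ≤ pop u) :
    sel H (u + 2 ^ c) k = sel H u k := by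
  induction c generalizing u k with
  | zero =>
    obtain rfl : u = 0 := by simpa using hu
    obtain rfl : k = 0 := by simpa using hk
    simp
  | succ c ih =>
    by_cases h0 : k = 0
    · simp [h0]
    have hu0 : u ≠ 0 := by rintro rfl; simp at hk; omega
    have h1 : (u + 2 ^ (c + 1)) / 2 = u / 2 + 2 ^ c := by rw [pow_succ]; omega
    have h2 : (u + 2 ^ (c + 1)) % 2 = u % 2 := by rw [pow_succ]; omega
    rw [pop_eq] at hk
    rw [sel_of_ne_zero (by omega) h0, sel_of_ne_zero hu0 h0, h1, h2,
      ih (by rw [pow_succ] at hu; omega) (by omega)]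

theorem sel_add_two_pow_last {H u c : ℕ} (hu : u < 2 ^ c) :
    sel H (u + 2 ^ c) (pop u + 1) = c + 1 := by
  induction c generalizing u with
  | zero =>
    obtain rfl : u = 0 := by simpa using hu
    rw [sel_of_ne_zero (by simp) (by simp)]; simp
  | succ c ih =>
    have h1 : (u + 2 ^ (c + 1)) / 2 = u / 2 + 2 ^ c := by rw [pow_succ]; omega
    have h2 : (u + 2 ^ (c + 1)) % 2 = u % 2 := by rw [pow_succ]; omega
    have h3 : pop u + 1 - u % 2 = pop (u / 2) + 1 := by rw [pop_eq]; omega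
    rw [sel_of_ne_zero (by positivity) (by omega), h1, h2, h3,
      ih (by rw [pow_succ] at hu; omega)]
    omega

theorem add_two_pow_mod {u c i : ℕ} (h : i ≤ c) : (u + 2 ^ c) % 2 ^ i = u % 2 ^ i := by
  obtain ⟨e, rfl⟩ := Nat.exists_eq_add_of_le h
  rw [pow_add, Nat.add_mul_mod_self_left]

/-! ### Words of concatenated codes -/

/-- The `k`-th field of a word whose low `b` bits mark the ends of the fields stored above. -/
def fieldStart (b H wd k : ℕ) : ℕ := sel H (wd % 2 ^ b) k

def fieldWidth (b H wd k : ℕ) : ℕ := sel H (wd % 2 ^ b) (k + 1) - sel H (wd % 2 ^ b) k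

def readField (b H wd k : ℕ) : ℕ :=
  wd / 2 ^ (b + fieldStart b H wd k) % 2 ^ fieldWidth b H wd k

theorem fieldStart_add_fieldWidth (b H wd k : ℕ) :
    fieldStart b H wd k + fieldWidth b H wd k = sel H (wd % 2 ^ b) (k + 1) := by
  have := sel_mono H (wd % 2 ^ b) (Nat.le_add_right k 1)
  rw [fieldStart, fieldWidth]
  omega

theorem fieldEnd_le (b H wd k : ℕ) : fieldStart b H wd k + fieldWidth b H wd k ≤ b + H := by
  rw [fieldStart_add_fieldWidth]
  exact sel_le (Nat.mod_lt _ (by positivity)) _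

/-- The word after incrementing its `k`-th field. -/
def incField (b H wd k : ℕ) : ℕ := wd + 2 ^ (b + fieldStart b H wd k)

theorem incField_mod (b H wd k : ℕ) : incField b H wd k % 2 ^ b = wd % 2 ^ b :=
  add_two_pow_mod (by omega)

theorem fieldStart_incField (b H wd k k' : ℕ) :
    fieldStart b H (incField b H wd k) k' = fieldStart b H wd k' := by
  rw [fieldStart, incField_mod, fieldStart]

theorem fieldWidth_incField (b H wd k k' : ℕ) :
    fieldWidth b H (incField b H wd k) k' = fieldWidth b H wd k' := by
  rw [fieldWidth, incField_mod, fieldWidth]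

theorem readField_incField_self {b H wd k : ℕ}
    (h : readField b H wd k + 1 < 2 ^ fieldWidth b H wd k) :
    readField b H (incField b H wd k) k = readField b H wd k + 1 := by
  rw [readField, fieldStart_incField, fieldWidth_incField, incField,
    Nat.add_div_right _ (by positivity), Nat.add_mod, ← readField]
  rw [Nat.mod_eq_of_lt (a := 1), Nat.mod_eq_of_lt h]
  omega

/-- There is no carry out of a field that is not full, so all bits above it stay. -/
theorem incField_div_end {b H wd k : ℕ}
    (h : readField b H wd k + 1 < 2 ^ fieldWidth b H wd k) :
    incField b H wd k / 2 ^ (b + (fieldStart b H wd k + fieldWidth b H wd k)) =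
      wd / 2 ^ (b + (fieldStart b H wd k + fieldWidth b H wd k)) := by
  rw [← Nat.add_assoc, pow_add 2 (b + _), ← Nat.div_div_eq_div_mul, ← Nat.div_div_eq_div_mul,
    incField, Nat.add_div_right _ (by positivity)]
  rw [readField] at h
  set q := wd / 2 ^ (b + fieldStart b H wd k)
  set m := 2 ^ fieldWidth b H wd k
  have hm : 0 < m := by positivity
  have h1 := Nat.div_add_mod q m
  refine Nat.div_eq_of_lt_le ?_ ?_ <;> rw [Nat.mul_comm]
  · omega
  · rw [Nat.mul_succ]; omega

theorem incField_lt {b H wd k X : ℕ} (hX : 2 * b + H ≤ X) (hwd : wd < 2 ^ X)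
    (h : readField b H wd k + 1 < 2 ^ fieldWidth b H wd k) : incField b H wd k < 2 ^ X := by
  have h1 := fieldEnd_le b H wd k
  obtain ⟨e, rfl⟩ := Nat.exists_eq_add_of_le
    (show b + (fieldStart b H wd k + fieldWidth b H wd k) ≤ X by omega)
  rw [pow_add] at hwd ⊢
  rw [Nat.mul_comm] at hwd ⊢
  rw [← Nat.div_lt_iff_lt_mul (by positivity)] at hwd ⊢
  rwa [incField_div_end h]

/-- Fields do not overlap, by monotonicity of `sel`. An earlier field lies below the added power of
two; a later one is protected by the absence of a carry. -/
theorem readField_incField_of_ne {b H wd k k' : ℕ} (hk : k' ≠ k)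
    (h : readField b H wd k + 1 < 2 ^ fieldWidth b H wd k) :
    readField b H (incField b H wd k) k' = readField b H wd k' := by
  rw [readField, fieldStart_incField, fieldWidth_incField, readField]
  rcases Nat.lt_or_gt_of_ne hk with hlt | hlt
  · have h1 : fieldStart b H wd k' + fieldWidth b H wd k' ≤ fieldStart b H wd k := by
      rw [fieldStart_add_fieldWidth]
      exact sel_mono _ _ hlt
    obtain ⟨e, he⟩ := Nat.exists_eq_add_of_le h1
    rw [incField, he, show b + (fieldStart b H wd k' + fieldWidth b H wd k' + e) =
      (b + fieldStart b H wd k') + (fieldWidth b H wd k' + e) by omega, pow_add 2 (b + _),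
      Nat.add_mul_div_left _ _ (by positivity), pow_add 2 (fieldWidth _ _ _ _) e, Nat.add_mul_mod_self_left]
  · have h1 : fieldStart b H wd k + fieldWidth b H wd k ≤ fieldStart b H wd k' := by
      rw [fieldStart_add_fieldWidth]
      exact sel_mono _ _ hlt
    obtain ⟨e, he⟩ := Nat.exists_eq_add_of_le h1
    rw [he, ← Nat.add_assoc, pow_add, ← Nat.div_div_eq_div_mul, ← Nat.div_div_eq_div_mul,
      incField_div_end h]

/-! ### Groups of codes -/

/-- The chunk that holds item `i` of a group whose chunk boundaries are marked in `F`. -/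
def chunkIdx (F i : ℕ) : ℕ := pop (F % 2 ^ i)

/-- The index of item `i` in its chunk. -/
def slotIdx (H F i : ℕ) : ℕ := i - sel H F (chunkIdx F i)

/-- The chunk of item `i` depends only on the boundaries strictly before `i`; bit `j` of the
boundary word says that item `j` is the last of its chunk. -/
theorem chunkIdx_add_two_pow {F c i : ℕ} (h : i ≤ c) : chunkIdx (F + 2 ^ c) i = chunkIdx F i := by
  rw [chunkIdx, add_two_pow_mod h, chunkIdx]

theorem slotIdx_add_two_pow {H F c i : ℕ} (hF : F < 2 ^ c) (h : i ≤ c) :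
    slotIdx H (F + 2 ^ c) i = slotIdx H F i := by
  rw [slotIdx, chunkIdx_add_two_pow h, chunkIdx, sel_add_two_pow hF (pop_mod_le _ _), slotIdx,
    chunkIdx]

theorem slotIdx_ne {H F i i' : ℕ} (h : i ≠ i') (hc : chunkIdx F i = chunkIdx F i') :
    slotIdx H F i ≠ slotIdx H F i' := by
  have h1 := sel_pop_mod_le H F i
  have h2 := sel_pop_mod_le H F i'
  rw [← chunkIdx] at h1 h2
  rw [slotIdx, slotIdx, hc]
  rw [hc] at h1
  omega

/-- The boundary word `F` and the chunks `c 0, …, c (K - 1)` represent the values `d i`, `i < b`,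
in fields that are wide enough for `e i`. -/
structure Encodes (b H F : ℕ) (c : ℕ → ℕ) (K : ℕ) (d e : ℕ → ℕ) : Prop where
  marks_lt : F < 2 ^ b
  chunk_lt : ∀ i < b, chunkIdx F i < K
  read : ∀ i < b, readField b H (c (chunkIdx F i)) (slotIdx H F i) = d i
  width : ∀ i < b, e i < 2 ^ fieldWidth b H (c (chunkIdx F i)) (slotIdx H F i)
  word_lt : ∀ r < K, c r < 2 ^ (8 * b)

theorem Encodes.congr {b H F K : ℕ} {c c' d d' e e' : ℕ → ℕ} (h : Encodes b H F c K d e)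
    (hc : ∀ r < K, c' r = c r) (hd : ∀ i < b, d' i = d i) (he : ∀ i < b, e' i = e i) :
    Encodes b H F c' K d' e' where
  marks_lt := h.marks_lt
  chunk_lt := h.chunk_lt
  read i hi := by rw [hc _ (h.chunk_lt i hi), hd i hi, h.read i hi]
  width i hi := by rw [hc _ (h.chunk_lt i hi), he i hi]; exact h.width i hi
  word_lt r hr := by rw [hc r hr]; exact h.word_lt r hr

/-- An increment changes neither marks nor boundaries, so all positions and widths persist. The word
bound is `b` mark bits plus fields ending by `b + H`, which is at most `8 * b` in all. -/
theorem Encodes.inc {b H F K i : ℕ} {c d e : ℕ → ℕ} (h : Encodes b H F c K d e) (hH : H ≤ 6 * b)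
    (hi : i < b) (hd : d i + 1 < 2 ^ fieldWidth b H (c (chunkIdx F i)) (slotIdx H F i)) :
    Encodes b H F (Function.update c (chunkIdx F i)
      (incField b H (c (chunkIdx F i)) (slotIdx H F i))) K (Function.update d i (d i + 1)) e where
  marks_lt := h.marks_lt
  chunk_lt := h.chunk_lt
  read i' hi' := by
    have hd' := hd
    rw [← h.read i hi] at hd'
    by_cases hii : i' = i
    · subst hii
      rw [Function.update_self, Function.update_self, readField_incField_self hd', h.read _ hi]
    · rw [Function.update_of_ne hii]
      by_cases hc : chunkIdx F i' = chunkIdx F i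
      · rw [hc, Function.update_self, readField_incField_of_ne (slotIdx_ne hii hc) hd', ← hc,
          h.read _ hi']
      · rw [Function.update_of_ne hc, h.read _ hi']
  width i' hi' := by
    by_cases hc : chunkIdx F i' = chunkIdx F i
    · rw [hc, Function.update_self, fieldWidth_incField, ← hc]
      exact h.width _ hi'
    · rw [Function.update_of_ne hc]
      exact h.width _ hi'
  word_lt r hr := by
    have hd' := hd
    rw [← h.read i hi] at hd'
    by_cases hc : r = chunkIdx F i
    · subst hc
      rw [Function.update_self]
      exact incField_lt (by omega) (h.word_lt _ hr) hd'
    · rw [Function.update_of_ne hc]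
      exact h.word_lt _ hr

end DegreeSequence

namespace DegreeSequence
open Finset

/-! ### Greedy encoding of a group -/

/-- The state of the greedy encoder: the boundary word, the number of closed chunks, the number of
bits in the open chunk, its word, and the closed chunks. -/
structure Encoder where
  F : ℕ
  cnt : ℕ
  cur : ℕ
  wd : ℕ
  c : ℕ → ℕ

/-- All chunks including the open one. -/
def Encoder.chunks (S : Encoder) : ℕ → ℕ := Function.update S.c S.cnt S.wd

/-- Before item `i` with a code of length `L`, the open chunk is closed if there is no room. -/
def Encoder.close (b L i : ℕ) (S : Encoder) : Encoder :=
  if 0 < S.cur ∧ b < S.cur + L then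
    ⟨S.F + 2 ^ (i - 1), S.cnt + 1, 0, 0, S.chunks⟩
  else S

/-- A code of length `L` for the value `d` is appended to the open chunk. -/
def Encoder.append (b L d : ℕ) (S : Encoder) : Encoder :=
  { S with
    cur := S.cur + L
    wd := S.wd + (d * 2 ^ (S.cur + b) + (if L < b + 1 then 1 else 0) * 2 ^ (S.cur + L - 1)) }

def Encoder.step (b L d i : ℕ) (S : Encoder) : Encoder := (S.close b L i).append b L d

/-- The part of the invariant of the encoder that concerns an open chunk with room for more. -/
structure Encoder.Open (b H i : ℕ) (S : Encoder) : Prop where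
  cur_le : S.cur ≤ b
  mod_lt : S.wd % 2 ^ b < 2 ^ S.cur
  pop_add : pop (S.wd % 2 ^ b) + sel H S.F S.cnt = i
  sel_pop : sel H (S.wd % 2 ^ b) (pop (S.wd % 2 ^ b)) = S.cur
  div_lt : S.wd / 2 ^ b < 2 ^ S.cur

/-- The part of the invariant of the encoder that holds throughout, when `i` items have been
encoded. -/
structure Encoder.Fields (b H : ℕ) (d e : ℕ → ℕ) (i : ℕ) (S : Encoder) : Prop where
  marks_lt : S.F < 2 ^ i
  cnt_eq : S.cnt = pop S.F
  read : ∀ j < i, readField b H (S.chunks (chunkIdx S.F j)) (slotIdx H S.F j) = d j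
  width : ∀ j < i, e j < 2 ^ fieldWidth b H (S.chunks (chunkIdx S.F j)) (slotIdx H S.F j)
  word_lt : ∀ r ≤ S.cnt, S.chunks r < 2 ^ (8 * b)

/-- The invariant of the encoder between two steps. -/
structure Encoder.Inv (b H : ℕ) (d e L : ℕ → ℕ) (i : ℕ) (S : Encoder) : Prop
    extends S.Fields b H d e i where
  marks_lt' : S.F < 2 ^ (i - 1)
  cur_pos : 0 < i → 0 < S.cur
  cur_le : S.cur ≤ b + H
  open_or : S.Open b H i ∨ (b < S.cur ∧ 0 < i)
  space : b * S.cnt + S.cur ≤ 2 * ∑ j ∈ range i, L j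

/-- The invariant of the encoder within a step. -/
structure Encoder.Ready (b H : ℕ) (d e L : ℕ → ℕ) (i : ℕ) (S : Encoder) : Prop
    extends S.Fields b H d e i, S.Open b H i where
  room : S.cur = 0 ∨ S.cur + L i ≤ b
  space : b * S.cnt + S.cur ≤ 2 * ∑ j ∈ range i, L j + L i

theorem Encoder.inv_zero (b H : ℕ) (d e L c : ℕ → ℕ) :
    Encoder.Inv b H d e L 0 ⟨0, 0, 0, 0, c⟩ := by
  refine ⟨⟨by simp, by simp, by simp, by simp, ?_⟩, by simp, by simp, by simp, .inl ⟨?_, ?_, ?_, ?_, ?_⟩, ?_⟩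
  · intro r hr
    obtain rfl : r = 0 := by simpa using hr
    simp [Encoder.chunks]
  all_goals simp

theorem Encoder.Inv.pos {b H i : ℕ} {d e L : ℕ → ℕ} {S : Encoder} (h : S.Inv b H d e L i)
    (hc : 0 < S.cur) : 0 < i := by
  rcases Nat.eq_zero_or_pos i with rfl | hi
  · rcases h.open_or with ho | ho
    · have h1 := ho.pop_add
      have h2 := ho.sel_pop
      have h3 : pop (S.wd % 2 ^ b) = 0 := by omega
      rw [h3, sel_zero] at h2
      omega
    · omega
  · exact hi

/-- The boundary mark goes to item `i - 1`, the last one encoded, which is why `marks_lt'` keeps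
that bit free. A chunk that consists of one code longer than `b` is always closed here. -/
theorem Encoder.Inv.close {b H i : ℕ} {d e L : ℕ → ℕ} {S : Encoder} (h : S.Inv b H d e L i) :
    (S.close b (L i) i).Ready b H d e L i := by
  unfold Encoder.close
  split_ifs with hc
  · have hi : 0 < i := h.pos hc.1
    have hlt := h.marks_lt'
    have hpow : 2 ^ i = 2 ^ (i - 1) + 2 ^ (i - 1) := by
      rw [← two_mul, ← pow_succ', Nat.sub_add_cancel hi]
    have hne : ∀ j < i, chunkIdx S.F j ≠ S.cnt + 1 := by
      intro j _
      have := pop_mod_le S.F j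
      rw [← h.cnt_eq, ← chunkIdx] at this
      omega
    refine ⟨⟨?_, ?_, ?_, ?_, ?_⟩, ⟨?_, ?_, ?_, ?_, ?_⟩, .inl rfl, ?_⟩ <;> dsimp only
    · omega
    · rw [pop_add_two_pow hlt, h.cnt_eq]
    · intro j hj
      rw [chunkIdx_add_two_pow (by omega), slotIdx_add_two_pow hlt (by omega), Encoder.chunks,
        Function.update_of_ne (hne j hj)]
      exact h.read j hj
    · intro j hj
      rw [chunkIdx_add_two_pow (by omega), slotIdx_add_two_pow hlt (by omega), Encoder.chunks,
        Function.update_of_ne (hne j hj)]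
      exact h.width j hj
    · intro r hr
      simp only [Encoder.chunks] at *
      by_cases hr' : r = S.cnt + 1
      · subst hr'; simp
      · rw [Function.update_of_ne hr']
        exact h.word_lt r (by omega)
    · simp
    · simp
    · rw [Nat.zero_mod, pop_zero, h.cnt_eq, sel_add_two_pow_last hlt]
      omega
    · simp
    · simp
    -- Closing charges a full `b` to the chunk, and `b` is less than `S.cur + L i`. So each code
    -- length is charged at most twice: for closing the chunk before it, and for its own place.
    · have := h.space
      rw [Nat.mul_succ]
      omega
  · rcases h.open_or with ho | ho
    · refine ⟨h.toFields, ho, by omega, ?_⟩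
      have := h.space
      omega
    · have := h.cur_pos ho.2
      omega

theorem add_mul_two_pow_lt {p d cur L : ℕ} (hp : p < 2 ^ cur) (hd : d < 2 ^ L) :
    p + d * 2 ^ cur < 2 ^ (cur + L) := by
  rw [pow_add]
  have : (d + 1) * 2 ^ cur ≤ 2 ^ L * 2 ^ cur := Nat.mul_le_mul_right _ hd
  nlinarith

/-- Existing fields end at or below `cur`, and the appended bits begin there. -/
theorem readField_append {b H wd wd' k x cur : ℕ}
    (hu : ∀ k' ≤ k + 1, sel H (wd' % 2 ^ b) k' = sel H (wd % 2 ^ b) k')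
    (hp : wd' / 2 ^ b = wd / 2 ^ b + x * 2 ^ cur) (hcur : sel H (wd % 2 ^ b) (k + 1) ≤ cur) :
    readField b H wd' k = readField b H wd k ∧ fieldWidth b H wd' k = fieldWidth b H wd k := by
  have h1 : fieldWidth b H wd' k = fieldWidth b H wd k := by
    rw [fieldWidth, fieldWidth, hu _ le_rfl, hu _ (Nat.le_succ k)]
  have h2 : fieldStart b H wd' k = fieldStart b H wd k := hu _ (Nat.le_succ k)
  refine ⟨?_, h1⟩
  rw [← fieldStart_add_fieldWidth] at hcur
  obtain ⟨m, rfl⟩ := Nat.exists_eq_add_of_le hcur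
  rw [readField, readField, h1, h2, pow_add, ← Nat.div_div_eq_div_mul, ← Nat.div_div_eq_div_mul, hp,
    show x * 2 ^ (fieldStart b H wd k + fieldWidth b H wd k + m) =
      2 ^ fieldStart b H wd k * (2 ^ fieldWidth b H wd k * (x * 2 ^ m)) by rw [pow_add, pow_add]; ring,
    Nat.add_mul_div_left _ _ (by positivity), Nat.add_mul_mod_self_left]

/-- A code of length at most `b` fits below bit `b` of the field area, and its end mark fits into
the `b` mark bits. A longer code has an empty chunk to itself and gets no mark; the default value in
`sel` then gives it the field from `0` to `H`. -/
theorem Encoder.Ready.append {b H i : ℕ} {d e L : ℕ → ℕ} {S : Encoder}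
    (h : S.Ready b H d e L i) (hL : 1 ≤ L i) (hd : d i < 2 ^ L i) (he : e i < 2 ^ L i)
    (hLH : L i ≤ H) (hH : H ≤ 6 * b) :
    (S.append b (L i) (d i)).Inv b H d e L (i + 1) := by
  obtain ⟨hF, ho, hroom, hspace⟩ := h
  obtain ⟨hF1, hcnt, hread, hwidth, hword⟩ := hF
  obtain ⟨hcur, hmod, hpop, hsel, hdiv⟩ := ho
  have hwd := Nat.div_add_mod S.wd (2 ^ b)
  set u := S.wd % 2 ^ b with hu
  set p := S.wd / 2 ^ b with hpdef
  set m := (if L i < b + 1 then 1 else 0) * 2 ^ (S.cur + L i - 1) with hm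
  set wd' := S.wd + (d i * 2 ^ (S.cur + b) + m) with hwd'
  have hwdeq : wd' = (u + m) + 2 ^ b * (p + d i * 2 ^ S.cur) := by
    rw [hwd', ← hwd, pow_add]; ring
  have hbH : ∀ {x y : ℕ}, x ≤ y → 2 ^ x ≤ 2 ^ y := fun h => Nat.pow_le_pow_right (by norm_num) h
  have hulow : L i ≤ b → S.cur + L i ≤ b → u + m < 2 ^ (S.cur + L i) := by
    intro h1 h2
    rw [hm, if_pos (by omega), one_mul]
    have : 2 ^ (S.cur + L i) = 2 ^ (S.cur + L i - 1) + 2 ^ (S.cur + L i - 1) := by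
      rw [← two_mul, ← pow_succ', Nat.sub_add_cancel (by omega)]
    have := hbH (show S.cur ≤ S.cur + L i - 1 by omega)
    omega
  have hlow : u + m < 2 ^ b := by
    by_cases h1 : L i ≤ b
    · have h2 : S.cur + L i ≤ b := by omega
      exact (hulow h1 h2).trans_le (hbH h2)
    · rw [hm, if_neg (by omega), zero_mul, add_zero]
      exact Nat.mod_lt _ (by positivity)
  have hmod' : wd' % 2 ^ b = u + m := by
    rw [hwdeq, Nat.add_mul_mod_self_left, Nat.mod_eq_of_lt hlow]
  have hdiv' : wd' / 2 ^ b = p + d i * 2 ^ S.cur := by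
    rw [hwdeq, Nat.add_mul_div_left _ _ (by positivity), Nat.div_eq_of_lt hlow, zero_add]
  have hplt : p + d i * 2 ^ S.cur < 2 ^ (S.cur + L i) := add_mul_two_pow_lt hdiv hd
  have hwlt : wd' < 2 ^ (8 * b) := by
    have h1 : wd' / 2 ^ b < 2 ^ (7 * b) := by
      rw [hdiv']
      refine hplt.trans_le (hbH ?_)
      omega
    rw [show 8 * b = 7 * b + b by ring, pow_add]
    exact (Nat.div_lt_iff_lt_mul (by positivity)).1 h1
  have hidx : chunkIdx S.F i = S.cnt := by
    rw [chunkIdx, Nat.mod_eq_of_lt hF1, hcnt]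
  have hslot : slotIdx H S.F i = pop u := by
    rw [slotIdx, hidx]; omega
  have hpow : 0 < 2 ^ S.cur := by positivity
  have hold : ∀ j < i, readField b H (Function.update S.c S.cnt wd' (chunkIdx S.F j))
        (slotIdx H S.F j) = readField b H (S.chunks (chunkIdx S.F j)) (slotIdx H S.F j) ∧
      fieldWidth b H (Function.update S.c S.cnt wd' (chunkIdx S.F j)) (slotIdx H S.F j) =
        fieldWidth b H (S.chunks (chunkIdx S.F j)) (slotIdx H S.F j) := by
    intro j hj
    rw [Encoder.chunks]
    by_cases hc : chunkIdx S.F j = S.cnt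
    · rw [hc, Function.update_self, Function.update_self]
      have h1 := sel_pop_mod_le H S.F j
      rw [← chunkIdx, hc] at h1
      have h2 : slotIdx H S.F j < pop u := by rw [slotIdx, hc]; omega
      -- If the open chunk already holds an item, it is not empty; then `hroom` shows that the new
      -- code is a short one, with a mark above the old marks.
      have h3 : S.cur ≠ 0 := by
        intro h0
        rw [h0] at hmod
        obtain h4 : u = 0 := by simpa using hmod
        rw [h4, pop_zero] at h2
        omega
      have h4 : S.cur + L i ≤ b := by omega
      refine readField_append (x := d i) (cur := S.cur) ?_ ?_ ?_
      · intro k' hk'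
        rw [hmod', hm, if_pos (by omega), one_mul]
        exact sel_add_two_pow (hmod.trans_le (hbH (by omega))) (by omega)
      · exact hdiv'
      · rw [← hu, ← hsel]
        exact sel_mono _ _ (by omega)
    · rw [Function.update_of_ne hc, Function.update_of_ne hc]
      exact ⟨rfl, rfl⟩
  have hnew : readField b H wd' (pop u) = d i ∧ L i ≤ fieldWidth b H wd' (pop u) := by
    by_cases h1 : L i ≤ b
    · have h2 : S.cur + L i ≤ b := by omega
      have h3 : u < 2 ^ (S.cur + L i - 1) := hmod.trans_le (hbH (by omega))
      have h4 : fieldStart b H wd' (pop u) = S.cur := by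
        rw [fieldStart, hmod', hm, if_pos (by omega), one_mul, sel_add_two_pow h3 le_rfl, hsel]
      have h5 : fieldWidth b H wd' (pop u) = L i := by
        have := fieldStart_add_fieldWidth b H wd' (pop u)
        rw [h4, hmod', hm, if_pos (by omega), one_mul, sel_add_two_pow_last h3] at this
        omega
      refine ⟨?_, h5.ge⟩
      rw [readField, h4, h5, pow_add, ← Nat.div_div_eq_div_mul, hdiv', Nat.add_mul_div_right _ _ hpow,
        Nat.div_eq_of_lt hdiv, zero_add, Nat.mod_eq_of_lt hd]
    -- The long code: no marks at all, hence a single field of width `H`, which is at least `L i`.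
    · have h2 : S.cur = 0 := by omega
      have h3 : u = 0 := by rw [h2] at hmod; simpa using hmod
      have h4 : p = 0 := by rw [h2] at hdiv; simpa using hdiv
      have h6 : wd' % 2 ^ b = 0 := by rw [hmod', h3, hm, if_neg (by omega)]; simp
      have h7 : fieldStart b H wd' (pop u) = 0 := by rw [h3, pop_zero, fieldStart, sel_zero]
      have h5 : fieldWidth b H wd' (pop u) = H := by
        rw [h3, pop_zero, fieldWidth, h6, sel_zero_left (by simp), sel_zero, Nat.sub_zero]
      refine ⟨?_, by omega⟩
      rw [readField, h7, h5, Nat.add_zero, hdiv', h4, h2, pow_zero, mul_one, zero_add,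
        Nat.mod_eq_of_lt (hd.trans_le (hbH hLH))]
  have hF2 : S.F < 2 ^ (i + 1) := hF1.trans_le (hbH (Nat.le_succ i))
  refine ⟨⟨hF2, hcnt, ?_, ?_, ?_⟩, hF1, ?_, ?_, ?_, ?_⟩
  · intro j hj
    change readField b H (Function.update S.c S.cnt wd' (chunkIdx S.F j)) (slotIdx H S.F j) = d j
    rcases Nat.lt_succ_iff_lt_or_eq.1 hj with hj | rfl
    · rw [(hold j hj).1, hread j hj]
    · rw [hidx, Function.update_self, hslot, hnew.1]
  · intro j hj
    change e j < 2 ^ fieldWidth b H (Function.update S.c S.cnt wd' (chunkIdx S.F j))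
      (slotIdx H S.F j)
    rcases Nat.lt_succ_iff_lt_or_eq.1 hj with hj | rfl
    · rw [(hold j hj).2]; exact hwidth j hj
    · rw [hidx, Function.update_self, hslot]
      exact he.trans_le (hbH hnew.2)
  · intro r hr
    change Function.update S.c S.cnt wd' r < _
    by_cases hr' : r = S.cnt
    · subst hr'; rwa [Function.update_self]
    · rw [Function.update_of_ne hr']
      have := hword r hr
      rwa [Encoder.chunks, Function.update_of_ne hr'] at this
  · intro _
    simp only [Encoder.append]
    omega
  · simp only [Encoder.append]
    omega
  · by_cases h1 : L i ≤ b
    · have h2 : S.cur + L i ≤ b := by omega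
      have h3 : u < 2 ^ (S.cur + L i - 1) := hmod.trans_le (hbH (by omega))
      have hm1 : m = 2 ^ (S.cur + L i - 1) := by rw [hm, if_pos (by omega), one_mul]
      refine .inl ⟨h2, ?_, ?_, ?_, ?_⟩
      · change wd' % 2 ^ b < 2 ^ (S.cur + L i)
        rw [hmod']; exact hulow h1 h2
      · change pop (wd' % 2 ^ b) + sel H S.F S.cnt = i + 1
        rw [hmod', hm1, pop_add_two_pow h3]; omega
      · change sel H (wd' % 2 ^ b) (pop (wd' % 2 ^ b)) = S.cur + L i
        rw [hmod', hm1, pop_add_two_pow h3, sel_add_two_pow_last h3]; omega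
      · change wd' / 2 ^ b < 2 ^ (S.cur + L i)
        rw [hdiv']; exact hplt
    · refine .inr ⟨?_, by omega⟩
      simp only [Encoder.append]
      omega
  · rw [sum_range_succ]
    simp only [Encoder.append]
    omega

theorem Encoder.Inv.step {b H i : ℕ} {d e L : ℕ → ℕ} {S : Encoder} (h : S.Inv b H d e L i)
    (hL : 1 ≤ L i) (hd : d i < 2 ^ L i) (he : e i < 2 ^ L i) (hLH : L i ≤ H) (hH : H ≤ 6 * b) :
    (S.step b (L i) (d i) i).Inv b H d e L (i + 1) :=
  h.close.append hL hd he hLH hH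

theorem Encoder.Inv.encodes {b H : ℕ} {d e L : ℕ → ℕ} {S : Encoder} (h : S.Inv b H d e L b) :
    Encodes b H S.F S.chunks (S.cnt + 1) d e where
  marks_lt := h.marks_lt
  chunk_lt i _ := by
    have := pop_mod_le S.F i
    rw [← h.cnt_eq] at this
    exact Nat.lt_succ_of_le this
  read := h.read
  width := h.width
  word_lt r hr := h.word_lt r (by omega)

theorem Encoder.Inv.cnt_le {b H i : ℕ} {d e L : ℕ → ℕ} {S : Encoder} (h : S.Inv b H d e L i) :
    S.cnt ≤ i - 1 := by
  rw [h.cnt_eq]; exact pop_le h.marks_lt'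

theorem Encoder.Inv.cnt_le_div {b H i : ℕ} {d e L : ℕ → ℕ} {S : Encoder} (hb : 1 ≤ b)
    (h : S.Inv b H d e L i) : S.cnt ≤ (2 * ∑ j ∈ range i, L j) / b := by
  rw [Nat.le_div_iff_mul_le (by omega), Nat.mul_comm]
  have := h.space
  omega

end DegreeSequence

namespace DegreeSequence
open Finset

/-! ### The collection of all groups -/

/-- The length of the code for `d`. -/
def codeLength (L₀ s d : ℕ) : ℕ := max L₀ (Nat.size (d + s))

theorem codeLength_mono {L₀ s d d' : ℕ} (h : d ≤ d') : codeLength L₀ s d ≤ codeLength L₀ s d' :=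
  max_le_max le_rfl (Nat.size_le_size (by omega))

theorem lt_two_pow_codeLength (L₀ s d : ℕ) : d + s < 2 ^ codeLength L₀ s d :=
  (Nat.lt_size_self _).trans_le (Nat.pow_le_pow_right (by norm_num) (le_max_right _ _))

/-- The number of chunks that are allocated for a group with the values `d i`, `i < b`. -/
def groupSpace (b L₀ s : ℕ) (d : ℕ → ℕ) : ℕ :=
  2 * (1 + (2 * ∑ i ∈ range b, codeLength L₀ s (d i)) / b)

theorem groupSpace_mono {b L₀ s : ℕ} {d d' : ℕ → ℕ} (h : ∀ i < b, d i ≤ d' i) :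
    groupSpace b L₀ s d ≤ groupSpace b L₀ s d' := by
  unfold groupSpace
  gcongr with i hi
  exact codeLength_mono (h i (mem_range.1 hi))

/-- For each group its boundary word, the position and the size of its area, furthermore the
chunks and the end of the allocated areas. -/
@[ext] structure Store where
  F : ℕ → ℕ
  P : ℕ → ℕ
  cap : ℕ → ℕ
  ch : ℕ → ℕ
  bump : ℕ

/-- The chunk that holds item `i` of group `γ`. -/
def Store.loc (S : Store) (γ i : ℕ) : ℕ := S.P γ + chunkIdx (S.F γ) i

def Store.read (b H : ℕ) (S : Store) (γ i : ℕ) : ℕ :=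
  readField b H (S.ch (S.loc γ i)) (slotIdx H (S.F γ) i)

def Store.width (b H : ℕ) (S : Store) (γ i : ℕ) : ℕ :=
  fieldWidth b H (S.ch (S.loc γ i)) (slotIdx H (S.F γ) i)

/-- The store represents the numbers `deg v`; `old v` is the number at the time when the group of
`v` was last encoded. -/
structure Store.Inv (b H G L₀ s : ℕ) (S : Store) (deg old : ℕ → ℕ) : Prop where
  ch_zero : S.ch 0 = 0
  bump_pos : 1 ≤ S.bump
  unbuilt : ∀ γ < G, S.P γ = 0 →
    S.F γ = 0 ∧ S.cap γ = 0 ∧ ∀ i < b, deg (γ * b + i) = 0 ∧ old (γ * b + i) = 0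
  built : ∀ γ < G, S.P γ ≠ 0 → ∃ K ≤ S.cap γ, Encodes b H (S.F γ) (fun r => S.ch (S.P γ + r)) K
    (fun i => deg (γ * b + i)) (fun i => old (γ * b + i) + s)
  top : ∀ γ < G, S.P γ + S.cap γ ≤ S.bump
  disjoint : ∀ γ < G, ∀ γ' < G, γ ≠ γ' → S.P γ ≠ 0 → S.P γ' ≠ 0 →
    S.P γ + S.cap γ ≤ S.P γ' ∨ S.P γ' + S.cap γ' ≤ S.P γ
  bump_le : S.bump ≤ 1 + ∑ γ ∈ range G, 2 * S.cap γ
  cap_le : ∀ γ < G, S.cap γ ≤ groupSpace b L₀ s fun i => deg (γ * b + i)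

/-- A bound for the total number of chunks. -/
def storeSpace (b G L₀ s : ℕ) (deg : ℕ → ℕ) : ℕ :=
  1 + ∑ γ ∈ range G, 2 * groupSpace b L₀ s fun i => deg (γ * b + i)

theorem storeSpace_mono {b G L₀ s : ℕ} {deg deg' : ℕ → ℕ} (h : ∀ v, deg v ≤ deg' v) :
    storeSpace b G L₀ s deg ≤ storeSpace b G L₀ s deg' := by
  unfold storeSpace
  gcongr
  exact groupSpace_mono fun i _ => h _

section
variable {b H G L₀ s γ i : ℕ} {S : Store} {deg old : ℕ → ℕ}

theorem Store.Inv.bump_le_storeSpace (h : S.Inv b H G L₀ s deg old) :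
    S.bump ≤ storeSpace b G L₀ s deg := by
  refine h.bump_le.trans ?_
  unfold storeSpace
  gcongr with γ hγ
  exact h.cap_le γ (mem_range.1 hγ)

theorem readField_zero (b H k : ℕ) : readField b H 0 k = 0 := by simp [readField]

theorem slotIdx_lt (H F : ℕ) (hi : i < b) : slotIdx H F i < b := by
  rw [slotIdx]; omega

/-- A group that was never encoded has position `0` and no boundaries, so it refers to chunk `0`.
That chunk is never allocated and stays zero, so queries need no special case. -/
theorem Store.Inv.loc_lt_bump (h : S.Inv b H G L₀ s deg old) (hγ : γ < G) (hi : i < b) :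
    S.loc γ i < S.bump := by
  by_cases hP : S.P γ = 0
  · obtain ⟨hF, -, -⟩ := h.unbuilt γ hγ hP
    have := h.bump_pos
    simp only [Store.loc, hP, hF, chunkIdx, Nat.zero_mod, pop_zero]
    omega
  · obtain ⟨K, hK, he⟩ := h.built γ hγ hP
    have := he.chunk_lt i hi
    have := h.top γ hγ
    rw [Store.loc]; omega

theorem Store.Inv.marks_lt (h : S.Inv b H G L₀ s deg old) (hγ : γ < G) : S.F γ < 2 ^ b := by
  by_cases hP : S.P γ = 0
  · rw [(h.unbuilt γ hγ hP).1]; positivity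
  · obtain ⟨K, hK, he⟩ := h.built γ hγ hP
    exact he.marks_lt

theorem Store.Inv.word_lt (h : S.Inv b H G L₀ s deg old) (hγ : γ < G) (hi : i < b) :
    S.ch (S.loc γ i) < 2 ^ (8 * b) := by
  by_cases hP : S.P γ = 0
  · simp only [Store.loc, hP, (h.unbuilt γ hγ hP).1, chunkIdx, Nat.zero_mod, pop_zero, h.ch_zero]
    positivity
  · obtain ⟨K, hK, he⟩ := h.built γ hγ hP
    exact he.word_lt _ (he.chunk_lt i hi)

theorem Store.Inv.read_eq (h : S.Inv b H G L₀ s deg old) (hγ : γ < G) (hi : i < b) :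
    S.read b H γ i = deg (γ * b + i) := by
  by_cases hP : S.P γ = 0
  · obtain ⟨hF, -, hd⟩ := h.unbuilt γ hγ hP
    simp only [Store.read, Store.loc, hP, hF, chunkIdx, Nat.zero_mod, pop_zero, h.ch_zero,
      readField_zero, (hd i hi).1]
  · obtain ⟨K, hK, he⟩ := h.built γ hγ hP
    exact he.read i hi

theorem Store.Inv.width_gt (h : S.Inv b H G L₀ s deg old) (hγ : γ < G) (hP : S.P γ ≠ 0)
    (hi : i < b) : old (γ * b + i) + s < 2 ^ S.width b H γ i := by
  obtain ⟨K, hK, he⟩ := h.built γ hγ hP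
  exact he.width i hi

/-- The store after incrementing item `i` of group `γ`. -/
def Store.inc (b H : ℕ) (S : Store) (γ i : ℕ) : Store :=
  ⟨S.F, S.P, S.cap, Function.update S.ch (S.loc γ i)
    (incField b H (S.ch (S.loc γ i)) (slotIdx H (S.F γ) i)), S.bump⟩

theorem mul_add_inj {γ γ' i i' : ℕ} (hi : i < b) (hi' : i' < b)
    (h : γ * b + i = γ' * b + i') : γ = γ' ∧ i = i' := by
  have hb : 0 < b := by omega
  have h1 : (γ * b + i) / b = γ := by
    rw [Nat.mul_comm, Nat.mul_add_div hb, Nat.div_eq_of_lt hi, add_zero]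
  have h2 : (γ' * b + i') / b = γ' := by
    rw [Nat.mul_comm, Nat.mul_add_div hb, Nat.div_eq_of_lt hi', add_zero]
  have h3 : γ = γ' := by rw [← h1, ← h2, h]
  subst h3
  exact ⟨rfl, by omega⟩

/-- Disjointness of the areas keeps the other groups intact, and `old` does not change because
nothing is encoded anew. -/
theorem Store.Inv.inc (h : S.Inv b H G L₀ s deg old) (hH : H ≤ 6 * b) (hγ : γ < G)
    (hP : S.P γ ≠ 0) (hi : i < b) (hw : deg (γ * b + i) + 1 < 2 ^ S.width b H γ i) :
    (S.inc b H γ i).Inv b H G L₀ s (Function.update deg (γ * b + i) (deg (γ * b + i) + 1)) old := by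
  obtain ⟨K, hK, he⟩ := h.built γ hγ hP
  have hloc : S.loc γ i < S.P γ + S.cap γ := by
    have := he.chunk_lt i hi
    rw [Store.loc]; omega
  have hle : ∀ v, deg v ≤ Function.update deg (γ * b + i) (deg (γ * b + i) + 1) v := by
    intro v
    by_cases hv : v = γ * b + i
    · subst hv; simp
    · simp [hv]
  refine ⟨?_, h.bump_pos, ?_, ?_, h.top, h.disjoint, h.bump_le, ?_⟩
  · change Function.update S.ch (S.loc γ i) _ 0 = 0
    rw [Function.update_of_ne (by rw [Store.loc]; omega), h.ch_zero]
  · intro γ' hγ' hP'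
    obtain ⟨h1, h2, h3⟩ := h.unbuilt γ' hγ' hP'
    refine ⟨h1, h2, fun i' hi' => ?_⟩
    rw [Function.update_of_ne]
    · exact h3 i' hi'
    · intro heq
      obtain ⟨rfl, -⟩ := mul_add_inj hi' hi heq
      exact hP hP'
  · intro γ' hγ' hP'
    by_cases hg : γ' = γ
    · subst hg
      refine ⟨K, hK, (he.inc hH hi hw).congr ?_ ?_ fun _ _ => rfl⟩
      · intro r _
        change Function.update S.ch (S.loc γ' i) _ (S.P γ' + r) = _
        by_cases hr : r = chunkIdx (S.F γ') i
        · subst hr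
          rw [← Store.loc, Function.update_self, Function.update_self]
        · rw [Function.update_of_ne hr, Function.update_of_ne (by rw [Store.loc]; omega)]
      · intro i' hi'
        by_cases hr : i' = i
        · subst hr; simp
        · rw [Function.update_of_ne hr, Function.update_of_ne (by omega)]
    · obtain ⟨K', hK', he'⟩ := h.built γ' hγ' hP'
      refine ⟨K', hK', he'.congr ?_ ?_ fun _ _ => rfl⟩
      · intro r hr
        have hP'' : S.P γ' ≠ 0 := hP'
        change Function.update S.ch (S.loc γ i) _ (S.P γ' + r) = _
        rw [Function.update_of_ne]
        have hge : S.P γ ≤ S.loc γ i := Nat.le_add_right _ _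
        rcases h.disjoint γ hγ γ' hγ' (Ne.symm hg) hP hP'' with h1 | h1
        · omega
        · omega
      · intro i' hi'
        rw [Function.update_of_ne]
        intro heq
        exact hg (mul_add_inj hi' hi heq).1
  · intro γ' hγ'
    exact (h.cap_le γ' hγ').trans (groupSpace_mono fun i _ => hle _)

/-- The store after group `γ` has received a new encoding. -/
def Store.install (S : Store) (γ F' K : ℕ) (c : ℕ → ℕ) : Store :=
  let P' := if S.cap γ < K then S.bump else S.P γ
  { F := Function.update S.F γ F'
    P := Function.update S.P γ P'
    cap := Function.update S.cap γ (if S.cap γ < K then 2 * K else S.cap γ)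
    ch := fun j => if P' ≤ j ∧ j < P' + K then c (j - P') else S.ch j
    bump := if S.cap γ < K then S.bump + 2 * K else S.bump }

/-- The old area is reused if it is large enough; otherwise an area of size `2 * K` is taken at the
end. Degrees only grow, so a capacity once justified by `groupSpace` remains justified. -/
theorem Store.Inv.install {F' K : ℕ} {c d deg' old' : ℕ → ℕ} (h : S.Inv b H G L₀ s deg old)
    (hγ : γ < G) (he : Encodes b H F' c K d fun i => d i + s) (hK : 1 ≤ K)
    (hKle : 2 * K ≤ groupSpace b L₀ s d) (hd : ∀ i < b, deg (γ * b + i) ≤ d i)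
    (hdeg : ∀ i < b, deg' (γ * b + i) = d i) (hold : ∀ i < b, old' (γ * b + i) = d i)
    (hne : ∀ γ' ≠ γ, ∀ i < b, deg' (γ' * b + i) = deg (γ' * b + i) ∧
      old' (γ' * b + i) = old (γ' * b + i)) :
    (S.install γ F' K c).Inv b H G L₀ s deg' old' ∧ (S.install γ F' K c).P γ ≠ 0 ∧
      K ≤ (S.install γ F' K c).cap γ := by
  have hbump := h.bump_pos
  have htop := h.top
  set P' := if S.cap γ < K then S.bump else S.P γ with hP'
  set cap' := if S.cap γ < K then 2 * K else S.cap γ with hcap'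
  set bump' := if S.cap γ < K then S.bump + 2 * K else S.bump with hbump'
  have hKcap : K ≤ cap' := by rw [hcap']; split_ifs <;> omega
  have hPne : P' ≠ 0 := by
    rw [hP']
    split_ifs with hc
    · omega
    · intro h0
      have := (h.unbuilt γ hγ h0).2.1
      omega
  have hbb : S.bump ≤ bump' := by rw [hbump']; split_ifs <;> omega
  have htop' : P' + cap' ≤ bump' := by
    have := h.top γ hγ
    rw [hP', hcap', hbump']
    split_ifs <;> omega
  have hdisj : ∀ γ' < G, γ' ≠ γ → S.P γ' ≠ 0 →
      P' + cap' ≤ S.P γ' ∨ S.P γ' + S.cap γ' ≤ P' := by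
    intro γ' hγ' hg h0
    rw [hP', hcap']
    split_ifs with hc
    · exact .inr (h.top γ' hγ')
    · rw [hP', if_neg hc] at hPne
      exact h.disjoint γ hγ γ' hγ' (Ne.symm hg) hPne h0
  have hmain : (S.install γ F' K c).Inv b H G L₀ s deg' old' := by
    refine ⟨?_, hbump.trans hbb, ?_, ?_, ?_, ?_, ?_, ?_⟩
    · change (if P' ≤ 0 ∧ 0 < P' + K then c (0 - P') else S.ch 0) = 0
      rw [if_neg (by omega), h.ch_zero]
    · intro γ' hγ' h0
      change Function.update S.P γ P' γ' = 0 at h0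
      change Function.update S.F γ F' γ' = 0 ∧ Function.update S.cap γ cap' γ' = 0 ∧ _
      by_cases hg : γ' = γ
      · subst hg; rw [Function.update_self] at h0; exact absurd h0 hPne
      · rw [Function.update_of_ne hg] at h0 ⊢
        rw [Function.update_of_ne hg]
        obtain ⟨h1, h2, h3⟩ := h.unbuilt γ' hγ' h0
        refine ⟨h1, h2, fun i hi => ?_⟩
        rw [(hne γ' hg i hi).1, (hne γ' hg i hi).2]
        exact h3 i hi
    · intro γ' hγ' h0
      change Function.update S.P γ P' γ' ≠ 0 at h0
      change ∃ K' ≤ Function.update S.cap γ cap' γ', Encodes b H (Function.update S.F γ F' γ')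
        (fun r => if P' ≤ Function.update S.P γ P' γ' + r ∧ Function.update S.P γ P' γ' + r < P' + K
          then c (Function.update S.P γ P' γ' + r - P') else
          S.ch (Function.update S.P γ P' γ' + r)) K' _ _
      by_cases hg : γ' = γ
      · subst hg
        simp only [Function.update_self]
        refine ⟨K, hKcap, he.congr ?_ hdeg fun i hi => by rw [hold i hi]⟩
        intro r hr
        rw [if_pos (by omega), Nat.add_sub_cancel_left]
      · simp only [Function.update_of_ne hg] at h0 ⊢
        obtain ⟨K', hK', he'⟩ := h.built γ' hγ' h0
        refine ⟨K', hK', he'.congr ?_ (fun i hi => (hne γ' hg i hi).1)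
          fun i hi => by rw [(hne γ' hg i hi).2]⟩
        intro r hr
        have := hdisj γ' hγ' hg h0
        rw [if_neg (by omega)]
    · intro γ' hγ'
      change Function.update S.P γ P' γ' + Function.update S.cap γ cap' γ' ≤ bump'
      by_cases hg : γ' = γ
      · subst hg; simpa using htop'
      · rw [Function.update_of_ne hg, Function.update_of_ne hg]
        exact (htop γ' hγ').trans hbb
    · intro γ₁ h₁ γ₂ h₂ h12 h0 h0'
      change Function.update S.P γ P' γ₁ ≠ 0 at h0
      change Function.update S.P γ P' γ₂ ≠ 0 at h0'
      change Function.update S.P γ P' γ₁ + Function.update S.cap γ cap' γ₁ ≤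
        Function.update S.P γ P' γ₂ ∨ Function.update S.P γ P' γ₂ +
        Function.update S.cap γ cap' γ₂ ≤ Function.update S.P γ P' γ₁
      by_cases hg1 : γ₁ = γ
      · subst hg1
        simp only [Function.update_self, Function.update_of_ne (Ne.symm h12)] at h0' ⊢
        exact hdisj γ₂ h₂ (Ne.symm h12) h0'
      · by_cases hg2 : γ₂ = γ
        · subst hg2
          simp only [Function.update_self, Function.update_of_ne h12] at h0 ⊢
          exact (hdisj γ₁ h₁ h12 h0).symm
        · simp only [Function.update_of_ne hg1, Function.update_of_ne hg2] at h0 h0' ⊢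
          exact h.disjoint γ₁ h₁ γ₂ h₂ h12 h0 h0'
    · change bump' ≤ 1 + ∑ γ₁ ∈ range G, 2 * Function.update S.cap γ cap' γ₁
      -- A new area is taken only if `S.cap γ < K`. The bound then grows by `4 * K - 2 * S.cap γ`,
      -- which covers the `2 * K` new chunks: the doubled capacity also pays for the abandoned
      -- areas.
      have hsum : ∑ γ₁ ∈ range G, 2 * Function.update S.cap γ cap' γ₁ + 2 * S.cap γ =
          ∑ γ₁ ∈ range G, 2 * S.cap γ₁ + 2 * cap' := by
        have hm : γ ∈ range G := mem_range.2 hγ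
        rw [← Finset.add_sum_erase _ _ hm, ← Finset.add_sum_erase (range G) (fun x => 2 * S.cap x) hm]
        have : ∑ x ∈ (range G).erase γ, 2 * Function.update S.cap γ cap' x =
            ∑ x ∈ (range G).erase γ, 2 * S.cap x :=
          Finset.sum_congr rfl fun x hx => by rw [Function.update_of_ne (Finset.ne_of_mem_erase hx)]
        rw [this, Function.update_self]
        ring
      have := h.bump_le
      rw [hbump']
      rw [hcap'] at hsum ⊢
      split_ifs at hsum ⊢ <;> omega
    · intro γ' hγ'
      change Function.update S.cap γ cap' γ' ≤ _
      by_cases hg : γ' = γ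
      · subst hg
        rw [Function.update_self]
        have h1 : groupSpace b L₀ s d ≤ groupSpace b L₀ s fun i => deg' (γ' * b + i) :=
          groupSpace_mono fun i hi => (hdeg i hi).ge
        have h2 : S.cap γ' ≤ groupSpace b L₀ s d :=
          (h.cap_le γ' hγ').trans (groupSpace_mono fun i hi => hd i hi)
        rw [hcap']
        split_ifs <;> omega
      · rw [Function.update_of_ne hg]
        exact (h.cap_le γ' hγ').trans (groupSpace_mono fun i hi => ((hne γ' hg i hi).1).ge)
  refine ⟨hmain, ?_, ?_⟩
  · change Function.update S.P γ P' γ ≠ 0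
    rwa [Function.update_self]
  · change K ≤ Function.update S.cap γ cap' γ
    rwa [Function.update_self]

end
end DegreeSequence

/-! ### Notation for programs, and rules with explicit values -/

namespace WordRAM

abbrev reg (x : ℕ) : Expr := .reg x

abbrev cst (k : ℕ) : Expr := .const k

/-- The expression `2 ^ e`. -/
def twoPow (e : Expr) : Expr := cst 1 <<< e

@[simp] theorem natEval_twoPow (w : ℕ) (r : ℕ → ℕ) (e : Expr) :
    (twoPow e).natEval w r = 2 ^ e.natEval w r := by simp [twoPow]

@[simp] theorem fits_twoPow (w : ℕ) (r : ℕ → ℕ) (e : Expr) :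
    (twoPow e).Fits w r ↔ e.Fits w r ∧ e.natEval w r < 2 ^ w := by simp [twoPow]

@[simp] theorem cost_twoPow (e : Expr) : (twoPow e).cost = e.cost + 2 := by
  simp [twoPow]; omega

/-- The commands of a list, one after another. -/
def Cmd.block : List Cmd → Cmd
  | [] => .skip
  | [p] => p
  | p :: q :: l => .seq p (Cmd.block (q :: l))

section
variable {w S : ℕ} {s : NatState} {t : ℕ} {Q : NatState → ℕ → Prop}

theorem wp_assign_eq {x : ℕ} {e : Expr} (v : ℕ) (h : e.Fits w s.regs)
    (hv : e.natEval w s.regs = v)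
    (hQ : Q ⟨Function.update s.regs x v, s.mem⟩ (t + (e.cost + 1))) :
    wp w S (.assign x e) s t Q := by
  subst hv; exact wp_assign h hQ

theorem wp_load_eq {x : ℕ} {a : Expr} (α v : ℕ) (hS : S ≤ 2 ^ w) (h : a.Fits w s.regs)
    (ha : a.natEval w s.regs = α) (hα : α < S) (hv : s.mem α = v)
    (hQ : Q ⟨Function.update s.regs x v, s.mem⟩ (t + (a.cost + 1))) :
    wp w S (.load x a) s t Q := by
  subst hv ha; exact wp_load hS h hα hQ

theorem wp_store_eq {a e : Expr} (α v : ℕ) (hS : S ≤ 2 ^ w) (h : a.Fits w s.regs)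
    (he : e.Fits w s.regs) (ha : a.natEval w s.regs = α) (hv : e.natEval w s.regs = v)
    (hα : α < S)
    (hQ : Q ⟨s.regs, Function.update s.mem α v⟩ (t + (a.cost + e.cost + 1))) :
    wp w S (.store a e) s t Q := by
  subst hv ha; exact wp_store hS h he hα hQ

theorem test_lt_two_pow (hw : 1 ≤ w) (p : Prop) [Decidable p] : (if p then 1 else 0) < 2 ^ w := by
  have := Nat.one_lt_two_pow (n := w) (by omega)
  split_ifs <;> omega

theorem mul_test_lt_two_pow (hw : 1 ≤ w) (p q : Prop) [Decidable p] [Decidable q] :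
    (if p then 1 else 0) * (if q then 1 else 0) < 2 ^ w := by
  have := Nat.one_lt_two_pow (n := w) (by omega)
  split_ifs <;> omega

theorem add_test_lt_two_pow (hw : 2 ≤ w) (p q : Prop) [Decidable p] [Decidable q] :
    (if p then 1 else 0) + (if q then 1 else 0) < 2 ^ w := by
  have : 2 ^ 2 ≤ 2 ^ w := Nat.pow_le_pow_right (by norm_num) hw
  split_ifs <;> omega

end
end WordRAM

namespace DegreeSequence
open Finset WordRAM

/-! ### Memory layout

The memory is divided into sixteen interleaved arrays; entry `j` of array `f` has address
`16 * j + f`. Array `0` is a table of `sel`, array `1` a table of `pop`; a store takes up five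
arrays `o, …, o + 4`, where `o = 2` during the construction and `o = 7` at the end; arrays `12`,
`13`, `14` hold one parameter each, and array `15` is scratch space. -/

/-- Arrays in different residue classes modulo 16 cannot collide, and none needs a length fixed in
advance. A bound `X` on all indices in use gives the address bound `16 * X`, and it can be sharpened
after compaction without moving anything. -/
def view (M : ℕ → ℕ) (o : ℕ) : Store where
  F γ := M (16 * γ + o)
  P γ := M (16 * γ + (o + 1))
  cap γ := M (16 * γ + (o + 2))
  ch j := M (16 * j + (o + 3))
  bump := M (o + 4)

structure Tables (b : ℕ) (M : ℕ → ℕ) : Prop where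
  size : M 12 = b
  sel : ∀ u < 2 ^ b, ∀ k ≤ b, M (16 * (u * (b + 1) + k)) = sel (6 * b) u k
  pop : ∀ u < 2 ^ b, M (16 * u + 1) = pop u

theorem Tables.congr {b : ℕ} {M M' : ℕ → ℕ} (h : Tables b M)
    (hM : ∀ a, a % 16 = 0 ∨ a % 16 = 1 ∨ a % 16 = 12 → M' a = M a) : Tables b M' where
  size := by rw [hM 12 (by simp), h.size]
  sel u hu k hk := by rw [hM _ (by omega), h.sel u hu k hk]
  pop u hu := by rw [hM _ (by omega), h.pop u hu]

/-- Bounds for the parameters: the word size `w`, the group size `b`, and the number `X` of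
entries of each of the interleaved arrays. -/
structure Params (w b X : ℕ) : Prop where
  one_le : 1 ≤ b
  le_word : 20 * b ≤ w
  table_le : 2 ^ b * (b + 1) ≤ X
  le_pow : 16 * X ≤ 2 ^ (20 * b)

section
variable {w b X : ℕ}

theorem Params.two_pow_le (h : Params w b X) {e : ℕ} (he : e ≤ 20 * b) : 2 ^ e ≤ 2 ^ w :=
  Nat.pow_le_pow_right (by norm_num) (he.trans h.le_word)

theorem Params.le_word_pow (h : Params w b X) : 16 * X ≤ 2 ^ w :=
  h.le_pow.trans (h.two_pow_le le_rfl)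

theorem Params.lt_word (h : Params w b X) : 20 * b < 2 ^ w :=
  h.le_word.trans_lt Nat.lt_two_pow_self

theorem Params.two_pow_le_table (h : Params w b X) : 2 ^ b ≤ X :=
  (Nat.le_mul_of_pos_right _ (by omega)).trans h.table_le

theorem Params.lt_table (h : Params w b X) : b < X :=
  Nat.lt_two_pow_self.trans_le h.two_pow_le_table

theorem table_index_lt {u k : ℕ} (hu : u < 2 ^ b) (hk : k ≤ b) :
    u * (b + 1) + k < 2 ^ b * (b + 1) := by
  have : (u + 1) * (b + 1) ≤ 2 ^ b * (b + 1) := Nat.mul_le_mul_right _ hu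
  rw [Nat.succ_mul] at this
  omega

end

/-- Reads item `r₆` of group `r₅` of the store at `o`. -/
def decode (o : ℕ) : Cmd := .block
  [.load 20 (cst 16 * reg 5 + cst o),
   .load 28 (cst 16 * reg 5 + cst (o + 1)),
   .load 21 (cst 16 * (reg 20 % twoPow (reg 6)) + cst 1),
   .assign 22 (cst 16 * (reg 28 + reg 21) + cst (o + 3)),
   .load 23 (reg 22),
   .load 24 (cst 16 * (reg 20 * (reg 2 + cst 1) + reg 21)),
   .assign 24 ((reg 23 % twoPow (reg 2)) * (reg 2 + cst 1) + (reg 6 - reg 24)),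
   .load 25 (cst 16 * reg 24),
   .load 26 (cst 16 * (reg 24 + cst 1)),
   .assign 26 (reg 26 - reg 25),
   .assign 27 ((reg 23 >>> (reg 2 + reg 25)) % twoPow (reg 26))]

/-- Rank and select in the boundary word take one table lookup each, and the start and end of the
field take one each, so the time is constant. The position of the chunk, the start and width of the
field, and the position of the group remain in registers for `increment`. -/
theorem wp_decode {w b X o γ i t : ℕ} {s : NatState} {Q : NatState → ℕ → Prop}
    (hp : Params w b X) (hT : Tables b s.mem) (ho : o + 3 < 16) (h2 : s.regs 2 = b)
    (h5 : s.regs 5 = γ) (h6 : s.regs 6 = i) (hγ : γ < X) (hi : i < b)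
    (hF : (view s.mem o).F γ < 2 ^ b) (hloc : (view s.mem o).loc γ i < X)
    (hwd : (view s.mem o).ch ((view s.mem o).loc γ i) < 2 ^ (8 * b))
    (hQ : ∀ r t', t' ≤ t + 100 → (∀ x < 20, r x = s.regs x) →
      r 22 = 16 * (view s.mem o).loc γ i + (o + 3) →
      r 23 = (view s.mem o).ch ((view s.mem o).loc γ i) →
      r 25 = fieldStart b (6 * b) ((view s.mem o).ch ((view s.mem o).loc γ i))
        (slotIdx (6 * b) ((view s.mem o).F γ) i) →
      r 26 = (view s.mem o).width b (6 * b) γ i →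
      r 27 = (view s.mem o).read b (6 * b) γ i → r 28 = (view s.mem o).P γ → Q ⟨r, s.mem⟩ t') :
    wp w (16 * X) (decode o) s t Q := by
  have hS := hp.le_word_pow
  have hlw := hp.lt_word
  have htab := hp.table_le
  have h2b := hp.two_pow_le_table
  have hp8 : 2 ^ (8 * b) ≤ 2 ^ w := hp.two_pow_le (by omega)
  have hpb : 2 ^ b ≤ 2 ^ w := hp.two_pow_le (by omega)
  have hp7 : 2 ^ (7 * b) ≤ 2 ^ w := hp.two_pow_le (by omega)
  set F := (view s.mem o).F γ with hFdef
  set P := (view s.mem o).P γ with hPdef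
  set idx := chunkIdx F i with hidx
  set loc := (view s.mem o).loc γ i with hlocdef
  set wd := (view s.mem o).ch loc with hwddef
  set k := slotIdx (6 * b) F i with hk
  have hloceq : loc = P + idx := rfl
  have hkb : k < b := slotIdx_lt _ _ hi
  have hFi : F % 2 ^ i < 2 ^ b := (Nat.mod_le _ _).trans_lt hF
  have hidxle : idx ≤ b := pop_le hFi
  have hselle : sel (6 * b) F idx ≤ i := sel_pop_mod_le _ _ _
  have hu : wd % 2 ^ b < 2 ^ b := Nat.mod_lt _ (by positivity)
  have hend := fieldEnd_le b (6 * b) wd k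
  have hi1 : 2 ^ i < 2 ^ b := Nat.pow_lt_pow_right (by norm_num) hi
  have hT1 := table_index_lt (u := F) (k := idx) hF hidxle
  have hT2 := table_index_lt (u := wd % 2 ^ b) (k := k) hu hkb.le
  have hT3 := table_index_lt (u := wd % 2 ^ b) (k := k + 1) hu hkb
  have hwidth : 2 ^ fieldWidth b (6 * b) wd k ≤ 2 ^ (7 * b) :=
    Nat.pow_le_pow_right (by norm_num) (by omega)
  have h7lt : 2 ^ (7 * b) < 2 ^ w :=
    Nat.pow_lt_pow_right (by norm_num) (by have := hp.one_le; have := hp.le_word; omega)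
  have hblt : 2 ^ b < 2 ^ w :=
    Nat.pow_lt_pow_right (by norm_num) (by have := hp.one_le; have := hp.le_word; omega)
  refine wp_seq (wp_load_eq (16 * γ + o) F hS (by simp) (by simp [h5]) (by omega) rfl ?_)
  refine wp_seq (wp_load_eq (16 * γ + (o + 1)) P hS (by simp) (by simp [h5])
    (by omega) rfl ?_)
  refine wp_seq (wp_load_eq (16 * (F % 2 ^ i) + 1) idx hS ?_ (by simp [h6])
    (by omega) (hT.pop _ hFi) ?_)
  · simp [h6]; omega
  refine wp_seq (wp_assign_eq (16 * loc + (o + 3)) (by simp) (by simp [hloceq]) ?_)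
  refine wp_seq (wp_load_eq (16 * loc + (o + 3)) wd hS (by simp) (by simp) (by omega) rfl ?_)
  refine wp_seq (wp_load_eq (16 * (F * (b + 1) + idx)) (sel (6 * b) F idx) hS (by simp)
    (by simp [h2]) (by omega) (hT.sel _ hF _ hidxle) ?_)
  refine wp_seq (wp_assign_eq (wd % 2 ^ b * (b + 1) + k) ?_ (by simp [h2, h6, k, slotIdx, idx]) ?_)
  · simp [h2, h6]; omega
  refine wp_seq (wp_load_eq (16 * (wd % 2 ^ b * (b + 1) + k)) (sel (6 * b) (wd % 2 ^ b) k) hS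
    (by simp) (by simp) (by omega) (hT.sel _ hu _ hkb.le) ?_)
  refine wp_seq (wp_load_eq (16 * (wd % 2 ^ b * (b + 1) + (k + 1)))
    (sel (6 * b) (wd % 2 ^ b) (k + 1)) hS
    (by simp) (by simp [Nat.add_assoc]) (by omega) (hT.sel _ hu _ hkb) ?_)
  refine wp_seq (wp_assign_eq (fieldWidth b (6 * b) wd k) ?_ (by simp [fieldWidth]) ?_)
  · simp [sel_mono]
  refine wp_assign_eq (readField b (6 * b) wd k) ?_ (by simp [h2, readField, fieldStart]) ?_
  · have h1 : wd / 2 ^ (b + fieldStart b (6 * b) wd k) ≤ wd := Nat.div_le_self _ _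
    simp [h2]
    simp only [fieldStart] at h1 hend
    omega
  refine hQ _ _ ?_ ?_ ?_ ?_ ?_ ?_ ?_ ?_
  · simp
  · intro x hx
    simp only [Function.update_apply]
    simp [show x ≠ 27 by omega, show x ≠ 26 by omega, show x ≠ 25 by omega, show x ≠ 24 by omega,
      show x ≠ 23 by omega, show x ≠ 22 by omega, show x ≠ 21 by omega, show x ≠ 20 by omega,
      show x ≠ 28 by omega]
  all_goals simp
  · rfl
  · rfl
  · rfl

end DegreeSequence

/-! ### Programs that encode and store a group -/

namespace DegreeSequence
open Finset WordRAM

theorem view_congr {M M' : ℕ → ℕ} {o : ℕ} (ho : o + 4 < 16)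
    (h : ∀ a, o ≤ a % 16 → a % 16 ≤ o + 4 → M' a = M a) : view M' o = view M o := by
  ext x
  all_goals
    simp only [view]
    rw [h _ (by omega) (by omega)]

/-- Computes the length of the code for `r₂₇` in `r₁₁`. -/
def computeLength : Cmd := .block
  [.assign 11 (reg 3),
   .loop ((reg 27 + reg 4) >>> reg 11) (.assign 11 (reg 11 + cst 1))]

/-- The search starts at `L₀`, so only the excess over the minimum length costs time; the first
encoding of a group relies on this. -/
theorem wp_computeLength {w S L₀ sl d t : ℕ} {s : NatState} {Q : NatState → ℕ → Prop}
    (h3 : s.regs 3 = L₀) (h4 : s.regs 4 = sl) (h27 : s.regs 27 = d) (hlt : d + sl < 2 ^ w)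
    (hL : codeLength L₀ sl d < 2 ^ w)
    (hQ : ∀ t' ≤ t + 10 + 10 * (codeLength L₀ sl d - L₀),
      Q ⟨Function.update s.regs 11 (codeLength L₀ sl d), s.mem⟩ t') :
    wp w S computeLength s t Q := by
  refine wp_seq (wp_assign_eq L₀ (by simp) (by simp [h3]) ?_)
  have hle : L₀ ≤ codeLength L₀ sl d := le_max_left _ _
  refine wp_loop (fun s' t' => ∃ l, L₀ ≤ l ∧ l ≤ codeLength L₀ sl d ∧
    s' = ⟨Function.update s.regs 11 l, s.mem⟩ ∧ t' ≤ t + 2 + 10 * (l - L₀))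
    (fun s' => codeLength L₀ sl d - s'.regs 11) ⟨L₀, le_rfl, hle, rfl, by simp⟩ ?_
  rintro _ t' ⟨l, hl1, hl2, rfl, ht⟩
  refine ⟨?_, ?_, ?_, ?_⟩
  · simp [h4, h27]; omega
  · simp only [natEval_shr, natEval_add, natEval_reg]
    simp only [ne_eq, Nat.reduceEqDiff, not_false_eq_true, Function.update_of_ne, h27, h4]
    exact (Nat.div_le_self _ _).trans_lt hlt
  · intro h0
    simp [h4, h27] at h0
    have h1 : codeLength L₀ sl d = l := by
      have : Nat.size (d + sl) ≤ l := Nat.size_le.2 h0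
      exact le_antisymm (max_le hl1 this) hl2
    have := hQ (t' + 6) (by rw [h1]; omega)
    rw [h1] at this
    simpa using this
  · intro h0
    simp [h4, h27] at h0
    have h1 : l < codeLength L₀ sl d := (Nat.lt_size.2 h0).trans_le (le_max_right _ _)
    refine wp_assign_eq (l + 1) (by simp) (by simp) ⟨⟨l + 1, by omega, h1, by simp, ?_⟩, ?_⟩
    · simp; omega
    · simp; omega

/-- One step of the greedy encoder, for item `r₆` of group `r₅` of the store at `src`. The encoder
is kept in `r₇, …, r₁₀` and in scratch space. -/
def encodeStep (src : ℕ) : Cmd := .block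
  [decode src,
   computeLength,
   .ite (.bin .lt (cst 0) (reg 9) * .bin .lt (reg 2) (reg 9 + reg 11))
    (.block [.store (cst 16 * reg 8 + cst 15) (reg 10),
      .assign 8 (reg 8 + cst 1),
      .assign 7 (reg 7 + twoPow (reg 6 - cst 1)),
      .assign 9 (cst 0),
      .assign 10 (cst 0)])
    .skip,
   .assign 10 (reg 10 + ((reg 27 <<< (reg 9 + reg 2)) +
      .bin .lt (reg 11) (reg 2 + cst 1) * twoPow (reg 9 + reg 11 - cst 1))),
   .assign 9 (reg 9 + reg 11),
   .assign 6 (reg 6 + cst 1)]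

/-- The registers and the scratch space hold the state of the encoder. -/
structure Holds (E : Encoder) (s : NatState) : Prop where
  F : s.regs 7 = E.F
  cnt : s.regs 8 = E.cnt
  cur : s.regs 9 = E.cur
  wd : s.regs 10 = E.wd
  c : ∀ j < E.cnt, s.mem (16 * j + 15) = E.c j

theorem wp_encodeStep {w b X src γ i L₀ sl t : ℕ} {d : ℕ → ℕ} {E : Encoder} {s : NatState}
    {Q : NatState → ℕ → Prop} (hp : Params w b X) (hT : Tables b s.mem) (ho : src + 4 < 15)
    (h2 : s.regs 2 = b) (h3 : s.regs 3 = L₀) (h4 : s.regs 4 = sl)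
    (h5 : s.regs 5 = γ) (h6 : s.regs 6 = i) (hγ : γ < X) (hi : i < b)
    (hF : (view s.mem src).F γ < 2 ^ b) (hloc : (view s.mem src).loc γ i < X)
    (hwd : (view s.mem src).ch ((view s.mem src).loc γ i) < 2 ^ (8 * b))
    (hread : (view s.mem src).read b (6 * b) γ i = d i) (hd : d i + sl < 2 ^ (6 * b))
    (hL₀ : 1 ≤ L₀) (hL₀' : L₀ ≤ 6 * b)
    (hE : E.Inv b (6 * b) d (fun j => d j + sl) (fun j => codeLength L₀ sl (d j)) i)
    (hH : Holds E s)
    (hQ : ∀ E' r M t', t' ≤ t + 200 + 10 * (codeLength L₀ sl (d i) - L₀) →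
      E'.Inv b (6 * b) d (fun j => d j + sl) (fun j => codeLength L₀ sl (d j)) (i + 1) →
      Holds E' ⟨r, M⟩ → (∀ x < 20, x < 6 ∨ 11 < x → r x = s.regs x) → r 6 = i + 1 →
      (∀ a, a % 16 ≠ 15 → M a = s.mem a) → Q ⟨r, M⟩ t') :
    wp w (16 * X) (encodeStep src) s t Q := by
  set L := codeLength L₀ sl (d i) with hL
  have hb := hp.one_le
  have hLle : L ≤ 6 * b := max_le hL₀' (Nat.size_le.2 hd)
  have hLge : 1 ≤ L := hL₀.trans (le_max_left _ _)
  have hlw := hp.lt_word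
  have hw := hp.le_word
  have hS := hp.le_word_pow
  have hbX := hp.lt_table
  have hE' := hE.step hLge ((Nat.le_add_right _ _).trans_lt (lt_two_pow_codeLength L₀ sl (d i)))
    (lt_two_pow_codeLength L₀ sl (d i)) hLle le_rfl
  have hcntle := hE.cnt_le
  have hcur7 : E.cur ≤ 7 * b := by
    have := hE.cur_le
    omega
  refine wp_seq (wp_decode hp hT (by omega) h2 h5 h6 hγ hi hF hloc hwd ?_)
  intro r t₁ ht₁ hr _ _ _ _ h27 _
  rw [hread] at h27
  refine wp_seq (wp_computeLength (L₀ := L₀) (sl := sl) (d := d i) (by simp [hr, h3])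
    (by simp [hr, h4]) h27 (hd.trans_le (hp.two_pow_le (by omega))) (by omega) ?_)
  rw [← hL]
  intro t₂ ht₂
  have hr2 : r 2 = b := by rw [hr 2 (by simp), h2]
  have hr6 : r 6 = i := by rw [hr 6 (by simp), h6]
  have hr7 : r 7 = E.F := by rw [hr 7 (by simp), hH.F]
  have hr8 : r 8 = E.cnt := by rw [hr 8 (by simp), hH.cnt]
  have hr9 : r 9 = E.cur := by rw [hr 9 (by simp), hH.cur]
  have hr10 : r 10 = E.wd := by rw [hr 10 (by simp), hH.wd]
  refine wp_seq ?_
  -- Whether or not a chunk was closed, the state is now that of `E.close b L i`, and the same tail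
  -- performs `Encoder.append`.
  have htail : ∀ (C : Encoder) (r' M' : ℕ → ℕ) (t' : ℕ), t' ≤ t₂ + 60 →
      C = E.close b L i → C.cur ≤ 7 * b → Holds C ⟨r', M'⟩ →
      (∀ x, x < 7 ∨ 10 < x → r' x = Function.update r 11 L x) →
      (∀ a, a % 16 ≠ 15 → M' a = s.mem a) →
      wp w (16 * X) (.block [.assign 10 (reg 10 + ((reg 27 <<< (reg 9 + reg 2)) +
        .bin .lt (reg 11) (reg 2 + cst 1) * twoPow (reg 9 + reg 11 - cst 1))),
        .assign 9 (reg 9 + reg 11), .assign 6 (reg 6 + cst 1)]) ⟨r', M'⟩ t' Q := by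
    intro C r' M' t' ht' hC hCcur hHC hr' hM'
    have e2 : r' 2 = b := by rw [hr' 2 (by simp)]; simp [hr2]
    have e6 : r' 6 = i := by rw [hr' 6 (by simp)]; simp [hr6]
    have e11 : r' 11 = L := by rw [hr' 11 (by simp)]; simp
    have e27 : r' 27 = d i := by rw [hr' 27 (by simp)]; simp [h27]
    have e9 : r' 9 = C.cur := hHC.cur
    have e10 : r' 10 = C.wd := hHC.wd
    refine wp_seq (wp_assign_eq (C.append b L (d i)).wd ?_ ?_ ?_)
    · simp [e2, e9, e11]
      omega
    · simp [e2, e9, e10, e11, e27, Encoder.append]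
    refine wp_seq (wp_assign_eq (C.append b L (d i)).cur (by simp)
      (by simp [e9, e11, Encoder.append]) ?_)
    refine wp_assign_eq (i + 1) (by simp) (by simp [e6]) ?_
    refine hQ (C.append b L (d i)) _ _ _ ?_ (by rw [hC]; exact hE') ⟨?_, ?_, ?_, ?_, ?_⟩ ?_ ?_ hM'
    · simp; omega
    · simpa [Encoder.append] using hHC.F
    · simpa [Encoder.append] using hHC.cnt
    · simp
    · simp
    · exact hHC.c
    · intro x hx hx'
      simp only [Function.update_apply]
      rw [if_neg (by omega), if_neg (by omega), if_neg (by omega), hr' x (by omega),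
        Function.update_of_ne (by omega), hr x hx]
    · simp
  refine wp_ite ?_ ?_ ?_ ?_
  · simp [hr2, hr9]; omega
  · exact mul_test_lt_two_pow (by omega) _ _
  · intro hc
    have hc' : 0 < E.cur ∧ b < E.cur + L := by
      simp [hr2, hr9] at hc
      omega
    have hi0 : i ≠ 0 := (hE.pos hc'.1).ne'
    refine wp_seq (wp_store_eq (16 * E.cnt + 15) E.wd hS (by simp) (by simp) (by simp [hr8])
      (by simp [hr10]) (by omega) ?_)
    refine wp_seq (wp_assign_eq (E.cnt + 1) (by simp) (by simp [hr8]) ?_)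
    refine wp_seq (wp_assign_eq (E.F + 2 ^ (i - 1)) ?_ (by simp [hr7, hr6]) ?_)
    · simp [hr6]; omega
    refine wp_seq (wp_assign_eq 0 (by simp) (by simp) ?_)
    refine wp_assign_eq 0 (by simp) (by simp) ?_
    have hclose : E.close b L i = ⟨E.F + 2 ^ (i - 1), E.cnt + 1, 0, 0, E.chunks⟩ := if_pos hc'
    refine htail _ _ _ _ ?_ hclose.symm (by simp) ⟨?_, ?_, ?_, ?_, ?_⟩ ?_ ?_
    · simp
    · simp
    · simp
    · simp
    · simp
    · intro j hj
      dsimp only at hj ⊢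
      rw [Encoder.chunks]
      by_cases hj' : j = E.cnt
      · subst hj'; simp
      · rw [Function.update_of_ne hj', Function.update_of_ne (by omega)]
        exact hH.c j (by omega)
    · intro x hx
      simp only [Function.update_apply]
      rw [if_neg (by omega), if_neg (by omega), if_neg (by omega), if_neg (by omega)]
    · intro a ha
      dsimp only
      rw [Function.update_of_ne (by omega)]
  · intro hc
    have hc' : ¬ (0 < E.cur ∧ b < E.cur + L) := by
      simp [hr2, hr9] at hc
      omega
    refine wp_skip (htail E _ _ _ ?_ (if_neg hc').symm hcur7 ⟨?_, ?_, ?_, ?_, ?_⟩ ?_ ?_)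
    · simp
    · simp [hr7]
    · simp [hr8]
    · simp [hr9]
    · simp [hr10]
    · exact hH.c
    · intro x _; rfl
    · intro a _; rfl

end DegreeSequence

namespace DegreeSequence
open Finset WordRAM

/-- Encodes group `r₅` of the store at `src`, with boundary word in `r₇`, number of chunks in `r₈`,
and the chunks in scratch space. -/
def encodeGroup (src : ℕ) : Cmd := .block
  [.assign 6 (cst 0),
   .assign 7 (cst 0),
   .assign 8 (cst 0),
   .assign 9 (cst 0),
   .assign 10 (cst 0),
   .loop (.bin .lt (reg 6) (reg 2)) (encodeStep src),
   .store (cst 16 * reg 8 + cst 15) (reg 10),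
   .assign 8 (reg 8 + cst 1)]

/-- A bound for the time for encoding a group with the values `d i`. -/
def encodeTime (b L₀ sl : ℕ) (d : ℕ → ℕ) : ℕ :=
  ∑ i ∈ range b, (210 + 10 * (codeLength L₀ sl (d i) - L₀))

theorem wp_encodeGroup {w b X src γ L₀ sl t : ℕ} {d : ℕ → ℕ} {s : NatState}
    {Q : NatState → ℕ → Prop} (hp : Params w b X) (hT : Tables b s.mem) (ho : src + 4 < 15)
    (h2 : s.regs 2 = b) (h3 : s.regs 3 = L₀) (h4 : s.regs 4 = sl)
    (h5 : s.regs 5 = γ) (hγ : γ < X) (hF : (view s.mem src).F γ < 2 ^ b)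
    (hsrc : ∀ i < b, (view s.mem src).loc γ i < X ∧
      (view s.mem src).ch ((view s.mem src).loc γ i) < 2 ^ (8 * b) ∧
      (view s.mem src).read b (6 * b) γ i = d i ∧ d i + sl < 2 ^ (6 * b))
    (hL₀ : 1 ≤ L₀) (hL₀' : L₀ ≤ 6 * b)
    (hQ : ∀ r M t', t' ≤ t + 50 + encodeTime b L₀ sl d →
      Encodes b (6 * b) (r 7) (fun j => M (16 * j + 15)) (r 8) d (fun i => d i + sl) →
      1 ≤ r 8 → r 8 ≤ b → 2 * r 8 ≤ groupSpace b L₀ sl d →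
      (∀ x < 20, x < 6 ∨ 11 < x → r x = s.regs x) →
      (∀ a, a % 16 ≠ 15 → M a = s.mem a) → Q ⟨r, M⟩ t') :
    wp w (16 * X) (encodeGroup src) s t Q := by
  have hb := hp.one_le
  have hw := hp.le_word
  have hlw := hp.lt_word
  have hS := hp.le_word_pow
  have hbX := hp.lt_table
  refine wp_seq (wp_assign_eq 0 (by simp) (by simp) ?_)
  refine wp_seq (wp_assign_eq 0 (by simp) (by simp) ?_)
  refine wp_seq (wp_assign_eq 0 (by simp) (by simp) ?_)
  refine wp_seq (wp_assign_eq 0 (by simp) (by simp) ?_)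
  refine wp_seq (wp_assign_eq 0 (by simp) (by simp) ?_)
  refine wp_seq (wp_loop (fun s' t' => ∃ i E, i ≤ b ∧ s'.regs 6 = i ∧
    Encoder.Inv b (6 * b) d (fun j => d j + sl) (fun j => codeLength L₀ sl (d j)) i E ∧
    Holds E s' ∧ (∀ x < 20, x < 6 ∨ 11 < x → s'.regs x = s.regs x) ∧
    (∀ a, a % 16 ≠ 15 → s'.mem a = s.mem a) ∧
    t' ≤ t + 10 + ∑ j ∈ range i, (210 + 10 * (codeLength L₀ sl (d j) - L₀)))
    (fun s' => b - s'.regs 6) ?_ ?_)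
  · refine ⟨0, _, by omega, by simp, Encoder.inv_zero b _ _ _ _ (fun _ => 0),
      ⟨by simp, by simp, by simp, by simp, by simp⟩, ?_, fun _ _ => rfl, by simp⟩
    intro x _ hx
    simp only [Function.update_apply]
    simp [show x ≠ 6 by omega, show x ≠ 7 by omega, show x ≠ 8 by omega, show x ≠ 9 by omega,
      show x ≠ 10 by omega]
  rintro s' t' ⟨i, E, hi, h6, hE, hH, hr, hM, ht⟩
  have e2 : s'.regs 2 = b := by rw [hr 2 (by simp) (by simp), h2]
  refine ⟨?_, ?_, ?_, ?_⟩
  · simp [h6, e2]; omega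
  · exact test_lt_two_pow (by omega) _
  · intro h0
    have hib : i = b := by
      simp [h6, e2] at h0
      omega
    subst hib
    have hcnt := hE.cnt_le
    have hcnt' := hE.cnt_le_div hb
    refine wp_seq (wp_store_eq (16 * E.cnt + 15) E.wd hS (by simp) (by simp) (by simp [hH.cnt])
      (by simp [hH.wd]) (by omega) ?_)
    refine wp_assign_eq (E.cnt + 1) (by simp) (by simp [hH.cnt]) ?_
    refine hQ _ _ _ ?_ ?_ ?_ ?_ ?_ ?_ ?_
    · simp only [encodeTime]
      simp; omega
    · have := hE.encodes
      simp only [ne_eq, Nat.reduceEqDiff, not_false_eq_true, Function.update_of_ne, hH.F,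
        Function.update_self]
      refine this.congr ?_ (fun _ _ => rfl) (fun _ _ => rfl)
      intro r hr
      rw [Encoder.chunks]
      by_cases hr' : r = E.cnt
      · subst hr'; simp
      · rw [Function.update_of_ne hr', Function.update_of_ne (by omega)]
        exact hH.c r (by omega)
    · simp
    · simp; omega
    · simp [groupSpace]; omega
    · intro x hx hx'
      dsimp only
      rw [Function.update_of_ne (by omega), hr x hx hx']
    · intro a ha
      dsimp only
      rw [Function.update_of_ne (by omega), hM a ha]
  · intro h0
    have hib : i < b := by
      simp [h6, e2] at h0
      omega
    have hview : view s'.mem src = view s.mem src :=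
      view_congr (by omega) fun a _ _ => hM a (by omega)
    obtain ⟨hloc, hwd, hread, hd⟩ := hsrc i hib
    refine wp_encodeStep (d := d) (E := E) (γ := γ) (i := i) (L₀ := L₀) (sl := sl) hp
      (hT.congr fun a _ => hM a (by omega)) ho e2
      (by rw [hr 3 (by simp) (by simp), h3]) (by rw [hr 4 (by simp) (by simp), h4])
      (by rw [hr 5 (by simp) (by simp), h5]) h6 hγ hib (by rwa [hview]) (by rwa [hview])
      (by rwa [hview]) (by rwa [hview]) hd hL₀ hL₀' hE hH ?_
    intro E' r M t'' ht'' hE' hH' hr' hr6 hM'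
    refine ⟨⟨i + 1, E', hib, hr6, hE', hH', ?_, ?_, ?_⟩, ?_⟩
    · intro x hx hx'
      rw [← hr x hx hx', ← hr' x hx hx']
    · intro a ha
      rw [← hM a ha, ← hM' a ha]
    · rw [sum_range_succ]
      simp at ht''
      omega
    · dsimp only
      omega

/-- Stores the encoding produced by `encodeGroup` as group `r₅` of the store at `dst`. -/
def installGroup (dst : ℕ) : Cmd := .block
  [.store (cst 16 * reg 5 + cst dst) (reg 7),
   .load 14 (cst 16 * reg 5 + cst (dst + 2)),
   .ite (.bin .lt (reg 14) (reg 8))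
    (.block [.load 15 (cst (dst + 4)),
      .store (cst 16 * reg 5 + cst (dst + 1)) (reg 15),
      .store (cst 16 * reg 5 + cst (dst + 2)) (cst 2 * reg 8),
      .store (cst (dst + 4)) (reg 15 + cst 2 * reg 8)])
    .skip,
   .load 15 (cst 16 * reg 5 + cst (dst + 1)),
   .assign 6 (cst 0),
   .loop (.bin .lt (reg 6) (reg 8)) (.block
    [.load 14 (cst 16 * reg 6 + cst 15),
     .store (cst 16 * (reg 15 + reg 6) + cst (dst + 3)) (reg 14),
     .assign 6 (reg 6 + cst 1)])]

/-- The memory `M` after copying `j` chunks from scratch space to position `P` of the store at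
`dst`. -/
def copyChunks (M : ℕ → ℕ) (dst P j : ℕ) : ℕ → ℕ := fun a =>
  if a % 16 = dst + 3 ∧ P ≤ a / 16 ∧ a / 16 < P + j then M (16 * (a / 16 - P) + 15) else M a

theorem update_copyChunks {M : ℕ → ℕ} {dst P j : ℕ} (hd : dst + 3 < 15) :
    Function.update (copyChunks M dst P j) (16 * (P + j) + (dst + 3)) (M (16 * j + 15)) =
      copyChunks M dst P (j + 1) := by
  funext a
  by_cases ha : a = 16 * (P + j) + (dst + 3)
  · rw [ha, Function.update_self, copyChunks, if_pos (by omega)]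
    congr 1; omega
  · rw [Function.update_of_ne ha, copyChunks, copyChunks]
    by_cases h : a % 16 = dst + 3 ∧ P ≤ a / 16 ∧ a / 16 < P + j
    · rw [if_pos h, if_pos (by omega)]
    · rw [if_neg h, if_neg (by omega)]

/-- The memory after the administrative part of `installGroup`. -/
def reserve (M : ℕ → ℕ) (dst γ F' K : ℕ) : ℕ → ℕ :=
  let M₁ := Function.update M (16 * γ + dst) F'
  if M (16 * γ + (dst + 2)) < K then
    Function.update (Function.update (Function.update M₁ (16 * γ + (dst + 1)) (M (dst + 4)))
      (16 * γ + (dst + 2)) (2 * K)) (dst + 4) (M (dst + 4) + 2 * K)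
  else M₁

theorem reserve_of_mod {M : ℕ → ℕ} {dst γ F' K a : ℕ} (hd : dst + 4 < 15)
    (ha : a % 16 < dst ∨ a % 16 = dst + 3 ∨ dst + 4 < a % 16) :
    reserve M dst γ F' K a = M a := by
  rw [reserve]
  split_ifs
  · rw [Function.update_of_ne (by omega), Function.update_of_ne (by omega),
      Function.update_of_ne (by omega), Function.update_of_ne (by omega)]
  · rw [Function.update_of_ne (by omega)]

/-- This identifies the effect of `installGroup` on memory with the abstract `Store.install`, so
that `Store.Inv.install` applies to the program. -/
theorem view_copyChunks_reserve {M : ℕ → ℕ} {dst γ F' K P' : ℕ} (hd : dst + 4 < 15)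
    (hP' : P' = if (view M dst).cap γ < K then (view M dst).bump else (view M dst).P γ) :
    view (copyChunks (reserve M dst γ F' K) dst P' K) dst =
      (view M dst).install γ F' K fun j => M (16 * j + 15) := by
  have hne : ∀ a, a % 16 ≠ dst + 3 →
      copyChunks (reserve M dst γ F' K) dst P' K a = reserve M dst γ F' K a := by
    intro a ha
    rw [copyChunks, if_neg (by omega)]
  by_cases hc : (view M dst).cap γ < K
  · have hres : reserve M dst γ F' K = Function.update (Function.update (Function.update
        (Function.update M (16 * γ + dst) F') (16 * γ + (dst + 1)) (M (dst + 4)))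
        (16 * γ + (dst + 2)) (2 * K)) (dst + 4) (M (dst + 4) + 2 * K) := if_pos hc
    rw [if_pos hc] at hP'
    simp only [Store.install, if_pos hc, ← hP']
    ext x <;> dsimp only [view]
    · rw [hne _ (by omega), hres]
      simp only [Function.update_apply]
      split_ifs <;> first | rfl | omega
    · rw [hne _ (by omega), hres]
      simp only [Function.update_apply]
      split_ifs <;> first | exact hP'.symm | rfl | omega
    · rw [hne _ (by omega), hres]
      simp only [Function.update_apply]
      split_ifs <;> first | rfl | omega
    · rw [copyChunks, show (16 * x + (dst + 3)) / 16 = x by omega,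
        reserve_of_mod hd (by omega), reserve_of_mod hd (by omega)]
      by_cases h : P' ≤ x ∧ x < P' + K
      · rw [if_pos h, if_pos (by omega)]
      · rw [if_neg h, if_neg (by omega)]
    · rw [hne _ (by omega), hres, Function.update_self, hP']
      rfl
  · have hres : reserve M dst γ F' K = Function.update M (16 * γ + dst) F' := if_neg hc
    rw [if_neg hc] at hP'
    simp only [Store.install, if_neg hc, ← hP']
    ext x <;> dsimp only [view]
    · rw [hne _ (by omega), hres]
      simp only [Function.update_apply]
      split_ifs <;> first | rfl | omega
    · rw [hne _ (by omega), hres, hP']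
      simp only [Function.update_apply]
      split_ifs <;> first | omega | (subst_vars; rfl)
    · rw [hne _ (by omega), hres]
      simp only [Function.update_apply]
      split_ifs <;> first | omega | (subst_vars; rfl)
    · rw [copyChunks, show (16 * x + (dst + 3)) / 16 = x by omega,
        reserve_of_mod hd (by omega), reserve_of_mod hd (by omega)]
      by_cases h : P' ≤ x ∧ x < P' + K
      · rw [if_pos h, if_pos (by omega)]
      · rw [if_neg h, if_neg (by omega)]
    · rw [hne _ (by omega), hres, Function.update_of_ne (by omega)]

theorem wp_installGroup {w b X dst γ K t : ℕ} {s : NatState}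
    {Q : NatState → ℕ → Prop} (hp : Params w b X) (hd : dst + 4 < 15)
    (h5 : s.regs 5 = γ) (h8 : s.regs 8 = K) (hγ : γ < X) (hK : K ≤ X)
    (hcap : (view s.mem dst).cap γ < 2 ^ w)
    (hP : (if (view s.mem dst).cap γ < K then (view s.mem dst).bump else (view s.mem dst).P γ) + K
      ≤ X)
    (hQ : ∀ r M t', t' ≤ t + 100 + 30 * K →
      view M dst = (view s.mem dst).install γ (s.regs 7) K (fun j => s.mem (16 * j + 15)) →
      (∀ x < 20, x ≠ 6 → x ≠ 14 → x ≠ 15 → r x = s.regs x) →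
      (∀ a, a % 16 < dst ∨ dst + 4 < a % 16 → M a = s.mem a) → Q ⟨r, M⟩ t') :
    wp w (16 * X) (installGroup dst) s t Q := by
  have hb := hp.one_le
  have hw := hp.le_word
  have hS := hp.le_word_pow
  set P' := if (view s.mem dst).cap γ < K then (view s.mem dst).bump else (view s.mem dst).P γ
    with hP'
  set M₁ := reserve s.mem dst γ (s.regs 7) K with hM₁
  have hM₁P : M₁ (16 * γ + (dst + 1)) = P' := by
    by_cases hc : (view s.mem dst).cap γ < K
    · rw [hP', if_pos hc, hM₁, reserve,
        if_pos (show s.mem (16 * γ + (dst + 2)) < K from hc), Function.update_of_ne (by omega),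
        Function.update_of_ne (by omega), Function.update_self]
      rfl
    · rw [hP', if_neg hc, hM₁, reserve,
        if_neg (show ¬ s.mem (16 * γ + (dst + 2)) < K from hc), Function.update_of_ne (by omega)]
      rfl
  have htail : ∀ r' t', t' ≤ t + 60 → (∀ x < 20, x ≠ 14 → x ≠ 15 → r' x = s.regs x) →
      wp w (16 * X) (.block [.load 15 (cst 16 * reg 5 + cst (dst + 1)),
       .assign 6 (cst 0),
       .loop (.bin .lt (reg 6) (reg 8)) (.block
        [.load 14 (cst 16 * reg 6 + cst 15),
         .store (cst 16 * (reg 15 + reg 6) + cst (dst + 3)) (reg 14),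
         .assign 6 (reg 6 + cst 1)])]) ⟨r', M₁⟩ t' Q := by
    intro r' t' ht' hr'
    refine wp_seq (wp_load_eq (16 * γ + (dst + 1)) P' hS (by simp)
      (by simp [hr' 5 (by simp) (by simp) (by simp), h5]) (by omega) hM₁P ?_)
    refine wp_seq (wp_assign_eq 0 (by simp) (by simp) ?_)
    refine wp_loop (fun s' t' => ∃ j ≤ K, s'.regs 6 = j ∧ s'.regs 15 = P' ∧
      (∀ x < 20, x ≠ 6 → x ≠ 14 → x ≠ 15 → s'.regs x = s.regs x) ∧
      s'.mem = copyChunks M₁ dst P' j ∧ t' ≤ t + 80 + 30 * j) (fun s' => K - s'.regs 6) ?_ ?_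
    · refine ⟨0, by omega, by simp, by simp, ?_, ?_, ?_⟩
      · intro x hx h1 h2 h3
        simp only [Function.update_apply]
        rw [if_neg h1, if_neg h3, hr' x hx h2 h3]
      · funext a
        rw [copyChunks, if_neg (by omega)]
      · simp; omega
    rintro ⟨r, M⟩ t'' ⟨j, hj, h6, h15, hr, rfl, ht⟩
    dsimp only at h6 h15 hr
    have e8 : r 8 = K := by rw [hr 8 (by simp) (by simp) (by simp) (by simp), h8]
    refine ⟨?_, ?_, ?_, ?_⟩
    · simp [h6, e8]; omega
    · exact test_lt_two_pow (by omega) _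
    · intro h0
      have hjK : j = K := by
        simp [h6, e8] at h0
        omega
      subst hjK
      refine hQ _ _ _ ?_ (view_copyChunks_reserve hd hP') hr ?_
      · simp; omega
      · intro a ha
        rw [copyChunks, if_neg (by omega), hM₁, reserve_of_mod hd (by omega)]
    · intro h0
      have hjK : j < K := by
        simp [h6, e8] at h0
        omega
      refine wp_seq (wp_load_eq (16 * j + 15) (M₁ (16 * j + 15)) hS (by simp) (by simp [h6])
        (by omega) ?_ ?_)
      · dsimp only
        rw [copyChunks, if_neg (by omega)]
      refine wp_seq (wp_store_eq (16 * (P' + j) + (dst + 3)) (M₁ (16 * j + 15)) hS (by simp)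
        (by simp) (by simp [h6, h15]) (by simp) (by omega) ?_)
      refine wp_assign_eq (j + 1) (by simp) (by simp [h6]) ?_
      refine ⟨⟨j + 1, hjK, by simp, by simp [h15], ?_, update_copyChunks (by omega), ?_⟩, ?_⟩
      · intro x hx h1 h2 h3
        dsimp only
        rw [Function.update_of_ne h1, Function.update_of_ne h2, hr x hx h1 h2 h3]
      · simp; omega
      · simp [h6]; omega
  have hcapval : Function.update s.mem (16 * γ + dst) (s.regs 7) (16 * γ + (dst + 2)) =
      (view s.mem dst).cap γ := by
    rw [Function.update_of_ne (by omega)]; rfl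
  refine wp_seq (wp_store_eq (16 * γ + dst) (s.regs 7) hS (by simp) (by simp) (by simp [h5])
    (by simp) (by omega) ?_)
  refine wp_seq (wp_load_eq (16 * γ + (dst + 2)) ((view s.mem dst).cap γ) hS (by simp)
    (by simp [h5]) (by omega) hcapval ?_)
  refine wp_seq (wp_ite ?_ ?_ ?_ ?_)
  · simp [h8]; omega
  · exact test_lt_two_pow (by omega) _
  · intro hc
    have hc' : (view s.mem dst).cap γ < K := by
      simp [h8] at hc
      omega
    have hM₁eq : M₁ = Function.update (Function.update (Function.update
        (Function.update s.mem (16 * γ + dst) (s.regs 7))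
        (16 * γ + (dst + 1)) (s.mem (dst + 4)))
        (16 * γ + (dst + 2)) (2 * K)) (dst + 4) (s.mem (dst + 4) + 2 * K) := if_pos hc'
    refine wp_seq (wp_load_eq (dst + 4) (s.mem (dst + 4)) hS (by simp) (by simp) (by omega) ?_ ?_)
    · dsimp only
      rw [Function.update_of_ne (by omega)]
    refine wp_seq (wp_store_eq (16 * γ + (dst + 1)) (s.mem (dst + 4)) hS (by simp) (by simp)
      (by simp [h5]) (by simp) (by omega) ?_)
    refine wp_seq (wp_store_eq (16 * γ + (dst + 2)) (2 * K) hS (by simp) (by simp)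
      (by simp [h5]) (by simp [h8]) (by omega) ?_)
    refine wp_store_eq (dst + 4) (s.mem (dst + 4) + 2 * K) hS (by simp) (by simp)
      (by simp) (by simp [h8]) (by omega) ?_
    dsimp only
    rw [← hM₁eq]
    refine htail _ _ ?_ ?_
    · simp
    · intro x _ h1 h2
      rw [Function.update_of_ne h2, Function.update_of_ne h1]
  · intro hc
    have hc' : ¬ (view s.mem dst).cap γ < K := by
      simp [h8] at hc
      omega
    have hM₁eq : M₁ = Function.update s.mem (16 * γ + dst) (s.regs 7) := if_neg hc'
    refine wp_skip ?_
    dsimp only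
    rw [← hM₁eq]
    refine htail _ _ ?_ ?_
    · simp
    · intro x _ h1 h2
      rw [Function.update_of_ne h1]

end DegreeSequence

/-! ### Encoding a group anew -/

namespace DegreeSequence
open Finset WordRAM

/-- Encodes group `r₅` of the store at `src` anew and stores it at `dst`. -/
def rebuild (src dst : ℕ) : Cmd := .seq (encodeGroup src) (installGroup dst)

/-- The chunks are first collected in scratch space, so source and destination may coincide: an
overflow uses store `2` for both, compaction goes from `2` to `7`. -/
theorem wp_rebuild {w b X G src dst γ L₀ sl t : ℕ} {d deg old deg' old' : ℕ → ℕ} {s : NatState}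
    {Q : NatState → ℕ → Prop} (hp : Params w b X) (hT : Tables b s.mem) (ho : src + 4 < 15)
    (hdst : dst + 4 < 15) (h2 : s.regs 2 = b) (h3 : s.regs 3 = L₀) (h4 : s.regs 4 = sl)
    (h5 : s.regs 5 = γ) (hγ : γ < G) (hG : G ≤ X) (hF : (view s.mem src).F γ < 2 ^ b)
    (hsrc : ∀ i < b, (view s.mem src).loc γ i < X ∧
      (view s.mem src).ch ((view s.mem src).loc γ i) < 2 ^ (8 * b) ∧
      (view s.mem src).read b (6 * b) γ i = d i ∧ d i + sl < 2 ^ (6 * b))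
    (hL₀ : 1 ≤ L₀) (hL₀' : L₀ ≤ 6 * b)
    (hinv : (view s.mem dst).Inv b (6 * b) G L₀ sl deg old) (hbump : (view s.mem dst).bump ≤ X)
    (hd : ∀ i < b, deg (γ * b + i) ≤ d i) (hdeg : ∀ i < b, deg' (γ * b + i) = d i)
    (hold : ∀ i < b, old' (γ * b + i) = d i)
    (hne : ∀ γ' ≠ γ, ∀ i < b, deg' (γ' * b + i) = deg (γ' * b + i) ∧
      old' (γ' * b + i) = old (γ' * b + i))
    (hX : storeSpace b G L₀ sl deg' ≤ X)
    (hQ : ∀ r M t', t' ≤ t + 150 + 30 * b + encodeTime b L₀ sl d →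
      (view M dst).Inv b (6 * b) G L₀ sl deg' old' → (view M dst).P γ ≠ 0 →
      (∀ γ' ≠ γ, (view M dst).P γ' = (view s.mem dst).P γ') →
      (∀ x < 14, x < 6 ∨ 11 < x → r x = s.regs x) →
      (∀ a, a % 16 < dst ∨ dst + 4 < a % 16 → a % 16 ≠ 15 → M a = s.mem a) → Q ⟨r, M⟩ t') :
    wp w (16 * X) (rebuild src dst) s t Q := by
  have hbX := hp.lt_table
  have hS := hp.le_word_pow
  refine wp_seq (wp_encodeGroup (d := d) hp hT ho h2 h3 h4 h5 (by omega) hF hsrc hL₀ hL₀' ?_)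
  intro r M t₁ ht₁ henc hK1 hKb hKs hr hM
  have hview : view M dst = view s.mem dst := view_congr (by omega) fun a _ _ => hM a (by omega)
  obtain ⟨hI, hP, hKcap⟩ := hinv.install hγ henc hK1 hKs hd hdeg hold hne
  have htop := hI.top γ hγ
  have hb' := hI.bump_le_storeSpace
  have hcap : (view s.mem dst).cap γ ≤ X :=
    (Nat.le_add_left _ _).trans ((hinv.top γ hγ).trans hbump)
  refine wp_installGroup (γ := γ) (K := r 8) hp hdst (by rw [← h5]; exact hr 5 (by simp) (by simp))
    rfl (by omega) (by omega) ?_ ?_ ?_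
  · rw [hview]; omega
  · rw [hview]
    -- The copied chunks stay inside the area of the group, which ends by the new `bump`, and this
    -- is bounded by `storeSpace`.
    refine (Nat.add_le_add_left hKcap _).trans (le_trans ?_ (htop.trans (hb'.trans hX)))
    simp only [Store.install, Function.update_self]
    exact le_rfl
  · intro r' M' t₂ ht₂ hM' hr' hframe
    rw [hview] at hM'
    refine hQ _ _ _ ?_ (hM' ▸ hI) (hM' ▸ hP) ?_ ?_ ?_
    · have : 30 * r 8 ≤ 30 * b := by omega
      omega
    · intro γ' hγ'
      rw [hM']
      simp only [Store.install]
      rw [Function.update_of_ne hγ']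
    · intro x hx hx'
      rw [hr' x (by omega) (by omega) (by omega) (by omega)]
      exact hr x (by omega) hx'
    · intro a ha ha'
      rw [hframe a ha]
      exact hM a ha'

/-! ### The dynamic degree sequence -/

/-- The length of the code for zero during the construction. -/
def minLength (b : ℕ) : ℕ := Nat.size (b * b)

def numGroups (n b : ℕ) : ℕ := n / b + 1

/-- The memory `M` holds the degrees `deg v` during the construction; `old v` is the degree of `v`
when its group was last encoded. -/
structure DynamicInv (n b : ℕ) (M deg old : ℕ → ℕ) : Prop where
  tables : Tables b M
  minLength : M 13 = minLength b
  vertices : M 14 = n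
  store : (view M 2).Inv b (6 * b) (numGroups n b) (DegreeSequence.minLength b) (b * b) deg old
  empty : (view M 7).Inv b (6 * b) (numGroups n b) 1 0 0 0
  old_le : ∀ v, old v ≤ deg v
  deg_le : ∀ v, deg v ≤ n

structure Setting (n w b X : ℕ) : Prop extends Params w b X where
  n_lt : n + 2 < 2 ^ (4 * b)
  groups_le : numGroups n b ≤ X

theorem numGroups_mul_gt {n b v : ℕ} (hv : v ≤ n) : v / b < numGroups n b :=
  Nat.lt_succ_of_le (Nat.div_le_div_right hv)

/-- Every code, slack included, has length at most `6 * b`; this is the reason for `H = 6 * b`. -/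
theorem add_mul_self_lt {n b d : ℕ} (hb : 1 ≤ b) (hn : n + 2 < 2 ^ (4 * b)) (hd : d ≤ n) :
    d + b * b < 2 ^ (6 * b) := by
  have h1 : b * b < 2 ^ (2 * b) := by
    rw [two_mul, pow_add]
    exact Nat.mul_lt_mul'' Nat.lt_two_pow_self Nat.lt_two_pow_self
  have h3 : 2 ^ (2 * b) ≤ 2 ^ (4 * b) := Nat.pow_le_pow_right (by norm_num) (by omega)
  have h4 : 2 ^ (4 * b) + 2 ^ (4 * b) ≤ 2 ^ (6 * b) := by
    rw [← two_mul, ← pow_succ']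
    exact Nat.pow_le_pow_right (by norm_num) (by omega)
  omega

theorem Setting.add_sq_lt {n w b X d : ℕ} (h : Setting n w b X) (hd : d ≤ n) :
    d + b * b < 2 ^ (6 * b) := add_mul_self_lt h.one_le h.n_lt hd

theorem one_le_minLength {b : ℕ} (hb : 1 ≤ b) : 1 ≤ minLength b :=
  Nat.size_pos.2 (Nat.mul_pos hb hb)

theorem Setting.minLength_le {n w b X : ℕ} (h : Setting n w b X) : minLength b ≤ 6 * b :=
  Nat.size_le.2 (by simpa using h.add_sq_lt (Nat.zero_le n))

/-- For an all-zero group no length exceeds the minimum, so its first encoding takes O(`b`) steps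
without a factor lg lg n. -/
theorem codeLength_zero_minLength (b : ℕ) : codeLength (minLength b) (b * b) 0 = minLength b := by
  simp [codeLength, minLength]

/-- The potential that pays for encoding groups anew. -/
def potential (n b : ℕ) (P old : ℕ → ℕ) : ℕ :=
  ∑ γ ∈ range (numGroups n b), ((if P γ = 0 then 0 else b) + ∑ i ∈ range b, old (γ * b + i))

theorem sum_update_le {G γ : ℕ} {f g : ℕ → ℕ} (hγ : γ < G) (h : ∀ γ' ≠ γ, f γ' = g γ') :
    ∑ x ∈ range G, f x + g γ = ∑ x ∈ range G, g x + f γ := by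
  have hm : γ ∈ range G := mem_range.2 hγ
  rw [← Finset.add_sum_erase _ _ hm, ← Finset.add_sum_erase (range G) g hm,
    Finset.sum_congr rfl fun x hx => h x (Finset.ne_of_mem_erase hx)]
  ring

/-- Increments the degree of the vertex `r₁₂`. -/
def increment : Cmd := .block
  [.load 2 (cst 12),
   .load 3 (cst 13),
   .assign 4 (reg 2 * reg 2),
   .assign 5 (reg 12 / reg 2),
   .assign 6 (reg 12 % reg 2),
   decode 2,
   .ite (.bin .eq (reg 28) (cst 0) + .bin .eq (reg 27 + cst 1) (twoPow (reg 26)))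
    (.block [rebuild 2 2, .assign 6 (reg 12 % reg 2), decode 2])
    .skip,
   .store (reg 22) (reg 23 + twoPow (reg 2 + reg 25))]

theorem view_update_chunk (M : ℕ → ℕ) (o γ i b H : ℕ) :
    view (Function.update M (16 * (view M o).loc γ i + (o + 3))
      (incField b H ((view M o).ch ((view M o).loc γ i)) (slotIdx H ((view M o).F γ) i))) o =
      (view M o).inc b H γ i := by
  set l := (view M o).loc γ i
  set x := incField b H ((view M o).ch l) (slotIdx H ((view M o).F γ) i)
  have h : (view M o).inc b H γ i = ⟨(view M o).F, (view M o).P, (view M o).cap,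
    Function.update (view M o).ch l x, (view M o).bump⟩ := rfl
  rw [h]
  ext y <;> dsimp only [view]
  · rw [Function.update_of_ne (by omega)]
  · rw [Function.update_of_ne (by omega)]
  · rw [Function.update_of_ne (by omega)]
  · by_cases hy : y = l
    · subst hy; rw [Function.update_self, Function.update_self]
    · rw [Function.update_of_ne hy, Function.update_of_ne (by omega)]
  · rw [Function.update_of_ne (by omega)]

theorem DynamicInv.inc_chunk {n b γ i : ℕ} {M deg old : ℕ → ℕ} (h : DynamicInv n b M deg old)
    (hγ : γ < numGroups n b) (hP : (view M 2).P γ ≠ 0) (hi : i < b)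
    (hw : deg (γ * b + i) + 1 < 2 ^ (view M 2).width b (6 * b) γ i)
    (hn : deg (γ * b + i) + 1 ≤ n) :
    DynamicInv n b (Function.update M (16 * (view M 2).loc γ i + (2 + 3))
      (incField b (6 * b) ((view M 2).ch ((view M 2).loc γ i)) (slotIdx (6 * b) ((view M 2).F γ) i)))
      (Function.update deg (γ * b + i) (deg (γ * b + i) + 1)) old where
  tables := h.tables.congr fun a _ => Function.update_of_ne (by omega) _ _
  minLength := by rw [Function.update_of_ne (by omega), h.minLength]
  vertices := by rw [Function.update_of_ne (by omega), h.vertices]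
  store := by
    rw [view_update_chunk]
    exact h.store.inc le_rfl hγ hP hi hw
  empty := by
    rw [view_congr (by omega) fun a _ _ => Function.update_of_ne (by omega) _ _]
    exact h.empty
  old_le v := by
    by_cases hv : v = γ * b + i
    · subst hv
      rw [Function.update_self]
      exact (h.old_le _).trans (Nat.le_succ _)
    · rw [Function.update_of_ne hv]
      exact h.old_le v
  deg_le v := by
    by_cases hv : v = γ * b + i
    · subst hv
      rwa [Function.update_self]
    · rw [Function.update_of_ne hv]
      exact h.deg_le v

/-- The amortized cost is constant: work beyond O(1) is matched by growth of `potential`, which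
counts `b` for each group already encoded and the degrees at the last encodings. In contrast to the
usual convention, the potential measures payments already used up, so its final value bounds the
total. -/
theorem wp_increment {n w b X v t : ℕ} {deg old : ℕ → ℕ} {s : NatState}
    {Q : NatState → ℕ → Prop} (hS : Setting n w b X) (h : DynamicInv n b s.mem deg old)
    (hX : storeSpace b (numGroups n b) (minLength b) (b * b) deg ≤ X)
    (h12 : s.regs 12 = v) (hv : v < n) (hn : deg v + 1 ≤ n)
    (hQ : ∀ r M old' t',
      t' + 1000 * potential n b (view s.mem 2).P old ≤
        t + 500 + 1000 * potential n b (view M 2).P old' →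
      DynamicInv n b M (Function.update deg v (deg v + 1)) old' →
      (∀ x < 2, r x = s.regs x) → Q ⟨r, M⟩ t') :
    wp w (16 * X) increment s t Q := by
  have hp := hS.toParams
  have hb := hp.one_le
  have hw := hp.le_word
  have hlw := hp.lt_word
  have hSw := hp.le_word_pow
  have hbX := hp.lt_table
  have hGX := hS.groups_le
  have hnw : n + 2 < 2 ^ w := hS.n_lt.trans_le (hp.two_pow_le (by omega))
  set γ := v / b with hγdef
  set i := v % b with hidef
  have hγ : γ < numGroups n b := numGroups_mul_gt hv.le
  have hi : i < b := Nat.mod_lt _ (by omega)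
  have hvi : γ * b + i = v := by rw [Nat.mul_comm]; exact Nat.div_add_mod v b
  have h12X : 12 < 16 * X := by omega
  -- Both branches end with the same addition to a field that is not full; the clock is stated
  -- relative to the potential so that this covers the expensive branch too.
  have htail : ∀ (r M old' : ℕ → ℕ) (t' : ℕ),
      t' + 1000 * potential n b (view s.mem 2).P old ≤
        t + 400 + 1000 * potential n b (view M 2).P old' →
      DynamicInv n b M deg old' → (∀ x < 2, r x = s.regs x) → r 2 = b →
      (view M 2).P γ ≠ 0 → deg v + 1 < 2 ^ (view M 2).width b (6 * b) γ i →
      r 22 = 16 * (view M 2).loc γ i + (2 + 3) →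
      r 23 = (view M 2).ch ((view M 2).loc γ i) →
      r 25 = fieldStart b (6 * b) ((view M 2).ch ((view M 2).loc γ i))
        (slotIdx (6 * b) ((view M 2).F γ) i) →
      wp w (16 * X) (.store (reg 22) (reg 23 + twoPow (reg 2 + reg 25))) ⟨r, M⟩ t' Q := by
    intro r M old' t' ht' hD hr h2 hP hwid h22 h23 h25
    have hloc : (view M 2).loc γ i < X :=
      (hD.store.loc_lt_bump hγ hi).trans_le (hD.store.bump_le_storeSpace.trans hX)
    have hend := fieldEnd_le b (6 * b) ((view M 2).ch ((view M 2).loc γ i))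
        (slotIdx (6 * b) ((view M 2).F γ) i)
    refine wp_store_eq (16 * (view M 2).loc γ i + (2 + 3)) (incField b (6 * b)
      ((view M 2).ch ((view M 2).loc γ i)) (slotIdx (6 * b) ((view M 2).F γ) i)) hSw (by simp) ?_
      (by simp [h22]) (by simp [h23, h25, h2, incField]) (by omega) ?_
    · simp [h2, h25]; omega
    · have := hD.inc_chunk hγ hP hi (by rwa [hvi]) (by rwa [hvi])
      rw [hvi] at this
      refine hQ _ _ old' _ ?_ this hr
      rw [view_update_chunk]
      change _ ≤ _ + 1000 * potential n b (view M 2).P old'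
      simp; omega
  have hdec : ∀ (r M old' : ℕ → ℕ) (t' : ℕ) (Q : NatState → ℕ → Prop),
      DynamicInv n b M deg old' → r 2 = b → r 5 = γ → r 6 = i →
      (∀ r' t'', t'' ≤ t' + 100 → (∀ x < 20, r' x = r x) →
        r' 22 = 16 * (view M 2).loc γ i + (2 + 3) →
        r' 23 = (view M 2).ch ((view M 2).loc γ i) →
        r' 25 = fieldStart b (6 * b) ((view M 2).ch ((view M 2).loc γ i))
          (slotIdx (6 * b) ((view M 2).F γ) i) →
        r' 26 = (view M 2).width b (6 * b) γ i → r' 27 = (view M 2).read b (6 * b) γ i →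
        r' 28 = (view M 2).P γ → Q ⟨r', M⟩ t'') →
      wp w (16 * X) (decode 2) ⟨r, M⟩ t' Q := by
    intro r M old' t' Q hD h2 h5 h6 hq
    exact wp_decode hp hD.tables (by omega) h2 h5 h6 (by omega) hi (hD.store.marks_lt hγ)
      ((hD.store.loc_lt_bump hγ hi).trans_le (hD.store.bump_le_storeSpace.trans hX))
      (hD.store.word_lt hγ hi) hq
  refine wp_seq (wp_load_eq 12 b hSw (by simp) (by simp) h12X h.tables.size ?_)
  refine wp_seq (wp_load_eq 13 (minLength b) hSw (by simp) (by simp) (by omega) h.minLength ?_)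
  refine wp_seq (wp_assign_eq (b * b) (by simp) (by simp) ?_)
  refine wp_seq (wp_assign_eq γ ?_ (by simp [h12, hγdef]) ?_)
  · simp [h12]; omega
  refine wp_seq (wp_assign_eq i ?_ (by simp [h12, hidef]) ?_)
  · simp [h12]; omega
  refine wp_seq (hdec _ _ old _ _ h (by simp) (by simp) (by simp) ?_)
  intro r t₁ ht₁ hr h22 h23 h25 h26 h27 h28
  dsimp only at h22 h23 h25 h26 h27 h28
  have ht₁' : t₁ ≤ t + 130 := by
    simp at ht₁; omega
  clear ht₁
  have hr2 : r 2 = b := by rw [hr 2 (by simp)]; simp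
  have hr3 : r 3 = minLength b := by rw [hr 3 (by simp)]; simp
  have hr4 : r 4 = b * b := by rw [hr 4 (by simp)]; simp
  have hr5 : r 5 = γ := by rw [hr 5 (by simp)]; simp
  have hr12 : r 12 = v := by rw [hr 12 (by simp)]; simp [h12]
  have hr01 : ∀ x < 2, r x = s.regs x := by
    intro x hx
    rw [hr x (by omega)]
    simp only [Function.update_apply]
    rw [if_neg (by omega), if_neg (by omega), if_neg (by omega), if_neg (by omega),
      if_neg (by omega)]
  clear hr
  rw [h.store.read_eq hγ hi, hvi] at h27
  have hPX : (view s.mem 2).P γ ≤ X :=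
    (Nat.le_add_right _ _).trans ((h.store.top γ hγ).trans (h.store.bump_le_storeSpace.trans hX))
  have hwidle : (view s.mem 2).width b (6 * b) γ i ≤ 7 * b := by
    have := fieldEnd_le b (6 * b) ((view s.mem 2).ch ((view s.mem 2).loc γ i))
        (slotIdx (6 * b) ((view s.mem 2).F γ) i)
    rw [Store.width]; omega
  have hwidlt : 2 ^ (view s.mem 2).width b (6 * b) γ i < 2 ^ w :=
    Nat.pow_lt_pow_right (by norm_num) (by omega)
  have hdegw : deg v < 2 ^ (view s.mem 2).width b (6 * b) γ i := by
    have := h.store.read_eq hγ hi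
    rw [hvi, Store.read, readField] at this
    rw [← this]
    exact Nat.mod_lt _ (by positivity)
  have h2w : 2 < 2 ^ w := by omega
  refine wp_seq (wp_ite ?_ ?_ ?_ ?_)
  · simp [h26, h27, h28]; omega
  · exact add_test_lt_two_pow (by omega) _ _
  · intro hfull
    have hfull' : (view s.mem 2).P γ = 0 ∨
        deg v + 1 = 2 ^ (view s.mem 2).width b (6 * b) γ i := by
      simp [h26, h27, h28] at hfull
      tauto
    have hlen : ∀ d ≤ n, codeLength (minLength b) (b * b) d ≤ 6 * b := fun d hd =>
      max_le hS.minLength_le (Nat.size_le.2 (hS.add_sq_lt hd))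
    -- Encoding brings the reference degrees up to date for this group only.
    set old' : ℕ → ℕ := fun u => if u / b = γ then deg u else old u with hold'
    have hdivb : ∀ γ' i', i' < b → (γ' * b + i') / b = γ' := by
      intro γ' i' hi'
      rw [Nat.mul_comm, Nat.mul_add_div (by omega), Nat.div_eq_of_lt hi', add_zero]
    refine wp_seq (wp_rebuild (d := fun i => deg (γ * b + i)) (deg := deg) (old := old)
      (deg' := deg) (old' := old') hp h.tables (by omega) (by omega) hr2 hr3 hr4 hr5 hγ hGX
      (h.store.marks_lt hγ) ?_ (one_le_minLength hb) hS.minLength_le h.store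
      (h.store.bump_le_storeSpace.trans hX) (fun _ _ => le_rfl) (fun _ _ => rfl) ?_ ?_ hX ?_)
    · intro i' hi'
      exact ⟨(h.store.loc_lt_bump hγ hi').trans_le (h.store.bump_le_storeSpace.trans hX),
        h.store.word_lt hγ hi', h.store.read_eq hγ hi', hS.add_sq_lt (h.deg_le _)⟩
    · intro i' hi'
      simp only [hold']
      rw [if_pos (hdivb _ _ hi')]
    · intro γ' hγ' i' hi'
      simp only [hold']
      rw [if_neg (by rw [hdivb _ _ hi']; exact hγ')]
      exact ⟨trivial, rfl⟩
    intro r₂ M t₂ ht₂ hinv hPγ hP' hr₂ hM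
    simp only [cost_add, cost_eq, cost_reg, cost_const, cost_twoPow] at ht₂
    dsimp only at hP' hr₂ hM
    have hpot : potential n b (view M 2).P old' +
        ((if (view s.mem 2).P γ = 0 then 0 else b) + ∑ i ∈ range b, old (γ * b + i)) =
        potential n b (view s.mem 2).P old + (b + ∑ i ∈ range b, deg (γ * b + i)) := by
      have := sum_update_le (G := numGroups n b) (γ := γ)
        (f := fun γ => (if (view M 2).P γ = 0 then 0 else b) + ∑ i ∈ range b, old' (γ * b + i))
        (g := fun γ => (if (view s.mem 2).P γ = 0 then 0 else b) + ∑ i ∈ range b, old (γ * b + i))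
        hγ (by
          intro γ' hγ'
          rw [hP' γ' hγ']
          congr 1
          refine Finset.sum_congr rfl fun i' hi' => ?_
          simp only [hold']
          rw [if_neg (by rw [hdivb _ _ (mem_range.1 hi')]; exact hγ')])
      rw [if_neg hPγ] at this
      have h2 : ∑ i ∈ range b, old' (γ * b + i) = ∑ i ∈ range b, deg (γ * b + i) :=
        Finset.sum_congr rfl fun i' hi' => by
          simp only [hold']
          rw [if_pos (hdivb _ _ (mem_range.1 hi'))]
      rw [h2] at this
      exact this
    -- On a first encoding all degrees are zero, the time is O(`b`), and the potential grows by `b`.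
    -- On an overflow the time is O(`b * b`), and the potential grows by at least `b * b`.
    have hpay : t₂ + 1000 * potential n b (view s.mem 2).P old ≤
        t + 290 + 1000 * potential n b (view M 2).P old' := by
      by_cases hP0 : (view s.mem 2).P γ = 0
      · have hz := (h.store.unbuilt γ hγ hP0).2.2
        have he : encodeTime b (minLength b) (b * b) (fun i => deg (γ * b + i)) = b * 210 := by
          rw [encodeTime, Finset.sum_congr rfl (g := fun _ => 210)]
          · simp
          · intro i' hi'
            rw [(hz i' (mem_range.1 hi')).1, codeLength_zero_minLength]
            simp
        have h1 : ∑ i ∈ range b, old (γ * b + i) = 0 :=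
          Finset.sum_eq_zero fun i' hi' => (hz i' (mem_range.1 hi')).2
        rw [if_pos hP0, h1] at hpot
        rw [he] at ht₂
        omega
      · have hfull'' := hfull'.resolve_left hP0
        -- The field had room for the old degree plus `b * b` and is now full, so this vertex alone
        -- has gained at least `b * b`.
        have hwg := h.store.width_gt hγ hP0 hi
        rw [hvi, ← hfull''] at hwg
        have he : encodeTime b (minLength b) (b * b) (fun i => deg (γ * b + i)) ≤
            b * (210 + 60 * b) := by
          rw [encodeTime]
          refine (Finset.sum_le_card_nsmul _ _ (210 + 60 * b) ?_).trans (by simp)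
          intro i' _
          have := hlen _ (h.deg_le (γ * b + i'))
          omega
        have h1 : ∑ i ∈ range b, old (γ * b + i) + b * b ≤ ∑ i ∈ range b, deg (γ * b + i) := by
          have hm : i ∈ range b := mem_range.2 hi
          rw [← Finset.add_sum_erase _ _ hm, ← Finset.add_sum_erase _ (fun i => deg (γ * b + i)) hm,
            hvi]
          have : ∑ x ∈ (range b).erase i, old (γ * b + x) ≤ ∑ x ∈ (range b).erase i, deg (γ * b + x) :=
            Finset.sum_le_sum fun x _ => h.old_le _
          omega
        rw [if_neg hP0] at hpot
        have hbb : b ≤ b * b := Nat.le_mul_of_pos_left _ hb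
        have h3 : b * (210 + 60 * b) = 210 * b + 60 * (b * b) := by ring
        omega
    have hD : DynamicInv n b M deg old' := by
      refine ⟨h.tables.congr fun a ha => hM a (by omega) (by omega), ?_, ?_, hinv, ?_, ?_, h.deg_le⟩
      · rw [hM 13 (by simp) (by simp), h.minLength]
      · rw [hM 14 (by simp) (by simp), h.vertices]
      · rw [view_congr (by omega) fun a ha ha' => hM a (by omega) (by omega)]
        exact h.empty
      · intro u
        simp only [hold']
        split_ifs
        · exact le_rfl
        · exact h.old_le u
    refine wp_seq (wp_assign_eq i ?_ ?_ ?_)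
    · simp [hr₂ 12 (by simp) (by simp), hr₂ 2 (by simp) (by simp), hr12, hr2]; omega
    · simp [hr₂ 12 (by simp) (by simp), hr₂ 2 (by simp) (by simp), hr12, hr2, hidef]
    refine hdec _ _ old' _ _ hD (by simp [hr₂ 2 (by simp) (by simp), hr2])
      (by simp [hr₂ 5 (by simp) (by simp), hr5]) (by simp) ?_
    intro r₃ t₃ ht₃ hr₃ h22' h23' h25' _ _ _
    dsimp only at h22' h23' h25'
    refine htail _ _ old' _ ?_ hD ?_ ?_ hPγ ?_ h22' h23' h25'
    · simp at ht₃
      dsimp only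
      omega
    · intro x hx
      rw [hr₃ x (by omega)]
      dsimp only
      rw [Function.update_of_ne (by omega), hr₂ x (by omega) (by omega), hr01 x hx]
    · rw [hr₃ 2 (by simp)]
      simp [hr₂ 2 (by simp) (by simp), hr2]
    -- The fresh field has room for the present degree plus `b * b`, and `b * b` is at least one, so
    -- the pending increment fits.
    · have h1 := hinv.width_gt hγ hPγ hi
      rw [hvi] at h1
      have h2 : old' v = deg v := if_pos rfl
      have : b ≤ b * b := Nat.le_mul_of_pos_left _ hb
      dsimp only
      omega
  · intro hfull
    have hfull' : (view s.mem 2).P γ ≠ 0 ∧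
        deg v + 1 ≠ 2 ^ (view s.mem 2).width b (6 * b) γ i := by
      simp [h26, h27, h28] at hfull
      tauto
    refine wp_skip (htail _ _ old _ ?_ h hr01 hr2 hfull'.1 (by dsimp only; omega) h22 h23 h25)
    simp; omega

end DegreeSequence

/-! ### Degree queries -/

namespace DegreeSequence
open Finset WordRAM

/-- Returns the number with index `r₀` in the store at `o`. -/
def degreeQuery (o : ℕ) : Cmd := .block
  [.load 2 (cst 12),
   .assign 5 (reg 0 / reg 2),
   .assign 6 (reg 0 % reg 2),
   decode o,
   .assign 0 (reg 27)]

theorem wp_degreeQuery {w b X G L₀ sl o v t : ℕ} {deg old : ℕ → ℕ} {s : NatState}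
    {Q : NatState → ℕ → Prop} (hp : Params w b X) (hT : Tables b s.mem) (ho : o + 3 < 16)
    (h : (view s.mem o).Inv b (6 * b) G L₀ sl deg old) (hX : storeSpace b G L₀ sl deg ≤ X)
    (hGX : G ≤ X) (h0 : s.regs 0 = v) (hvw : v < 2 ^ w) (hv : v / b < G)
    (hQ : ∀ r t', t' ≤ t + 150 → r 0 = deg v → Q ⟨r, s.mem⟩ t') :
    wp w (16 * X) (degreeQuery o) s t Q := by
  have hb := hp.one_le
  have hSw := hp.le_word_pow
  have hlw := hp.lt_word
  have hbX := hp.lt_table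
  have hi : v % b < b := Nat.mod_lt _ (by omega)
  have hvi : v / b * b + v % b = v := by rw [Nat.mul_comm]; exact Nat.div_add_mod v b
  refine wp_seq (wp_load_eq 12 b hSw (by simp) (by simp) (by omega) hT.size ?_)
  refine wp_seq (wp_assign_eq (v / b) ?_ (by simp [h0]) ?_)
  · simp [h0]; omega
  refine wp_seq (wp_assign_eq (v % b) ?_ (by simp [h0]) ?_)
  · simp [h0]; omega
  refine wp_seq (wp_decode (γ := v / b) (i := v % b) hp hT ho (by simp) (by simp) (by simp)
    (by omega) hi (h.marks_lt hv) ((h.loc_lt_bump hv hi).trans_le (h.bump_le_storeSpace.trans hX))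
    (h.word_lt hv hi) ?_)
  intro r t' ht' _ _ _ _ _ h27 _
  refine wp_assign_eq (deg v) (by simp) ?_ ?_
  · have h' := h.read_eq hv hi
    rw [hvi] at h'
    simp only [natEval_reg]
    rw [h27, ← h']
  · refine hQ _ _ ?_ (by simp)
    simp at ht' ⊢
    omega

/-! ### Compaction -/

/-- Encodes all groups of the store at `2` with minimum length one and without slack, and stores
them at `7`. -/
def compact : Cmd := .block
  [.load 2 (cst 12),
   .load 12 (cst 14),
   .assign 3 (cst 1),
   .assign 4 (cst 0),
   .assign 12 (reg 12 / reg 2 + cst 1),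
   .assign 5 (cst 0),
   .loop (.bin .lt (reg 5) (reg 12)) (.seq (rebuild 2 7) (.assign 5 (reg 5 + cst 1)))]

/-- This crude linear bound suffices for the time of compaction, because the degrees sum to O(m). -/
theorem codeLength_one_zero_sub_one_le (d : ℕ) : codeLength 1 0 d - 1 ≤ d := by
  have : Nat.size d ≤ d := Nat.size_le.2 Nat.lt_two_pow_self
  rw [codeLength, Nat.add_zero]
  omega

/-- The numbers in the first `γ` groups. -/
def truncate (b γ : ℕ) (deg : ℕ → ℕ) (v : ℕ) : ℕ := if v / b < γ then deg v else 0

theorem truncate_le (b γ : ℕ) (deg : ℕ → ℕ) (v : ℕ) : truncate b γ deg v ≤ deg v := by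
  unfold truncate; split_ifs <;> omega

theorem mul_add_div_of_lt {γ i b : ℕ} (hi : i < b) : (γ * b + i) / b = γ := by
  rw [Nat.mul_comm, Nat.mul_add_div (by omega), Nat.div_eq_of_lt hi, add_zero]

/-- After `γ` rounds the target store represents `truncate b γ deg`, while the source is untouched.
Each group is installed once, starting from the empty store that `DynamicInv` has kept at `7`. -/
theorem wp_compact {n w b X t : ℕ} {deg old : ℕ → ℕ} {s : NatState}
    {Q : NatState → ℕ → Prop} (hS : Setting n w b X) (h : DynamicInv n b s.mem deg old)
    (hX : storeSpace b (numGroups n b) (minLength b) (b * b) deg ≤ X)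
    (hX' : storeSpace b (numGroups n b) 1 0 deg ≤ X)
    (hQ : ∀ r M t',
      t' ≤ t + 50 + ∑ γ ∈ range (numGroups n b), (410 * b + 10 * ∑ i ∈ range b, deg (γ * b + i)) →
      Tables b M → (view M 7).Inv b (6 * b) (numGroups n b) 1 0 (truncate b (numGroups n b) deg)
        (truncate b (numGroups n b) deg) → Q ⟨r, M⟩ t') :
    wp w (16 * X) compact s t Q := by
  have hp := hS.toParams
  have hb := hp.one_le
  have hSw := hp.le_word_pow
  have hlw := hp.lt_word
  have hbX := hp.lt_table
  have hw := hp.le_word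
  have hGX := hS.groups_le
  have hnw : n + 2 < 2 ^ w := hS.n_lt.trans_le (hp.two_pow_le (by omega))
  refine wp_seq (wp_load_eq 12 b hSw (by simp) (by simp) (by omega) h.tables.size ?_)
  refine wp_seq (wp_load_eq 14 n hSw (by simp) (by simp) (by omega) h.vertices ?_)
  refine wp_seq (wp_assign_eq 1 (by simp) (by simp) ?_)
  refine wp_seq (wp_assign_eq 0 (by simp) (by simp) ?_)
  refine wp_seq (wp_assign_eq (numGroups n b) ?_ (by simp [numGroups]) ?_)
  · simp; omega
  refine wp_seq (wp_assign_eq 0 (by simp) (by simp) ?_)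
  set G := numGroups n b with hG
  refine wp_loop (fun s' t' => ∃ γ ≤ G, s'.regs 5 = γ ∧ s'.regs 2 = b ∧ s'.regs 3 = 1 ∧
    s'.regs 4 = 0 ∧ s'.regs 12 = G ∧
    (∀ a, a % 16 < 7 ∨ 11 < a % 16 → a % 16 ≠ 15 → s'.mem a = s.mem a) ∧
    (view s'.mem 7).Inv b (6 * b) G 1 0 (truncate b γ deg) (truncate b γ deg) ∧
    t' ≤ t + 30 + ∑ γ' ∈ range γ, (410 * b + 10 * ∑ i ∈ range b, deg (γ' * b + i)))
    (fun s' => G - s'.regs 5) ?_ ?_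
  · refine ⟨0, by simp, by simp, by simp, by simp, by simp, by simp, fun _ _ _ => rfl, ?_, ?_⟩
    · have : truncate b 0 deg = 0 := by funext v; simp [truncate]
      rw [this]
      exact h.empty
    · simp
  · rintro ⟨r, M⟩ t₁ ⟨γ, hγ, h5, h2, h3, h4, h12, hM, hI, ht₁⟩
    dsimp only at h5 h2 h3 h4 h12 hM hI ⊢
    have hT : Tables b M := h.tables.congr fun a ha => hM a (by omega) (by omega)
    refine ⟨?_, ?_, ?_, ?_⟩
    · simp [h5, h12]; omega
    · exact test_lt_two_pow (by omega) _
    · intro h0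
      have hγG : γ = G := by simp [h5, h12] at h0; omega
      subst hγG
      refine hQ _ _ _ ?_ hT hI
      simp; omega
    · intro h0
      have hγG : γ < G := by simp [h5, h12] at h0; omega
      have hview : view M 2 = view s.mem 2 := view_congr (by omega) fun a _ _ => hM a (by omega) (by omega)
      refine wp_seq (wp_rebuild (d := fun i => deg (γ * b + i)) (deg := truncate b γ deg)
        (old := truncate b γ deg) (deg' := truncate b (γ + 1) deg)
        (old' := truncate b (γ + 1) deg) (X := X) (γ := γ) hp hT (by omega) (by omega) h2 h3 h4 h5
        hγG hGX ?_ ?_ le_rfl (by omega) hI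
        (hI.bump_le_storeSpace.trans ((storeSpace_mono (truncate_le _ _ _)).trans hX'))
        (fun i _ => truncate_le _ _ _ _) ?_ ?_ ?_
        ((storeSpace_mono (truncate_le _ _ _)).trans hX') ?_)
      · rw [hview]; exact h.store.marks_lt hγG
      · intro i hi
        rw [hview]
        have := hS.add_sq_lt (h.deg_le (γ * b + i))
        exact ⟨(h.store.loc_lt_bump hγG hi).trans_le (h.store.bump_le_storeSpace.trans hX),
          h.store.word_lt hγG hi, h.store.read_eq hγG hi, by omega⟩
      · intro i hi
        rw [truncate, mul_add_div_of_lt hi, if_pos (by omega)]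
      · intro i hi
        rw [truncate, mul_add_div_of_lt hi, if_pos (by omega)]
      · intro γ' hγ' i hi
        simp only [truncate, mul_add_div_of_lt hi]
        simp only [show γ' < γ + 1 ↔ γ' < γ by omega, and_self]
      · intro r' M' t₂ ht₂ hI' _ _ hr' hM'
        dsimp only at hr' hM'
        have h5' := hr' 5 (by simp) (by simp)
        refine wp_assign_eq (γ + 1) (by simp) (by simp [h5', h5]) ⟨⟨γ + 1, hγG, by simp, ?_, ?_, ?_,
          ?_, ?_, hI', ?_⟩, ?_⟩
        · simp [hr' 2, h2]
        · simp [hr' 3, h3]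
        · simp [hr' 4, h4]
        · simp [hr' 12, h12]
        · intro a ha ha'
          dsimp only
          rw [hM' a (by omega) ha', hM a ha ha']
        · rw [Finset.sum_range_succ]
          have he : encodeTime b 1 0 (fun i => deg (γ * b + i)) ≤
              210 * b + 10 * ∑ i ∈ range b, deg (γ * b + i) := by
            rw [encodeTime, Finset.sum_add_distrib, ← Finset.mul_sum]
            have : ∑ i ∈ range b, (codeLength 1 0 (deg (γ * b + i)) - 1) ≤
                ∑ i ∈ range b, deg (γ * b + i) :=
              Finset.sum_le_sum fun i _ => codeLength_one_zero_sub_one_le _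
            simp
            omega
          simp at ht₂ ⊢
          omega
        · simp [h5]; omega

end DegreeSequence

namespace DegreeSequence
open Finset WordRAM

/-! ### Initialization -/

/-- The least `b` with `n + 2 < 2 ^ (4 * b)`. -/
def groupSize (n : ℕ) : ℕ := (Nat.size (n + 2) + 3) / 4

theorem two_le_size (n : ℕ) : 2 ≤ Nat.size (n + 2) := Nat.lt_size.2 (by norm_num)

theorem one_le_groupSize (n : ℕ) : 1 ≤ groupSize n := by
  have := two_le_size n
  rw [groupSize]; omega

theorem div_two_pow_eq_zero_iff {x k : ℕ} : x / 2 ^ k = 0 ↔ Nat.size x ≤ k := by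
  rw [Nat.size_le, Nat.div_eq_zero_iff]
  simp

theorem mul_add_mod_of_lt {γ i b : ℕ} (hi : i < b) : (γ * b + i) % b = i := by
  rw [Nat.mul_comm, Nat.mul_add_mod, Nat.mod_eq_of_lt hi]

/-- Stores the table of `sel`. -/
def selTable : Cmd := .loop (.bin .lt (reg 5) (twoPow (reg 2) * (reg 2 + cst 1))) (.block
  [.assign 6 (reg 5 / (reg 2 + cst 1)),
   .assign 7 (reg 5 % (reg 2 + cst 1)),
   .ite (.bin .eq (reg 7) (cst 0)) (.assign 8 (cst 0))
    (.ite (.bin .eq (reg 6) (cst 0)) (.assign 8 (cst 6 * reg 2)) (.block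
      [.load 8 (cst 16 * (reg 6 / cst 2 * (reg 2 + cst 1) + (reg 7 - reg 6 % cst 2))),
       .assign 8 (cst 1 + reg 8)])),
   .store (cst 16 * reg 5) (reg 8),
   .assign 5 (reg 5 + cst 1)])

/-- The recursion for `sel` refers to the row of `u / 2`, so filling the table in the order of
indices costs O(1) per entry. -/
theorem wp_selTable {w b X t : ℕ} {s : NatState} {Q : NatState → ℕ → Prop} (hp : Params w b X)
    (h2 : s.regs 2 = b) (h5 : s.regs 5 = 0)
    (hQ : ∀ r M t', t' ≤ t + 10 + 100 * (2 ^ b * (b + 1)) → r 2 = b →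
      (∀ u < 2 ^ b, ∀ k ≤ b, M (16 * (u * (b + 1) + k)) = sel (6 * b) u k) →
      (∀ a, a % 16 ≠ 0 → M a = s.mem a) → Q ⟨r, M⟩ t') :
    wp w (16 * X) selTable s t Q := by
  have hb := hp.one_le
  have hSw := hp.le_word_pow
  have hlw := hp.lt_word
  have hw := hp.le_word
  have hbX := hp.lt_table
  have htab := hp.table_le
  refine wp_loop (fun s' t' => ∃ j ≤ 2 ^ b * (b + 1), s'.regs 5 = j ∧ s'.regs 2 = b ∧
    (∀ j' < j, s'.mem (16 * j') = sel (6 * b) (j' / (b + 1)) (j' % (b + 1))) ∧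
    (∀ a, a % 16 ≠ 0 → s'.mem a = s.mem a) ∧ t' ≤ t + 100 * j)
    (fun s' => 2 ^ b * (b + 1) - s'.regs 5) ?_ ?_
  · exact ⟨0, by simp, h5, h2, by simp, fun _ _ => rfl, by simp⟩
  · rintro ⟨r, M⟩ t₁ ⟨j, hj, h5, h2, hM, hfr, ht₁⟩
    dsimp only at h5 h2 hM hfr ⊢
    refine ⟨?_, ?_, ?_, ?_⟩
    · simp [h5, h2]; omega
    · exact test_lt_two_pow (by omega) _
    · intro h0
      have hjG : j = 2 ^ b * (b + 1) := by simp [h5, h2] at h0; omega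
      subst hjG
      refine hQ _ _ _ ?_ h2 ?_ hfr
      · simp; omega
      · intro u hu k hk
        rw [hM _ (table_index_lt hu hk), mul_add_div_of_lt (by omega), mul_add_mod_of_lt (by omega)]
    · intro h0
      have hjG : j < 2 ^ b * (b + 1) := by simp [h5, h2] at h0; omega
      set u := j / (b + 1) with hu
      set k := j % (b + 1) with hk
      have hkb : k ≤ b := Nat.lt_succ_iff.1 (Nat.mod_lt _ (by omega))
      have huk : u * (b + 1) + k = j := by rw [Nat.mul_comm]; exact Nat.div_add_mod j (b + 1)
      have hub : u ≤ j := Nat.div_le_self _ _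
      refine wp_seq (wp_assign_eq u ?_ (by simp [h5, h2, hu]) ?_)
      · simp [h5, h2]; omega
      refine wp_seq (wp_assign_eq k ?_ (by simp [h5, h2, hk]) ?_)
      · simp [h5, h2]; omega
      have htail : ∀ r' t', r' 5 = j → r' 2 = b → r' 8 = sel (6 * b) u k → t' ≤ t₁ + 80 →
          wp w (16 * X) (.block [.store (cst 16 * reg 5) (reg 8), .assign 5 (reg 5 + cst 1)])
            ⟨r', M⟩ t' fun s' t' => (∃ j ≤ 2 ^ b * (b + 1), s'.regs 5 = j ∧ s'.regs 2 = b ∧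
            (∀ j' < j, s'.mem (16 * j') = sel (6 * b) (j' / (b + 1)) (j' % (b + 1))) ∧
            (∀ a, a % 16 ≠ 0 → s'.mem a = s.mem a) ∧ t' ≤ t + 100 * j) ∧
            2 ^ b * (b + 1) - s'.regs 5 < 2 ^ b * (b + 1) - r 5 := by
        intro r' t' h5' h2' h8' ht'
        refine wp_seq (wp_store_eq (16 * j) (sel (6 * b) u k) hSw (by simp) (by simp)
          (by simp [h5']) (by simp [h8']) (by omega) ?_)
        refine wp_assign_eq (j + 1) (by simp) (by simp [h5'])
          ⟨⟨j + 1, hjG, by simp, by simp [h2'], ?_, ?_, ?_⟩, ?_⟩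
        · intro j' hj'
          dsimp only
          by_cases hjj : j' = j
          · subst hjj; simp [hu, hk]
          · rw [Function.update_of_ne (by omega)]
            exact hM _ (by omega)
        · intro a ha
          dsimp only
          rw [Function.update_of_ne (by omega)]
          exact hfr a ha
        · simp; omega
        · simp [h5]; omega
      refine wp_seq (wp_ite ?_ (test_lt_two_pow (by omega) _) ?_ ?_)
      · simp; omega
      · intro hk0
        simp at hk0
        refine wp_assign_eq 0 (by simp) (by simp) (htail _ _ (by simp [h5]) (by simp [h2])
          (by simp [hk0]) (by simp))
      · intro hk0
        simp at hk0
        refine wp_ite ?_ (test_lt_two_pow (by omega) _) ?_ ?_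
        · simp; omega
        · intro hu0
          simp at hu0
          refine wp_assign_eq (6 * b) (by simp) (by simp [h2]) (htail _ _ (by simp [h5])
            (by simp [h2]) (by simp [hu0, sel_zero_left hk0]) (by simp))
        · intro hu0'
          have hu0 : u ≠ 0 := by
            intro h
            simp [h] at hu0'
          -- As `u` is nonzero, row `u / 2` is strictly earlier and already complete.
          have hlt : u / 2 * (b + 1) + (k - u % 2) < j := by
            have : u / 2 * (b + 1) + (b + 1) ≤ u * (b + 1) := by
              have hu1 : u / 2 + 1 ≤ u := Nat.div_lt_self (Nat.pos_of_ne_zero hu0) (by norm_num)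
              calc _ = (u / 2 + 1) * (b + 1) := by ring
                _ ≤ _ := Nat.mul_le_mul_right _ hu1
            omega
          refine wp_seq (wp_load_eq (16 * (u / 2 * (b + 1) + (k - u % 2)))
            (sel (6 * b) (u / 2) (k - u % 2)) hSw ?_ (by simp [h2]) (by omega) ?_ ?_)
          · simp; omega
          · dsimp only
            rw [hM _ hlt, mul_add_div_of_lt (by omega), mul_add_mod_of_lt (by omega)]
          · refine wp_assign_eq (sel (6 * b) u k) (by simp)
              (by simp [sel_of_ne_zero hu0 hk0]) (htail _ _ (by simp [h5])
              (by simp [h2]) (by simp) (by simp))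

/-- Stores the table of `pop`. -/
def popTable : Cmd := .loop (.bin .lt (reg 5) (twoPow (reg 2))) (.block
  [.load 6 (cst 16 * (reg 5 / cst 2) + cst 1),
   .store (cst 16 * reg 5 + cst 1) (reg 5 % cst 2 + reg 6),
   .assign 5 (reg 5 + cst 1)])

/-- Entry `0` is correct from the start since memory is zero; beginning at `1` ensures that `j / 2`
is strictly smaller than `j`. -/
theorem wp_popTable {w b X t : ℕ} {s : NatState} {Q : NatState → ℕ → Prop} (hp : Params w b X)
    (h2 : s.regs 2 = b) (h5 : s.regs 5 = 1) (h1 : s.mem 1 = 0)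
    (hQ : ∀ r M t', t' ≤ t + 10 + 50 * 2 ^ b →
      (∀ u < 2 ^ b, M (16 * u + 1) = pop u) →
      (∀ a, a % 16 ≠ 1 → M a = s.mem a) → Q ⟨r, M⟩ t') :
    wp w (16 * X) popTable s t Q := by
  have hb := hp.one_le
  have hSw := hp.le_word_pow
  have hlw := hp.lt_word
  have hw := hp.le_word
  have hbX := hp.two_pow_le_table
  have h2b : 0 < 2 ^ b := by positivity
  refine wp_loop (fun s' t' => ∃ j ≤ 2 ^ b, 1 ≤ j ∧ s'.regs 5 = j ∧ s'.regs 2 = b ∧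
    (∀ j' < j, s'.mem (16 * j' + 1) = pop j') ∧
    (∀ a, a % 16 ≠ 1 → s'.mem a = s.mem a) ∧ t' ≤ t + 50 * j)
    (fun s' => 2 ^ b - s'.regs 5) ?_ ?_
  · refine ⟨1, h2b, le_rfl, h5, h2, ?_, fun _ _ => rfl, by simp⟩
    intro j' hj'
    obtain rfl : j' = 0 := by omega
    simpa using h1
  · rintro ⟨r, M⟩ t₁ ⟨j, hj, hj1, h5, h2, hM, hfr, ht₁⟩
    dsimp only at h5 h2 hM hfr ⊢
    refine ⟨?_, ?_, ?_, ?_⟩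
    · simp [h5, h2]; omega
    · exact test_lt_two_pow (by omega) _
    · intro h0
      have hjG : j = 2 ^ b := by simp [h5, h2] at h0; omega
      subst hjG
      refine hQ _ _ _ ?_ hM hfr
      simp; omega
    · intro h0
      have hjG : j < 2 ^ b := by simp [h5, h2] at h0; omega
      refine wp_seq (wp_load_eq (16 * (j / 2) + 1) (pop (j / 2)) hSw ?_ (by simp [h5]) (by omega)
        (hM _ (by omega)) ?_)
      · simp [h5]; omega
      refine wp_seq (wp_store_eq (16 * j + 1) (pop j) hSw (by simp) ?_ (by simp [h5])
        (by simp [h5, pop_eq j]) (by omega) ?_)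
      · simp [h5]; omega
      refine wp_assign_eq (j + 1) (by simp) (by simp [h5])
        ⟨⟨j + 1, hjG, by omega, by simp, by simp [h2], ?_, ?_, ?_⟩, ?_⟩
      · intro j' hj'
        dsimp only
        by_cases hjj : j' = j
        · subst hjj; simp
        · rw [Function.update_of_ne (by omega)]
          exact hM _ (by omega)
      · intro a ha
        dsimp only
        rw [Function.update_of_ne (by omega)]
        exact hfr a ha
      · simp; omega
      · simp [h5]; omega

/-- Sets up the degree sequence of a graph with `r₀` vertices and without edges. -/
def setUp : Cmd := .block
  [.assign 2 (cst 1),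
   .loop ((reg 0 + cst 2) >>> (cst 4 * reg 2)) (.assign 2 (reg 2 + cst 1)),
   .assign 3 (cst 0),
   .loop ((reg 2 * reg 2) >>> reg 3) (.assign 3 (reg 3 + cst 1)),
   .store (cst 13) (reg 3),
   .store (cst 14) (reg 0),
   .store (cst 6) (cst 1),
   .store (cst 11) (cst 1),
   .store (cst 12) (reg 2),
   .assign 5 (cst 0),
   selTable,
   .assign 5 (cst 1),
   popTable]

/-- Zeroed memory is already an empty store once `bump` is set to `1`, so initialization does not
visit the groups. -/
theorem Store.Inv.zero (b H G L₀ sl : ℕ) {S : Store} (hF : ∀ γ, S.F γ = 0) (hP : ∀ γ, S.P γ = 0)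
    (hcap : ∀ γ, S.cap γ = 0) (hch : S.ch 0 = 0) (hbump : S.bump = 1) :
    S.Inv b H G L₀ sl 0 0 where
  ch_zero := hch
  bump_pos := hbump.ge
  unbuilt γ _ _ := ⟨hF γ, hcap γ, fun _ _ => ⟨rfl, rfl⟩⟩
  built γ _ h := absurd (hP γ) h
  top γ _ := by rw [hP, hcap]; omega
  disjoint γ _ _ _ _ h := absurd (hP γ) h
  bump_le := by rw [hbump]; omega
  cap_le γ _ := by rw [hcap]; exact Nat.zero_le _

theorem wp_setUp {n w X t : ℕ} {s : NatState} {Q : NatState → ℕ → Prop}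
    (hS : Setting n w (groupSize n) X) (h0 : s.regs 0 = n) (hmem : ∀ a, s.mem a = 0)
    (hQ : ∀ r M t', t' ≤ t + 500 * (2 ^ groupSize n * (groupSize n + 1)) →
      DynamicInv n (groupSize n) M 0 0 → Q ⟨r, M⟩ t') :
    wp w (16 * X) setUp s t Q := by
  set b := groupSize n with hbdef
  have hp := hS.toParams
  have hb := hp.one_le
  have hSw := hp.le_word_pow
  have hlw := hp.lt_word
  have hw := hp.le_word
  have hbX := hp.lt_table
  have hnw : n + 2 < 2 ^ w := hS.n_lt.trans_le (hp.two_pow_le (by omega))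
  have h2b : b < 2 ^ b := Nat.lt_two_pow_self
  have hsize : 4 * b < Nat.size (n + 2) + 4 ∧ Nat.size (n + 2) ≤ 4 * b := by
    rw [hbdef, groupSize]; omega
  have hbb : b * b < 2 ^ w := by
    refine lt_of_le_of_lt ?_ (hS.add_sq_lt (Nat.zero_le n) |>.trans_le (hp.two_pow_le (by omega)))
    omega
  have hL := hS.minLength_le
  have htab : 2 ^ b ≤ 2 ^ b * (b + 1) := Nat.le_mul_of_pos_right _ (by omega)
  refine wp_seq (wp_assign_eq 1 (by simp) (by simp) ?_)
  refine wp_seq (wp_loop (fun s' t' => s'.regs 0 = n ∧ s'.mem = s.mem ∧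
    1 ≤ s'.regs 2 ∧ s'.regs 2 ≤ b ∧ t' ≤ t + 2 + 20 * s'.regs 2) (fun s' => b - s'.regs 2) ?_ ?_)
  · simp [h0, hb]
  rintro ⟨r, M⟩ t₁ ⟨hr0, hM, hr1, hrb, ht₁⟩
  dsimp only at hr0 hM hr1 hrb ht₁ ⊢
  subst hM
  have hnat : ((reg 0 + cst 2) >>> (cst 4 * reg 2)).natEval w r = (n + 2) / 2 ^ (4 * r 2) := by
    simp [hr0]
  rw [hnat]
  refine ⟨by simp [hr0]; omega, (Nat.div_le_self _ _).trans_lt hnw, ?_, ?_⟩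
  swap
  · intro hne
    rw [Ne, div_two_pow_eq_zero_iff] at hne
    refine wp_assign_eq (r 2 + 1) (by simp) (by simp) ?_
    simp [hr0]
    refine ⟨⟨?_, ?_⟩, ?_⟩ <;> omega
  intro hz
  rw [div_two_pow_eq_zero_iff] at hz
  have hr2 : r 2 = b := by omega
  refine wp_seq (wp_assign_eq 0 (by simp) (by simp) ?_)
  refine wp_seq (wp_loop (fun s' t' => s'.regs 0 = n ∧ s'.mem = s.mem ∧ s'.regs 2 = b ∧
    s'.regs 3 ≤ minLength b ∧ t' ≤ t + 20 + 20 * b + 20 * s'.regs 3)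
    (fun s' => minLength b - s'.regs 3) ?_ ?_)
  · simp [hr0, hr2]; omega
  clear ht₁
  rintro ⟨r', M⟩ t₂ ⟨hr0', hM, hr2', hr3', ht₂⟩
  dsimp only at hr0' hM hr2' hr3' ht₂ ⊢
  subst hM
  have hnat : ((reg 2 * reg 2) >>> reg 3).natEval w r' = (b * b) / 2 ^ r' 3 := by
    simp [hr2']
  rw [hnat]
  refine ⟨by simp [hr2']; omega, (Nat.div_le_self _ _).trans_lt hbb, ?_, ?_⟩
  swap
  · intro hne
    rw [Ne, div_two_pow_eq_zero_iff] at hne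
    change ¬ minLength b ≤ _ at hne
    refine wp_assign_eq (r' 3 + 1) (by simp) (by simp) ?_
    simp [hr0', hr2']
    refine ⟨⟨?_, ?_⟩, ?_⟩ <;> omega
  intro hz
  rw [div_two_pow_eq_zero_iff] at hz
  have hr3 : r' 3 = minLength b := le_antisymm hr3' hz
  refine wp_seq (wp_store_eq 13 (minLength b) hSw (by simp) (by simp) (by simp) (by simp [hr3])
    (by omega) ?_)
  refine wp_seq (wp_store_eq 14 n hSw (by simp) (by simp) (by simp) (by simp [hr0'])
    (by omega) ?_)
  refine wp_seq (wp_store_eq 6 1 hSw (by simp) (by simp) (by simp) (by simp) (by omega) ?_)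
  refine wp_seq (wp_store_eq 11 1 hSw (by simp) (by simp) (by simp) (by simp) (by omega) ?_)
  refine wp_seq (wp_store_eq 12 b hSw (by simp) (by simp) (by simp) (by simp [hr2']) (by omega) ?_)
  refine wp_seq (wp_assign_eq 0 (by simp) (by simp) ?_)
  refine wp_seq (wp_selTable hp (by simp [hr2']) (by simp) ?_)
  intro r₃ M₃ t₃ ht₃ hr₃ hsel hM₃
  refine wp_seq (wp_assign_eq 1 (by simp) (by simp) ?_)
  have hM₃1 : M₃ 1 = 0 := by rw [hM₃ 1 (by simp)]; simp [hmem]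
  refine wp_popTable hp (by simp [hr₃]) (by simp) hM₃1 ?_
  intro r₄ M₄ t₄ ht₄ hpop hM₄
  dsimp only at hM₃ hM₄
  have hfr : ∀ a, a % 16 ≠ 0 → a % 16 ≠ 1 → M₄ a = if a = 12 then b else if a = 11 then 1 else
      if a = 6 then 1 else if a = 14 then n else if a = 13 then minLength b else 0 := by
    intro a ha ha'
    rw [hM₄ a ha', hM₃ a ha]
    simp only [Function.update_apply, hmem]
  have hzero : ∀ a, a % 16 ≠ 0 → a % 16 ≠ 1 → a % 16 ≠ 6 → a % 16 ≠ 11 → a % 16 ≠ 12 → a % 16 ≠ 13 →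
      a % 16 ≠ 14 → M₄ a = 0 := by
    intro a h0 h1 h2 h3 h4 h5 h6
    rw [hfr a h0 h1, if_neg (by omega), if_neg (by omega), if_neg (by omega), if_neg (by omega),
      if_neg (by omega)]
  refine hQ _ _ _ ?_ ⟨⟨?_, ?_, hpop⟩, ?_, ?_, ?_, ?_, fun _ => le_rfl, fun _ => Nat.zero_le _⟩
  · simp at ht₃ ht₄
    omega
  · simpa using hfr 12 (by simp) (by simp)
  · intro u hu k hk
    rw [hM₄ _ (by omega)]
    exact hsel u hu k hk
  · simpa using hfr 13 (by simp) (by simp)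
  · simpa using hfr 14 (by simp) (by simp)
  · refine .zero _ _ _ _ _ (fun γ => ?_) (fun γ => ?_) (fun γ => ?_) ?_ ?_
    iterate 4 exact hzero _ (by omega) (by omega) (by omega) (by omega) (by omega) (by omega) (by omega)
    exact (hfr 6 (by simp) (by simp)).trans (by simp)
  · refine .zero _ _ _ _ _ (fun γ => ?_) (fun γ => ?_) (fun γ => ?_) ?_ ?_
    iterate 4 exact hzero _ (by omega) (by omega) (by omega) (by omega) (by omega) (by omega) (by omega)
    exact (hfr 11 (by simp) (by simp)).trans (by simp)

end DegreeSequence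

/-! ### From verified programs to calls on words -/

namespace WordRAM

theorem wp.updates {w S : ℕ} {p : Cmd} {args : List ℕ} {M : ℕ → ℕ} {Q : NatState → ℕ → Prop}
    (h : wp w S p ⟨fun i => args.getD i 0, M⟩ 0 Q) :
    ∃ s t, Updates S p args (fun a => BitVec.ofNat w (M a)) t (fun a => BitVec.ofNat w (s.mem a)) ∧
      Q s t := by
  obtain ⟨t, s, he, hq⟩ := h
  exact ⟨s, t, ⟨_, he⟩, by simpa using hq⟩

theorem wp.returns {w S y T : ℕ} {p : Cmd} {args : List ℕ} {M : ℕ → ℕ}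
    (h : wp w S p ⟨fun i => args.getD i 0, M⟩ 0 fun s t => s.mem = M ∧ s.regs 0 = y ∧ t ≤ T)
    (hy : y < 2 ^ w) :
    ∃ τ ≤ T, Returns S p args (fun a => BitVec.ofNat w (M a)) τ y := by
  obtain ⟨t, s, he, hM, h0, ht⟩ := h
  refine ⟨t, by simpa using ht, fun i => BitVec.ofNat w (s.regs i), ?_, ?_⟩
  · rw [← hM]
    rw [← hM] at he
    exact he
  · simp only
    rw [h0, BitVec.toNat_ofNat, Nat.mod_eq_of_lt hy]

end WordRAM

/-! ### The whole construction -/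

namespace DegreeSequence
open Finset WordRAM

/-- The programs of a degree sequence, except for the insertion. -/
def program (insert : Cmd) : DegreeSequenceProgram where
  init := setUp
  insert := insert
  degree := degreeQuery 2
  compact := compact
  finalDegree := degreeQuery 7

/-- The right-hand side is O(n + m), which bounds the total cost of all encodings during the
insertions. -/
theorem potential_le {n b : ℕ} {P old deg : ℕ → ℕ} (h : ∀ v, old v ≤ deg v) :
    potential n b P old ≤
      ∑ γ ∈ range (numGroups n b), (b + ∑ i ∈ range b, deg (γ * b + i)) := by
  unfold potential
  gcongr with γ _ i _
  · split_ifs <;> omega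
  · exact h _

/-- Here `D k` extends the degrees after `k` insertions to all natural numbers. Degrees only grow,
so `X`, chosen for the final ones, serves throughout; `Xf` bounds the indices used by queries after
compaction. -/
theorem maintains_of_step {n w X Xf b queryTime : ℕ} {time space finalSpace : ℝ}
    {edges : List (Fin n × Fin n)} {deg : ℕ → Fin n → ℕ} {finalDeg : Fin n → ℕ}
    {D : ℕ → ℕ → ℕ} {insert : Cmd} (hb : b = groupSize n) (hS : Setting n w b X)
    (hpf : Params w b Xf) (hGf : numGroups n b ≤ Xf) (hXX : Xf ≤ X) (hD0 : D 0 = 0)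
    (hinsert : ∀ k (hk : k < edges.length), ∀ M old, DynamicInv n b M (D k) old →
      wp w (16 * X) insert
        ⟨fun i => [(edges[k].1 : ℕ), (edges[k].2 : ℕ)].getD i 0, M⟩ 0 fun s t =>
          ∃ old', DynamicInv n b s.mem (D (k + 1)) old' ∧
            t + 1000 * potential n b (view M 2).P old ≤
              1100 + 1000 * potential n b (view s.mem 2).P old')
    (hD : ∀ k ≤ edges.length, ∀ v, D k v ≤ D edges.length v)
    (hdeg : ∀ k ≤ edges.length, ∀ v : Fin n, deg k v = D k v)
    (hfin : ∀ v : Fin n, finalDeg v = D edges.length v)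
    (hX : storeSpace b (numGroups n b) (minLength b) (b * b) (D edges.length) ≤ X)
    (hXf : storeSpace b (numGroups n b) 1 0 (D edges.length) ≤ Xf)
    (htime : ((550 * (2 ^ b * (b + 1)) + 1100 * edges.length + 1500 *
      ∑ γ ∈ range (numGroups n b), (b + ∑ i ∈ range b, D edges.length (γ * b + i)) : ℕ) : ℝ) ≤ time)
    (hspace : (((16 * X + (program insert).numRegs) * w : ℕ) : ℝ) ≤ space)
    (hfinal : (((16 * Xf + (program insert).numRegs) * w : ℕ) : ℝ) ≤ finalSpace)
    (hquery : 150 ≤ queryTime) :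
    (program insert).Maintains n w edges deg finalDeg time space finalSpace queryTime := by
  set len := edges.length with hlen
  have hnw : n + 2 < 2 ^ w :=
    hS.n_lt.trans_le (hS.two_pow_le (by omega))
  obtain ⟨s₀, t₀, hu₀, ht₀, hI₀⟩ := (wp_setUp (n := n) (w := w) (X := X) (t := 0)
    (s := ⟨fun i => [n].getD i 0, fun _ => 0⟩)
    (Q := fun s t => t ≤ 500 * (2 ^ b * (b + 1)) ∧ DynamicInv n b s.mem 0 0)
    (hb ▸ hS) rfl (fun _ => rfl)
    (fun r M t' ht hI => ⟨by rw [hb]; simpa using ht, hb ▸ hI⟩)).updates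
  -- A pair consists of the memory and the ghost function `old`. The hypotheses stand inside the
  -- existential quantifiers, with dummy values where they fail, so that `choose` yields a total
  -- function to iterate.
  have hstep : ∀ k, ∀ p : (ℕ → ℕ) × (ℕ → ℕ), ∃ q : (ℕ → ℕ) × (ℕ → ℕ), ∃ τ : ℕ,
      ∀ hk : k < edges.length, DynamicInv n b p.1 (D k) p.2 →
        Updates (16 * X) insert [(edges[k].1 : ℕ), (edges[k].2 : ℕ)]
          (fun a => BitVec.ofNat w (p.1 a)) τ (fun a => BitVec.ofNat w (q.1 a)) ∧
        DynamicInv n b q.1 (D (k + 1)) q.2 ∧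
        τ + 1000 * potential n b (view p.1 2).P p.2 ≤
          1100 + 1000 * potential n b (view q.1 2).P q.2 := by
    intro k p
    by_cases hk : k < edges.length
    · by_cases hI : DynamicInv n b p.1 (D k) p.2
      · obtain ⟨s, t, hu, old', hI', ht⟩ := (hinsert k hk _ _ hI).updates
        exact ⟨⟨s.mem, old'⟩, t, fun _ _ => ⟨hu, hI', ht⟩⟩
      · exact ⟨p, 0, fun _ h => absurd h hI⟩
    · exact ⟨p, 0, fun h => absurd h hk⟩
  choose next τ hnext using hstep
  let seq : ℕ → (ℕ → ℕ) × (ℕ → ℕ) := fun k => Nat.rec ⟨s₀.mem, 0⟩ next k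
  have hseq : ∀ k ≤ len, DynamicInv n b (seq k).1 (D k) (seq k).2 := by
    intro k
    induction k with
    | zero => intro _; rw [hD0]; exact hI₀
    | succ k ih => exact fun hk => (hnext k (seq k) hk (ih (by omega))).2.1
  -- The amortized bounds telescope; the initial potential can be dropped because it is nonnegative.
  have htot : ∀ k ≤ len, ∑ j ∈ range k, τ j (seq j) ≤
      1100 * k + 1000 * potential n b (view (seq k).1 2).P (seq k).2 := by
    intro k
    induction k with
    | zero => simp
    | succ k ih =>
      intro hk
      have h1 := (hnext k (seq k) hk (hseq k (by omega))).2.2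
      have h2 := ih (by omega)
      change _ ≤ 1100 + 1000 * potential n b (view (seq (k + 1)).1 2).P (seq (k + 1)).2 at h1
      rw [Finset.sum_range_succ]
      omega
  have hIf := hseq len le_rfl
  obtain ⟨s₁, t₁, hu₁, ht₁, hT₁, hI₁⟩ := (wp_compact (n := n) (w := w) (X := X) (t := 0) (b := b)
    (s := ⟨fun i => ([] : List ℕ).getD i 0, (seq len).1⟩)
    (Q := fun s t => t ≤ 50 + ∑ γ ∈ range (numGroups n b), (410 * b + 10 * ∑ i ∈ range b,
      D len (γ * b + i)) ∧ Tables b s.mem ∧ (view s.mem 7).Inv b (6 * b) (numGroups n b) 1 0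
        (truncate b (numGroups n b) (D len)) (truncate b (numGroups n b) (D len)))
    hS hIf hX (hXf.trans hXX)
    (fun r M t' ht hT hI => ⟨by simpa using ht, hT, hI⟩)).updates
  refine ⟨16 * X, 16 * Xf, fun k a => BitVec.ofNat w ((seq k).1 a),
    fun a => BitVec.ofNat w (s₁.mem a), t₀, fun k => τ k (seq k), t₁, hu₀, ?_, ?_, hu₁, ?_, ?_,
    hspace, hfinal⟩
  · intro k
    exact (hnext k (seq k) k.2 (hseq k k.2.le)).1
  · intro k hk v
    have hI := hseq k hk
    have hle := hI.deg_le v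
    obtain ⟨τ, hτ, hr⟩ := (wp_degreeQuery (w := w) (X := X) (t := 0) (v := v)
      (s := ⟨fun i => [(v : ℕ)].getD i 0, (seq k).1⟩)
      (Q := fun s t => s.mem = (seq k).1 ∧ s.regs 0 = D k v ∧ t ≤ 150) hS.toParams hI.tables
      (by omega) hI.store ((storeSpace_mono (hD k hk)).trans hX) hS.groups_le rfl
      (by omega) (numGroups_mul_gt v.2.le)
      (fun r t' ht h0 => ⟨rfl, h0, by simpa using ht⟩)).returns (by omega)
    rw [hdeg k hk v]
    exact ⟨τ, hτ.trans hquery, hr⟩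
  · intro v
    have hle := hIf.deg_le v
    have hvG := numGroups_mul_gt (b := b) v.2.le
    obtain ⟨τ, hτ, hr⟩ := (wp_degreeQuery (w := w) (X := Xf) (t := 0) (v := v)
      (s := ⟨fun i => [(v : ℕ)].getD i 0, s₁.mem⟩)
      (Q := fun s t => s.mem = s₁.mem ∧ s.regs 0 = D len v ∧ t ≤ 150) hpf hT₁
      (by omega) hI₁ ((storeSpace_mono (truncate_le _ _ _)).trans hXf) hGf rfl
      (by omega) hvG
      (fun r t' ht h0 => ⟨rfl, h0.trans (if_pos hvG), by simpa using ht⟩)).returns (by omega)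
    rw [hfin v]
    exact ⟨τ, hτ.trans hquery, hr⟩
  · refine le_trans ?_ htime
    have h1 := htot len le_rfl
    have h2 : potential n b (view (seq len).1 2).P (seq len).2 ≤
        ∑ γ ∈ range (numGroups n b), (b + ∑ i ∈ range b, D len (γ * b + i)) :=
      potential_le hIf.old_le
    have h3 : ∑ γ ∈ range (numGroups n b), (410 * b + 10 * ∑ i ∈ range b, D len (γ * b + i)) ≤
        410 * ∑ γ ∈ range (numGroups n b), (b + ∑ i ∈ range b, D len (γ * b + i)) := by
      rw [Finset.mul_sum]
      refine Finset.sum_le_sum fun γ _ => ?_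
      omega
    have h4 : 1 ≤ 2 ^ b * (b + 1) := Nat.mul_pos (by positivity) (by omega)
    rw [Fin.sum_univ_eq_sum_range (fun j => τ j (seq j))]
    exact_mod_cast (by omega : t₀ + ∑ j ∈ range len, τ j (seq j) + t₁ ≤
      550 * (2 ^ b * (b + 1)) + 1100 * len + 1500 *
      ∑ γ ∈ range (numGroups n b), (b + ∑ i ∈ range b, D len (γ * b + i)))

end DegreeSequence

namespace DegreeSequence
open Finset WordRAM

/-! ### Bounds -/

theorem size_le_lg_add_one {x : ℕ} (hx : 1 ≤ x) : (Nat.size x : ℝ) ≤ lg x + 1 := by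
  have h1 : 0 < Nat.size x := Nat.size_pos.2 hx
  have h2 : 2 ^ (Nat.size x - 1) ≤ x := Nat.lt_size.1 (by omega)
  have h3 : ((Nat.size x - 1 : ℕ) : ℝ) ≤ Real.logb 2 x := by
    rw [Real.le_logb_iff_rpow_le (by norm_num) (by exact_mod_cast hx), Real.rpow_natCast]
    exact_mod_cast h2
  rw [Nat.cast_sub h1] at h3
  rw [lg]
  push_cast at h3
  linarith

theorem lg_le_size {x : ℕ} (hx : 1 ≤ x) : lg x ≤ Nat.size x := by
  rw [lg, Real.logb_le_iff_le_rpow (by norm_num) (by exact_mod_cast hx), Real.rpow_natCast]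
  exact_mod_cast (Nat.lt_size_self x).le

theorem lg_mono {x y : ℝ} (hx : 0 < x) (h : x ≤ y) : lg x ≤ lg y :=
  Real.logb_le_logb_of_le (by norm_num) hx h

/-- This follows from 2 ^ 4 ≤ 3 ^ 3. The value 4/3 is what absorbs the rounding in `groupSize`: the
size is at most lg(n + 2) + 1, and lg(n + 2) + 4 ≤ 4 lg(n + 2). -/
theorem four_thirds_le_lg (n : ℕ) (hn : 1 ≤ n) : 4 / 3 ≤ lg (n + 2) := by
  have h1 : lg 3 ≤ lg (n + 2) := lg_mono (by norm_num) (by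
    have : (1 : ℝ) ≤ n := by exact_mod_cast hn
    linarith)
  have h2 : (4 : ℝ) ≤ Real.logb 2 (3 ^ 3) := by
    rw [Real.le_logb_iff_rpow_le (by norm_num) (by norm_num)]
    norm_num
  rw [Real.logb_pow] at h2
  rw [lg] at h1
  push_cast at h2
  linarith

section
variable {n b : ℕ}

theorem groupSize_le_lg (hn : 1 ≤ n) : (groupSize n : ℝ) ≤ lg (n + 2) := by
  have h1 := size_le_lg_add_one (x := n + 2) (by omega)
  have h2 := four_thirds_le_lg n hn
  have h3 : 4 * groupSize n ≤ Nat.size (n + 2) + 3 := by rw [groupSize]; omega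
  have h4 : (4 : ℝ) * groupSize n ≤ Nat.size (n + 2) + 3 := by exact_mod_cast h3
  push_cast at h1
  linarith

theorem size_le_four_mul_groupSize (n : ℕ) : Nat.size (n + 2) ≤ 4 * groupSize n := by
  rw [groupSize]; omega

theorem lg_le_groupSize (n : ℕ) : lg (n + 2) ≤ 4 * groupSize n := by
  have h1 := lg_le_size (x := n + 2) (by omega)
  have h2 : (Nat.size (n + 2) : ℝ) ≤ 4 * groupSize n := by
    exact_mod_cast size_le_four_mul_groupSize n
  push_cast at h1
  linarith

theorem lt_two_pow_groupSize (n : ℕ) : n + 2 < 2 ^ (4 * groupSize n) :=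
  Nat.size_le.1 (size_le_four_mul_groupSize n)

/-- Rounding up raises the exponent to at most three more than the size, so the power is at most 16
(n + 2), hence at most 48 n. -/
theorem two_pow_groupSize_le (hn : 1 ≤ n) : 2 ^ (4 * groupSize n) ≤ 48 * n := by
  have h1 : 2 ^ (Nat.size (n + 2) - 1) ≤ n + 2 := Nat.lt_size.1 (by have := two_le_size n; omega)
  have h2 : 2 ^ (4 * groupSize n) ≤ 2 ^ (Nat.size (n + 2) - 1 + 4) :=
    Nat.pow_le_pow_right (by norm_num) (by have := two_le_size n; rw [groupSize]; omega)
  rw [pow_add] at h2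
  omega

/-- Together with `two_pow_groupSize_le`: the lookup tables take O(n) bits, and O(n) time to fill.
-/
theorem table_mul_le (b : ℕ) : b * (2 ^ b * (b + 1)) ≤ 2 ^ (4 * b) := by
  have h1 : b + 1 ≤ 2 ^ b := Nat.lt_two_pow_self
  calc b * (2 ^ b * (b + 1)) ≤ 2 ^ b * (2 ^ b * 2 ^ b) := by gcongr; omega
    _ = 2 ^ (3 * b) := by ring
    _ ≤ _ := Nat.pow_le_pow_right (by norm_num) (by omega)

theorem mul_numGroups_le (n b : ℕ) : b * numGroups n b ≤ n + b := by
  have := Nat.mul_div_le n b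
  rw [numGroups, Nat.mul_add]; omega

theorem lt_numGroups_mul (hb : 1 ≤ b) : n < numGroups n b * b := by
  rw [Nat.mul_comm]; exact Nat.lt_mul_div_succ n hb

theorem sum_groups (f : ℕ → ℕ) (b G : ℕ) :
    ∑ γ ∈ range G, ∑ i ∈ range b, f (γ * b + i) = ∑ v ∈ range (G * b), f v := by
  induction G with
  | zero => simp
  | succ G ih => rw [Finset.sum_range_succ, ih, Nat.succ_mul, Finset.sum_range_add]

/-- The factor `b` turns words into bits, up to a constant. Rounding costs one chunk per group, that
is O(`b * G`) bits in total; the rest is the total code length. -/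
theorem mul_storeSpace_le {G L₀ s : ℕ} {deg : ℕ → ℕ} :
    b * storeSpace b G L₀ s deg ≤
      b + 4 * (b * G) + 8 * ∑ v ∈ range (G * b), codeLength L₀ s (deg v) := by
  rw [storeSpace, ← sum_groups (fun v => codeLength L₀ s (deg v)), Nat.mul_add, Nat.mul_one,
    Finset.mul_sum, Finset.mul_sum, Nat.add_assoc]
  have : 4 * (b * G) = ∑ γ ∈ range G, 4 * b := by simp; ring
  rw [this, ← Finset.sum_add_distrib]
  gcongr with γ _
  have := Nat.mul_div_le (2 * ∑ i ∈ range b, codeLength L₀ s (deg (γ * b + i))) b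
  have h : b * (2 * groupSpace b L₀ s fun i => deg (γ * b + i)) =
    4 * b + 4 * (b * ((2 * ∑ i ∈ range b, codeLength L₀ s (deg (γ * b + i))) / b)) := by
    unfold groupSpace; ring
  omega

/-- This coarse worst-case bound serves only to show that addresses fit into a word. -/
theorem storeSpace_le {G L₀ s : ℕ} {deg : ℕ → ℕ} (hb : 1 ≤ b)
    (h : ∀ v, codeLength L₀ s (deg v) ≤ 6 * b) : storeSpace b G L₀ s deg ≤ 1 + 52 * (b * G) := by
  have h1 : ∑ v ∈ range (G * b), codeLength L₀ s (deg v) ≤ G * b * (6 * b) := by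
    refine (Finset.sum_le_card_nsmul _ _ _ fun v _ => h v).trans ?_
    simp
  rw [storeSpace]
  have h2 : 52 * (b * G) = ∑ γ ∈ range G, 52 * b := by simp; ring
  rw [h2]
  refine Nat.add_le_add_left (Finset.sum_le_sum fun γ _ => ?_) 1
  have h3 : ∑ i ∈ range b, codeLength L₀ s (deg (γ * b + i)) ≤ b * (6 * b) :=
    (Finset.sum_le_card_nsmul _ _ _ fun v _ => h _).trans (by simp)
  have h4 : (2 * ∑ i ∈ range b, codeLength L₀ s (deg (γ * b + i))) / b ≤ 12 * b := by
    refine Nat.div_le_of_le_mul ?_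
    calc _ ≤ 2 * (b * (6 * b)) := by omega
      _ = _ := by ring
  rw [groupSpace]
  omega

theorem size_add_le (x y : ℕ) : Nat.size (x + y) ≤ Nat.size x + Nat.size y + 1 := by
  rw [Nat.size_le]
  have h1 := Nat.lt_size_self x
  have h2 := Nat.lt_size_self y
  have h3 : 2 ^ Nat.size x ≤ 2 ^ (Nat.size x + Nat.size y) :=
    Nat.pow_le_pow_right (by norm_num) (by omega)
  have h4 : 2 ^ Nat.size y ≤ 2 ^ (Nat.size x + Nat.size y) :=
    Nat.pow_le_pow_right (by norm_num) (by omega)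
  rw [pow_succ]
  omega

/-- The last group may contain numbers from `n` on; they have degree zero and pay only the fixed
overhead per item. -/
theorem sum_codeLength_le {N L₀ s : ℕ} {deg : ℕ → ℕ} (hN : n ≤ N) (h0 : ∀ v, n ≤ v → deg v = 0) :
    ∑ v ∈ range N, codeLength L₀ s (deg v) ≤
      N * (L₀ + Nat.size s + 1) + ∑ v ∈ range n, Nat.size (deg v) := by
  have h1 : ∑ v ∈ range N, Nat.size (deg v) = ∑ v ∈ range n, Nat.size (deg v) := by
    symm
    refine Finset.sum_subset (Finset.range_subset_range.2 hN) fun v _ hv => ?_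
    rw [h0 v (by simpa using hv), Nat.size_zero]
  rw [← h1]
  calc _ ≤ ∑ v ∈ range N, ((L₀ + Nat.size s + 1) + Nat.size (deg v)) := by
        refine Finset.sum_le_sum fun v _ => ?_
        have := size_add_le (deg v) s
        rw [codeLength]
        omega
    _ = _ := by rw [Finset.sum_add_distrib]; simp

/-- A tangent-type bound for the concave logarithm, from ln q ≤ q - 1 and 1 / ln 2 ≤ 2. Being linear
in `x`, it can be summed over the vertices and takes the place of Jensen's inequality. -/
theorem lg_add_two_le {x a : ℝ} (hx : 0 ≤ x) (ha : 0 < a) :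
    lg (x + 2) ≤ lg a + 2 * ((x + 2) / a) := by
  have h1 : x + 2 = a * ((x + 2) / a) := by field_simp
  have hq : 0 < (x + 2) / a := by positivity
  rw [h1, lg, Real.logb_mul ha.ne' hq.ne', ← h1, ← lg]
  have h2 : Real.logb 2 ((x + 2) / a) ≤ 2 * ((x + 2) / a) := by
    rw [Real.logb, div_le_iff₀ (Real.log_pos (by norm_num))]
    have h3 := Real.log_le_sub_one_of_pos hq
    have h4 := Real.log_two_gt_d9
    nlinarith
  linarith

/-- The tangent bound is applied at a = m / n + 2. The quotients (deg v + 2) / a then sum to at most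
2 n, which contributes 4 n, and rounding to whole bits adds n. -/
theorem sum_size_le {m : ℕ} {deg : ℕ → ℕ} (hn : 1 ≤ n) (h : ∑ v ∈ range n, deg v ≤ 2 * m) :
    ((∑ v ∈ range n, Nat.size (deg v) : ℕ) : ℝ) ≤ n * lg ((m : ℝ) / n + 2) + 5 * n := by
  set a : ℝ := (m : ℝ) / n + 2 with ha
  have hn' : (0 : ℝ) < n := by exact_mod_cast hn
  have ha0 : 0 < a := by positivity
  have h1 : ∀ v, (Nat.size (deg v) : ℝ) ≤ 1 + lg a + 2 * (((deg v : ℝ) + 2) / a) := by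
    intro v
    have h2 := lg_add_two_le (x := deg v) (by positivity) ha0
    have h3 : (Nat.size (deg v) : ℝ) ≤ lg (deg v + 2) + 1 := by
      have h4 : (Nat.size (deg v) : ℝ) ≤ Nat.size (deg v + 2) := by
        exact_mod_cast Nat.size_le_size (by omega)
      have h5 := size_le_lg_add_one (x := deg v + 2) (by omega)
      push_cast at h5
      linarith
    linarith
  push_cast
  refine (Finset.sum_le_sum fun v _ => h1 v).trans ?_
  have h8 : ∑ v ∈ range n, ((deg v : ℝ) + 2) = ∑ v ∈ range n, (deg v : ℝ) + n * 2 := by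
    simp [Finset.sum_add_distrib]
  rw [Finset.sum_add_distrib, ← Finset.mul_sum, ← Finset.sum_div, h8]
  simp only [sum_const, card_range, nsmul_eq_mul]
  have h6 : ((∑ v ∈ range n, deg v : ℕ) : ℝ) ≤ 2 * m := by exact_mod_cast h
  push_cast at h6
  have h7 : (∑ v ∈ range n, (deg v : ℝ) + n * 2) / a ≤ 2 * n := by
    rw [div_le_iff₀ ha0, ha]
    field_simp
    nlinarith
  linarith

theorem one_le_lg {x : ℝ} (hx : 0 ≤ x) : 1 ≤ lg (x + 2) := by
  rw [lg, Real.le_logb_iff_rpow_le (by norm_num) (by linarith)]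
  simpa using hx

/-- This is the source of the term lg lg n: the slack `b * b` has about 2 lg b bits. -/
theorem minLength_le_lg_lg (hn : 1 ≤ n) :
    (minLength (groupSize n) : ℝ) ≤ 2 * lg (lg (n + 2)) + 1 := by
  have hb := one_le_groupSize n
  have h0 : (0 : ℝ) < groupSize n := by exact_mod_cast hb
  have h1 := size_le_lg_add_one (x := groupSize n * groupSize n) (Nat.mul_pos hb hb)
  have h2 := lg_mono h0 (groupSize_le_lg hn)
  push_cast at h1
  rw [lg, Real.logb_mul h0.ne' h0.ne', ← lg] at h1
  rw [minLength]
  linarith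

theorem lg_lg_nonneg (hn : 1 ≤ n) : 0 ≤ lg (lg (n + 2)) :=
  Real.logb_nonneg (by norm_num) (by have := four_thirds_le_lg n hn; linarith)

end
end DegreeSequence

/-! ### Choice of the memory size and the constants -/

namespace DegreeSequence
open Finset WordRAM

theorem setting_of_bounds {n w b G X : ℕ} {D : ℕ → ℕ} (hb : b = groupSize n) (hn : 1 ≤ n)
    (hw : 20 * lg (n + 2) ≤ w) (hD : ∀ v, D v ≤ n) (hG : G = numGroups n b)
    (hX : X = 2 ^ b * (b + 1) + G + storeSpace b G (minLength b) (b * b) D + storeSpace b G 1 0 D) :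
    Setting n w b X := by
  have hb1 : 1 ≤ b := hb ▸ one_le_groupSize n
  have hlt : n + 2 < 2 ^ (4 * b) := hb ▸ lt_two_pow_groupSize n
  have h1 : ∀ d ≤ n, Nat.size (d + b * b) ≤ 6 * b := fun d hd =>
    Nat.size_le.2 (add_mul_self_lt hb1 hlt hd)
  have h2 : storeSpace b G (minLength b) (b * b) D ≤ 1 + 52 * (b * G) :=
    storeSpace_le hb1 fun v => max_le (by simpa [minLength] using h1 0 (Nat.zero_le _))
      (h1 _ (hD v))
  have h3 : storeSpace b G 1 0 D ≤ 1 + 52 * (b * G) :=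
    storeSpace_le hb1 fun v => max_le (by omega)
      ((Nat.size_le_size (by omega)).trans (h1 _ (hD v)))
  have h4 : G ≤ 2 ^ (4 * b) := by
    have : n / b ≤ n := Nat.div_le_self _ _
    rw [hG, numGroups]; omega
  have hb2 : b + 1 ≤ 2 ^ b := Nat.lt_two_pow_self
  have h5 : b * G ≤ 2 ^ (5 * b) := by
    calc b * G ≤ 2 ^ b * 2 ^ (4 * b) := Nat.mul_le_mul (by omega) h4
      _ = _ := by ring
  have h6 : 2 ^ b * (b + 1) ≤ 2 ^ (5 * b) := by
    calc 2 ^ b * (b + 1) ≤ 2 ^ b * 2 ^ b := Nat.mul_le_mul_left _ hb2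
      _ = 2 ^ (2 * b) := by ring
      _ ≤ _ := Nat.pow_le_pow_right (by norm_num) (by omega)
  have h7 : 2 ^ (4 * b) ≤ 2 ^ (5 * b) := Nat.pow_le_pow_right (by norm_num) (by omega)
  -- The bounds above give `X` at most 108 times `2 ^ (5 * b)`, and 16 · 108 is less than `2 ^ 11`.
  have h8 : 2 ^ 11 * 2 ^ (5 * b) ≤ 2 ^ (20 * b) := by
    rw [← pow_add]
    exact Nat.pow_le_pow_right (by norm_num) (by omega)
  have h9 : 20 * b ≤ w := by
    have := groupSize_le_lg hn
    rw [← hb] at this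
    exact_mod_cast (by linarith : (20 : ℝ) * b ≤ w)
  have h10 : 1 ≤ 2 ^ (5 * b) := Nat.one_le_two_pow
  exact { one_le := hb1, le_word := h9, table_le := by omega, le_pow := by omega, n_lt := hlt,
          groups_le := by omega }

/-- This treats both kinds of graphs at once: all that matters is that the degrees sum to at most `2
* m'` and that an insertion has constant amortized cost. Here `X` and `Xf` are the sums of the sizes
of the parts, and they differ by the store used during the construction. -/
theorem maintains_of_insert {insert : Cmd} {c n w m m' R : ℕ} {edges : List (Fin n × Fin n)}
    {deg : ℕ → Fin n → ℕ} {finalDeg : Fin n → ℕ} {D : ℕ → ℕ → ℕ} {d : ℝ}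
    (hR : R = (program insert).numRegs) (hn : 1 ≤ n)
    (hw : 20 * lg (n + 2) ≤ w) (hwc : w ≤ c * lg (n + 2)) (hm : m' ≤ m)
    (hlen : edges.length = m') (hd : d = (m' : ℝ) / n) (hD0 : D 0 = 0)
    (hDn : ∀ v, D edges.length v ≤ n) (hDz : ∀ v, n ≤ v → D edges.length v = 0)
    (hD : ∀ k ≤ edges.length, ∀ v, D k v ≤ D edges.length v)
    (hsum : ∑ v ∈ range n, D edges.length v ≤ 2 * m')
    (hdeg : ∀ k ≤ edges.length, ∀ v : Fin n, deg k v = D k v)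
    (hfin : ∀ v : Fin n, finalDeg v = D edges.length v)
    (hinsert : ∀ b X, Setting n w b X →
      storeSpace b (numGroups n b) (minLength b) (b * b) (D edges.length) ≤ X →
      ∀ k (hk : k < edges.length), ∀ M old, DynamicInv n b M (D k) old →
      wp w (16 * X) insert
        ⟨fun i => [(edges[k].1 : ℕ), (edges[k].2 : ℕ)].getD i 0, M⟩ 0 fun s t =>
          ∃ old', DynamicInv n b s.mem (D (k + 1)) old' ∧
            t + 1000 * potential n b (view M 2).P old ≤
              1100 + 1000 * potential n b (view s.mem 2).P old') :
    (program insert).Maintains n w edges deg finalDeg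
      ((200000 * (c + 1) * (R + 1) : ℕ) * (m + n : ℝ))
      ((200000 * (c + 1) * (R + 1) : ℕ) * (n * (lg (d + 2) + lg (lg (n + 2)))))
      ((200000 * (c + 1) * (R + 1) : ℕ) * (n * lg (d + 2)))
      (200000 * (c + 1) * (R + 1)) := by
  obtain ⟨b, hb⟩ : ∃ b, b = groupSize n := ⟨_, rfl⟩
  obtain ⟨G, hG⟩ : ∃ G, G = numGroups n b := ⟨_, rfl⟩
  have hb1 : 1 ≤ b := hb ▸ one_le_groupSize n
  set Df := D edges.length with hDf
  obtain ⟨Xf, hXf⟩ : ∃ Xf, Xf = 2 ^ b * (b + 1) + G + storeSpace b G 1 0 Df := ⟨_, rfl⟩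
  obtain ⟨X, hX⟩ : ∃ X, X = 2 ^ b * (b + 1) + G + storeSpace b G (minLength b) (b * b) Df +
    storeSpace b G 1 0 Df := ⟨_, rfl⟩
  have hS : Setting n w b X := setting_of_bounds hb hn hw hDn hG hX
  have hpf : Params w b Xf := ⟨hb1, hS.le_word, by omega, by have := hS.le_pow; omega⟩
  have hC : 1 ≤ (c + 1) * (R + 1) := Nat.mul_pos (by omega) (by omega)
  have hpow : 2 ^ (4 * b) ≤ 48 * n := hb ▸ two_pow_groupSize_le hn
  have htab := (table_mul_le b).trans hpow
  have hbn : b ≤ 48 * n := by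
    have : b < 2 ^ b := Nat.lt_two_pow_self
    have : 2 ^ b ≤ 2 ^ (4 * b) := Nat.pow_le_pow_right (by norm_num) (by omega)
    omega
  have hbG : b * G ≤ 49 * n := by
    have := mul_numGroups_le n b
    rw [← hG] at this
    omega
  have hGn : n ≤ G * b := hG ▸ (lt_numGroups_mul hb1).le
  have hsize := sum_size_le hn hsum
  rw [← hd] at hsize
  set T := ∑ v ∈ range n, Nat.size (Df v) with hT
  have hn' : (1 : ℝ) ≤ n := by exact_mod_cast hn
  have hd0 : 0 ≤ d := by rw [hd]; positivity
  have hA := one_le_lg hd0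
  set A := lg (d + 2) with hAdef
  have hB := lg_lg_nonneg hn
  have hml := minLength_le_lg_lg hn
  rw [← hb] at hml
  set B := lg (lg (n + 2)) with hBdef
  have hnA : (n : ℝ) ≤ n * A := by nlinarith
  have hnB : (0 : ℝ) ≤ n * B := by positivity
  have hwb : (w : ℝ) ≤ 4 * c * b := by
    have h1 := lg_le_groupSize n
    rw [← hb] at h1
    calc (w : ℝ) ≤ c * lg (n + 2) := hwc
      _ ≤ c * (4 * b) := by gcongr
      _ = _ := by ring
  have hXf' : b * Xf ≤ 1200 * n + 8 * T := by
    have h1 := mul_storeSpace_le (b := b) (G := G) (L₀ := 1) (s := 0) (deg := Df)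
    have h2 := sum_codeLength_le (L₀ := 1) (s := 0) hGn hDz
    have h3 : G * b = b * G := Nat.mul_comm _ _
    simp only [Nat.size_zero, Nat.add_zero] at h2
    rw [hXf, Nat.mul_add, Nat.mul_add]
    omega
  have hX' : b * X ≤ 1836 * n + 784 * (n * minLength b) + 16 * T := by
    have h1 := mul_storeSpace_le (b := b) (G := G) (L₀ := minLength b) (s := b * b) (deg := Df)
    have h2 := sum_codeLength_le (L₀ := minLength b) (s := b * b) hGn hDz
    have h3 : G * b * (minLength b + Nat.size (b * b) + 1) ≤ 49 * n * (2 * minLength b + 1) := by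
      rw [Nat.mul_comm G, minLength, two_mul]
      gcongr
    have h4 : 49 * n * (2 * minLength b + 1) = 98 * (n * minLength b) + 49 * n := by ring
    have h5 : b * X = b * Xf + b * storeSpace b G (minLength b) (b * b) Df := by
      rw [hX, hXf]; ring
    omega
  have hTA : (T : ℝ) ≤ 6 * (n * A) := by linarith
  have hXfr : (b : ℝ) * Xf ≤ 1300 * (n * A) := by
    have : (b : ℝ) * Xf ≤ 1200 * n + 8 * T := by exact_mod_cast hXf'
    linarith
  have hXr : (b : ℝ) * X ≤ 2800 * (n * (A + B)) := by
    have h1 : (b : ℝ) * X ≤ 1836 * n + 784 * (n * minLength b) + 16 * T := by exact_mod_cast hX'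
    have h2 : (n : ℝ) * minLength b ≤ n * (2 * B + 1) := by gcongr
    linarith
  -- A word has at most `4 * c * b` bits, so the memory takes at most 64 c (b Y) bits. The registers
  -- take at most 4 R c b bits, where `b` is at most 48 n.
  have hspace : ∀ (Y : ℕ) (Z : ℝ), (b : ℝ) * Y ≤ 2800 * Z → n ≤ Z →
      (((16 * Y + R) * w : ℕ) : ℝ) ≤ (200000 * (c + 1) * (R + 1) : ℕ) * Z := by
    intro Y Z hY hZ
    have h1 : (b : ℝ) ≤ 48 * n := by exact_mod_cast hbn
    have hc0 : (0 : ℝ) ≤ c := by positivity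
    have hR0 : (0 : ℝ) ≤ R := by positivity
    have hZ0 : 0 ≤ Z := by linarith
    push_cast
    calc (16 * (Y : ℝ) + R) * w ≤ (16 * Y + R) * (4 * c * b) := by gcongr
      _ = 64 * c * (b * Y) + 4 * (R * c) * b := by ring
      _ ≤ 64 * c * (2800 * Z) + 4 * (R * c) * (48 * Z) := by
        gcongr
        linarith
      _ ≤ 200000 * (c + 1) * (R + 1) * Z := by
        have h2 : 0 ≤ c * Z := by positivity
        have h3 : 0 ≤ R * Z := by positivity
        have h4 : 0 ≤ c * R * Z := by positivity
        nlinarith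
  have hXd : storeSpace b (numGroups n b) (minLength b) (b * b) Df ≤ X := by rw [← hG]; omega
  have hXfd : storeSpace b (numGroups n b) 1 0 Df ≤ Xf := by rw [← hG]; omega
  refine maintains_of_step hb hS hpf (by omega) (by omega) hD0 (hinsert b X hS hXd) hD hdeg
    hfin hXd hXfd ?_ (hR ▸ hspace X _ hXr (by nlinarith))
    (hR ▸ hspace Xf _ (by linarith) hnA) ?_
  · have h1 : ∑ γ ∈ range (numGroups n b), (b + ∑ i ∈ range b, Df (γ * b + i)) ≤
        49 * n + 2 * m := by
      rw [Finset.sum_add_distrib, sum_groups]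
      have h2 : ∑ v ∈ range (numGroups n b * b), Df v = ∑ v ∈ range n, Df v := by
        symm
        refine Finset.sum_subset (Finset.range_subset_range.2 (hG ▸ hGn)) fun v _ hv => ?_
        exact hDz v (by simpa using hv)
      rw [h2, ← hG]
      have h3 : ∑ γ ∈ range G, b = b * G := by simp [Nat.mul_comm]
      omega
    have h2 : 2 ^ b * (b + 1) ≤ b * (2 ^ b * (b + 1)) := Nat.le_mul_of_pos_left _ hb1
    have h3 : 550 * (2 ^ b * (b + 1)) + 1100 * edges.length + 1500 *
        ∑ γ ∈ range (numGroups n b), (b + ∑ i ∈ range b, Df (γ * b + i)) ≤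
        200000 * (m + n) := by omega
    have h4 : 200000 * (m + n) ≤ 200000 * (c + 1) * (R + 1) * (m + n) :=
      Nat.mul_le_mul_right _ (by rw [Nat.mul_assoc]; omega)
    exact_mod_cast h3.trans h4
  · rw [Nat.mul_assoc]; omega

end DegreeSequence

namespace DegreeSequence
open Finset WordRAM

/-! ### Degrees -/

/-- The function on all natural numbers that is zero from `n` on. -/
def extend {n : ℕ} (f : Fin n → ℕ) (v : ℕ) : ℕ := if h : v < n then f ⟨v, h⟩ else 0

section
variable {n : ℕ}

@[simp] theorem extend_coe (f : Fin n → ℕ) (v : Fin n) : extend f v = f v := dif_pos v.2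

theorem extend_of_le (f : Fin n → ℕ) {v : ℕ} (h : n ≤ v) : extend f v = 0 := dif_neg (by omega)

theorem extend_zero : extend (0 : Fin n → ℕ) = 0 := by
  funext v; simp [extend]

theorem extend_mono {f g : Fin n → ℕ} (h : ∀ v, f v ≤ g v) (v : ℕ) : extend f v ≤ extend g v := by
  unfold extend
  split_ifs
  · exact h _
  · exact le_rfl

theorem extend_le {f : Fin n → ℕ} {N : ℕ} (h : ∀ v, f v ≤ N) (v : ℕ) : extend f v ≤ N := by
  unfold extend
  split_ifs
  · exact h _
  · exact Nat.zero_le _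

theorem update_extend (f : Fin n → ℕ) (u : Fin n) :
    Function.update (extend f) u (extend f u + 1) = extend (Function.update f u (f u + 1)) := by
  funext v
  by_cases hv : v < n
  · lift v to Fin n using hv
    by_cases h : v = u
    · subst h; simp
    · simp [h, Function.update_of_ne (Fin.val_ne_of_ne h)]
  · rw [Function.update_of_ne (by omega), extend_of_le _ (by omega), extend_of_le _ (by omega)]

theorem sum_extend (f : Fin n → ℕ) : ∑ v ∈ range n, extend f v = ∑ v, f v := by
  rw [Finset.sum_range]
  exact Finset.sum_congr rfl fun v _ => extend_coe f v

theorem sum_update_add_one (f : Fin n → ℕ) (u : Fin n) :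
    ∑ v, Function.update f u (f u + 1) v = ∑ v, f v + 1 := by
  rw [Finset.sum_update_of_mem (mem_univ u), ← Finset.add_sum_erase _ f (mem_univ u),
    Finset.sdiff_singleton_eq_erase]
  ring

theorem ncard_fin_le (s : Set (Fin n)) : s.ncard ≤ n := by
  simpa using Set.ncard_le_card s

variable {edges : List (Fin n × Fin n)}

theorem outDegreeAfter_zero : outDegreeAfter edges 0 = 0 := by
  funext v; simp [outDegreeAfter]

/-- Without repetitions in the list, the head of the new arc is a new out-neighbour, so counting
insertions agrees with counting neighbours. -/
theorem outDegreeAfter_succ (h : edges.Nodup) {k : ℕ} (hk : k < edges.length) :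
    outDegreeAfter edges (k + 1) = Function.update (outDegreeAfter edges k) edges[k].1
      (outDegreeAfter edges k edges[k].1 + 1) := by
  have hnot : edges[k] ∉ edges.take k := by
    rw [← List.take_append_drop k edges, List.nodup_append] at h
    intro hm
    exact h.2.2 _ hm edges[k]
      (by rw [List.drop_eq_getElem_cons hk]; exact List.mem_cons_self) rfl
  funext v
  by_cases hv : v = edges[k].1
  · subst hv
    rw [Function.update_self, outDegreeAfter, outDegreeAfter,
      ← Set.ncard_insert_of_notMem (a := edges[k].2) (by simpa using hnot)]
    congr 1
    ext u
    rw [← List.take_append_getElem hk]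
    simp only [Set.mem_ofPred_eq, List.mem_append, List.mem_singleton, Set.mem_insert_iff]
    constructor
    · rintro (h1 | h1)
      · exact .inr h1
      · exact .inl (congrArg Prod.snd h1)
    · rintro (h1 | h1)
      · subst h1; exact .inr rfl
      · exact .inl h1
  · rw [Function.update_of_ne hv, outDegreeAfter, outDegreeAfter]
    congr 1
    ext u
    rw [← List.take_append_getElem hk]
    simp only [Set.mem_ofPred_eq, List.mem_append, List.mem_singleton]
    constructor
    · rintro (h1 | h1)
      · exact h1
      · exact absurd (congrArg Prod.fst h1) hv
    · exact .inl

theorem outDegreeAfter_mono {k : ℕ} (v : Fin n) :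
    outDegreeAfter edges k v ≤ outDegreeAfter edges edges.length v := by
  refine Set.ncard_le_ncard (fun u hu => ?_)
  rw [Set.mem_ofPred_eq, List.take_length]
  exact List.mem_of_mem_take hu

theorem sum_outDegreeAfter (h : edges.Nodup) {k : ℕ} (hk : k ≤ edges.length) :
    ∑ v, outDegreeAfter edges k v = k := by
  induction k with
  | zero => simp [outDegreeAfter_zero]
  | succ k ih => rw [outDegreeAfter_succ h hk, sum_update_add_one, ih (by omega)]

theorem degreeAfter_zero : degreeAfter edges 0 = 0 := by
  funext v; simp [degreeAfter]

/-- The ends have to be distinct: two increments would count a loop twice, whereas it yields only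
one neighbour. Since no unordered pair repeats, each end gains a new neighbour. -/
theorem degreeAfter_succ (h : (edges.map fun p => s(p.1, p.2)).Nodup) {k : ℕ}
    (hk : k < edges.length) (hne : edges[k].1 ≠ edges[k].2) :
    degreeAfter edges (k + 1) = Function.update (Function.update (degreeAfter edges k) edges[k].1
      (degreeAfter edges k edges[k].1 + 1)) edges[k].2
      (Function.update (degreeAfter edges k) edges[k].1
      (degreeAfter edges k edges[k].1 + 1) edges[k].2 + 1) := by
  have hnot : s(edges[k].1, edges[k].2) ∉ (edges.take k).map fun p => s(p.1, p.2) := by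
    rw [← List.take_append_drop k edges, List.map_append, List.nodup_append] at h
    intro hm
    exact h.2.2 _ hm s(edges[k].1, edges[k].2) (List.mem_map.2 ⟨edges[k],
      by rw [List.drop_eq_getElem_cons hk]; exact List.mem_cons_self, rfl⟩) rfl
  have hmem : ∀ v u : Fin n, s(v, u) ∈ ((edges.take (k + 1)).map fun p => s(p.1, p.2)) ↔
      s(v, u) ∈ ((edges.take k).map fun p => s(p.1, p.2)) ∨
      s(v, u) = s(edges[k].1, edges[k].2) := by
    intro v u
    rw [← List.take_append_getElem hk, List.map_append, List.mem_append]
    simp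
  generalize edges[k] = p at *
  obtain ⟨x, y⟩ := p
  dsimp only at *
  funext v
  rw [Function.update_of_ne hne.symm]
  by_cases hx : v = x
  · subst hx
    rw [Function.update_of_ne hne, Function.update_self, degreeAfter, degreeAfter,
      ← Set.ncard_insert_of_notMem (a := y) hnot]
    congr 1
    ext u
    simp only [Set.mem_ofPred_eq, hmem, Set.mem_insert_iff]
    rw [Sym2.congr_right]
    tauto
  by_cases hy : v = y
  · subst hy
    rw [Function.update_self, degreeAfter, degreeAfter,
      ← Set.ncard_insert_of_notMem (a := x) (by rw [Sym2.eq_swap] at hnot; exact hnot)]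
    congr 1
    ext u
    simp only [Set.mem_ofPred_eq, hmem, Set.mem_insert_iff]
    rw [Sym2.eq_swap (a := x), Sym2.congr_right]
    tauto
  · rw [Function.update_of_ne hy, Function.update_of_ne hx, degreeAfter, degreeAfter]
    congr 1
    ext u
    simp only [Set.mem_ofPred_eq, hmem, Sym2.eq_iff]
    tauto

theorem degreeAfter_mono {k : ℕ} (v : Fin n) :
    degreeAfter edges k v ≤ degreeAfter edges edges.length v := by
  refine Set.ncard_le_ncard (fun u hu => ?_)
  rw [Set.mem_ofPred_eq, List.take_length]
  exact List.map_subset _ (List.take_subset k edges) hu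

theorem EnumeratesEdges.ne {H : SimpleGraph (Fin n)} (h : EnumeratesEdges H edges) {k : ℕ}
    (hk : k < edges.length) : edges[k].1 ≠ edges[k].2 := by
  have := (h.2 s(edges[k].1, edges[k].2)).1
    (List.mem_map.2 ⟨edges[k], List.getElem_mem hk, rfl⟩)
  exact (SimpleGraph.mem_edgeSet _).1 this |>.ne

theorem sum_degreeAfter {H : SimpleGraph (Fin n)} (h : EnumeratesEdges H edges) {k : ℕ}
    (hk : k ≤ edges.length) : ∑ v, degreeAfter edges k v = 2 * k := by
  induction k with
  | zero => simp [degreeAfter_zero]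
  | succ k ih =>
    rw [degreeAfter_succ h.1 hk (EnumeratesEdges.ne h hk), sum_update_add_one, sum_update_add_one,
      ih (by omega)]
    ring

theorem EnumeratesEdges.length_eq {H : SimpleGraph (Fin n)} (h : EnumeratesEdges H edges) :
    edges.length = H.edgeSet.ncard := by
  have h1 : H.edgeSet = ((edges.map fun p => s(p.1, p.2)).toFinset : Set (Sym2 (Fin n))) := by
    ext e
    rw [List.coe_toFinset, Set.mem_ofPred_eq]
    exact (h.2 e).symm
  rw [h1, Set.ncard_coe_finset, List.toFinset_card_of_nodup h.1, List.length_map]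

theorem EnumeratesArcs.length_eq {H : Digraph (Fin n)} (h : EnumeratesArcs H edges) :
    edges.length = numArcs H := by
  have h1 : {p : Fin n × Fin n | H.Adj p.1 p.2} = (edges.toFinset : Set (Fin n × Fin n)) := by
    ext p
    rw [List.coe_toFinset, Set.mem_ofPred_eq, Set.mem_ofPred_eq]
    exact (h.2 p).symm
  rw [numArcs, h1, Set.ncard_coe_finset, List.toFinset_card_of_nodup h.1]

theorem EnumeratesEdges.ncard_neighborSet {H : SimpleGraph (Fin n)} (h : EnumeratesEdges H edges)
    (v : Fin n) : (H.neighborSet v).ncard = degreeAfter edges edges.length v := by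
  rw [degreeAfter]
  congr 1
  ext u
  rw [Set.mem_ofPred_eq, List.take_length, h.2]
  rfl

theorem EnumeratesArcs.ncard_adj {H : Digraph (Fin n)} (h : EnumeratesArcs H edges)
    (v : Fin n) : {u | H.Adj v u}.ncard = outDegreeAfter edges edges.length v := by
  rw [outDegreeAfter]
  congr 1
  ext u
  rw [Set.mem_ofPred_eq, Set.mem_ofPred_eq, List.take_length, h.2]

end

/-! ### Insertion of edges -/

/-- Increments the degree of the vertex `rₓ`. -/
def incrementAt (x : ℕ) : Cmd := .block [.assign 12 (reg x), increment]

/-- Inserts an edge between the vertices `r₀` and `r₁`. -/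
def insertEdge : Cmd := .seq (incrementAt 0) (incrementAt 1)

theorem wp_incrementAt {n w b X t x : ℕ} {f : Fin n → ℕ} {u : Fin n} {old : ℕ → ℕ} {s : NatState}
    {Q : NatState → ℕ → Prop} (hS : Setting n w b X) (h : DynamicInv n b s.mem (extend f) old)
    (hX : storeSpace b (numGroups n b) (minLength b) (b * b) (extend f) ≤ X)
    (hx : s.regs x = u) (hn : f u + 1 ≤ n)
    (hQ : ∀ r M old' t',
      t' + 1000 * potential n b (view s.mem 2).P old ≤
        t + 550 + 1000 * potential n b (view M 2).P old' →
      DynamicInv n b M (extend (Function.update f u (f u + 1))) old' →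
      (∀ x < 2, r x = s.regs x) → Q ⟨r, M⟩ t') :
    wp w (16 * X) (incrementAt x) s t Q := by
  refine wp_seq (wp_assign_eq u (by simp) (by simp [hx]) ?_)
  refine wp_increment (v := u) hS h hX (by simp) u.2 (by simpa using hn) ?_
  intro r M old' t' ht' hD hr
  rw [update_extend] at hD
  refine hQ r M old' t' ?_ hD fun x hx => ?_
  · simp at ht' ⊢
    omega
  · rw [hr x hx]
    exact Function.update_of_ne (by omega) _ _

end DegreeSequence

/-! ### The main theorem -/

open DegreeSequence

theorem mainTheorem4 :
    -- undirected graphs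
    (∃ (P : DegreeSequenceProgram) (κ : ℕ), ∀ c : ℕ, ∃ C : ℕ, ∀ n w : ℕ, 1 ≤ n →
      κ * lg (n + 2) ≤ w → w ≤ c * lg (n + 2) →
      ∀ G G' : SimpleGraph (Fin n), G' ≤ G →
      ∀ m m' : ℕ, m = G.edgeSet.ncard → m' = G'.edgeSet.ncard →
      ∀ d' : ℝ, d' = (m' : ℝ) / n →
      ∀ edges : List (Fin n × Fin n), EnumeratesEdges G' edges →
        P.Maintains n w edges (degreeAfter edges) (fun v => (G'.neighborSet v).ncard)
          (C * (m + n : ℝ))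
          (C * (n * (lg (d' + 2) + lg (lg (n + 2)))))
          (C * (n * lg (d' + 2)))
          C) ∧
    -- directed graphs
    (∃ (P : DegreeSequenceProgram) (κ : ℕ), ∀ c : ℕ, ∃ C : ℕ, ∀ n w : ℕ, 1 ≤ n →
      κ * lg (n + 2) ≤ w → w ≤ c * lg (n + 2) →
      ∀ G G' : Digraph (Fin n), G' ≤ G →
      ∀ m m' : ℕ, m = numArcs G → m' = numArcs G' →
      ∀ d' : ℝ, d' = (m' : ℝ) / n →
      ∀ edges : List (Fin n × Fin n), EnumeratesArcs G' edges →
        P.Maintains n w edges (outDegreeAfter edges) (fun v => {u | G'.Adj v u}.ncard)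
          (C * (m + n : ℝ))
          (C * (n * (lg (d' + 2) + lg (lg (n + 2)))))
          (C * (n * lg (d' + 2)))
          C) := by
  -- The factor 20 together with `groupSize_le_lg` gives `20 * b ≤ w`, as required in `Params`.
  refine ⟨⟨program insertEdge, 20, fun c =>
    ⟨200000 * (c + 1) * ((program insertEdge).numRegs + 1), ?_⟩⟩,
    ⟨program (incrementAt 0), 20, fun c =>
    ⟨200000 * (c + 1) * ((program (incrementAt 0)).numRegs + 1), ?_⟩⟩⟩
  · intro n w hn hw hwc G G' hG m m' hm hm' d' hd edges hE
    have hlen : edges.length = m' := hm' ▸ EnumeratesEdges.length_eq hE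
    refine maintains_of_insert (m := m) (m' := m') (D := fun k => extend (degreeAfter edges k)) rfl hn
      (by exact_mod_cast hw) hwc ?_ hlen hd ?_ (extend_le fun v => ncard_fin_le _)
      (fun v hv => extend_of_le _ hv) (fun k _ => extend_mono degreeAfter_mono) ?_
      (fun k _ v => (extend_coe _ v).symm) ?_ ?_
    · rw [hm, hm']
      exact Set.ncard_le_ncard (SimpleGraph.edgeSet_mono hG)
    · simp only [degreeAfter_zero, extend_zero]
    · rw [sum_extend, sum_degreeAfter hE le_rfl, hlen]
    · intro v
      rw [extend_coe]
      exact EnumeratesEdges.ncard_neighborSet hE v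
    · intro b X hS hX k hk M old hD
      have hne := EnumeratesEdges.ne hE hk
      have hsucc := degreeAfter_succ hE.1 hk hne
      have hle : ∀ v, degreeAfter edges (k + 1) v ≤ n := fun v => ncard_fin_le _
      have hle' : ∀ v, degreeAfter edges k v ≤ degreeAfter edges edges.length v := degreeAfter_mono
      have hle'' : ∀ v, degreeAfter edges (k + 1) v ≤ degreeAfter edges edges.length v :=
        degreeAfter_mono
      rw [hsucc] at hle hle'' ⊢
      -- Between the two increments the stored numbers are not the degrees of a graph; they still
      -- lie below the final degrees, so the same space bound applies.
      have hf : ∀ v, Function.update (degreeAfter edges k) edges[k].1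
          (degreeAfter edges k edges[k].1 + 1) v ≤ degreeAfter edges edges.length v := by
        intro v
        by_cases hv : v = edges[k].2
        · rw [hv, Function.update_of_ne hne.symm]
          exact hle' _
        · have := hle'' v
          rwa [Function.update_of_ne hv] at this
      refine wp_seq (wp_incrementAt (u := edges[k].1) hS hD
        ((storeSpace_mono (extend_mono hle')).trans hX) rfl ?_ ?_)
      · have := hle edges[k].1
        rwa [Function.update_of_ne hne, Function.update_self] at this
      intro r M₁ old₁ t₁ ht₁ hD₁ hr
      refine wp_incrementAt (u := edges[k].2) hS hD₁
        ((storeSpace_mono (extend_mono hf)).trans hX) (hr 1 (by simp)) ?_ ?_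
      · have := hle edges[k].2
        rwa [Function.update_self] at this
      intro r M₂ old₂ t₂ ht₂ hD₂ _
      refine ⟨old₂, hD₂, ?_⟩
      dsimp only at ht₁ ht₂ ⊢
      omega
  · intro n w hn hw hwc G G' hG m m' hm hm' d' hd edges hE
    have hlen : edges.length = m' := hm' ▸ EnumeratesArcs.length_eq hE
    refine maintains_of_insert (m := m) (m' := m') (D := fun k => extend (outDegreeAfter edges k)) rfl hn
      (by exact_mod_cast hw) hwc ?_ hlen hd ?_ (extend_le fun v => ncard_fin_le _)
      (fun v hv => extend_of_le _ hv) (fun k _ => extend_mono outDegreeAfter_mono) ?_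
      (fun k _ v => (extend_coe _ v).symm) ?_ ?_
    · rw [hm, hm']
      exact Set.ncard_le_ncard fun p hp => hG hp
    · simp only [outDegreeAfter_zero, extend_zero]
    · rw [sum_extend, sum_outDegreeAfter hE.1 le_rfl, hlen]
      omega
    · intro v
      rw [extend_coe]
      exact EnumeratesArcs.ncard_adj hE v
    · intro b X hS hX k hk M old hD
      have hle : outDegreeAfter edges (k + 1) edges[k].1 ≤ n := ncard_fin_le _
      rw [outDegreeAfter_succ hE.1 hk] at hle ⊢
      rw [Function.update_self] at hle
      refine wp_incrementAt (u := edges[k].1) hS hD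
        ((storeSpace_mono (extend_mono outDegreeAfter_mono)).trans hX) rfl hle ?_
      intro r M₁ old₁ t₁ ht₁ hD₁ _
      refine ⟨old₁, hD₁, ?_⟩
      dsimp only at ht₁ ⊢
      omega
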